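/- Let $d\ge1$, $m\ge0$, $c>0$, $\Delta t>0$. Consider the wave system $p_t=c\,\nabla\cdot\mathbf v$, $\mathbf v_t=c\,\nabla p$ with periodic boundary conditions on a uniform grid with mesh sizes $h_i>0$ and $K_i\ge1$ cells in direction $i$ (so all functions have period $K_ih_i$ in $x_i$). The primary nodes are $x_{\min}+(j_1h_1,\dots,j_dh_d)$, $j\in\mathbb Z^d$; the dual nodes are the cell centres, obtained by shifting all indices by $\tfrac12$. Assume the CFL condition $c\,\Delta t<h_i$ for all $i$. The Hermite-leapfrog scheme carries periodic nodal values of all derivatives $\partial^\alpha$, $0\le\alpha_i\le m$: of $p^h(\cdot,n\Delta t)$ on the primary grid and of $\mathbf v^h(\cdot,(n-\frac12)\Delta t)$ on the dual grid, $n\in\mathbb N$. On each cell of the respective grid the functions $p^h$ and $v_i^h$ are the polynomials of degree at most $2m+1$ in each variable that interpolate these data at the $2^d$ corners. Starting from arbitrary periodic nodal data for $p^h(\cdot,0)$ and $\mathbf v^h(\cdot,-\frac12\Delta t)$, the nodal data are updated, for all $\alpha$ with $0\le\alpha_i\le m$, by $$\partial^\alpha p^h(x,t+\Delta t)=\partial^\alpha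 p^h(x,t)+2\sum_{j\ \mathrm{odd}}\frac{(c\Delta t/2)^j}{j!}\,\partial^\alpha\Delta^{(j-1)/2}\,\nabla\cdot\mathbf v^h(x,t+\tfrac{\Delta t}2)$$ at the primary nodes $x$ (with $t=n\Delta t$), and $$\partial^\alpha \mathbf v^h(x,t+\tfrac{\Delta t}2)=\partial^\alpha \mathbf v^h(x,t-\tfrac{\Delta t}2)+2\sum_{j\ \mathrm{odd}}\frac{(c\Delta t/2)^j}{j!}\,\partial^\alpha\Delta^{(j-1)/2}\,\nabla p^h(x,t)$$ at the dual nodes $x$. The sums are finite, since $p^h,\mathbf v^h$ are polynomials near those nodes. For periodic functions let $\mathcal S_\pm$ be the Fourier multipliers with symbols $e^{\pm ic|\mathbf k|\Delta t/2}$, where $\mathbf k=(2\pi n_i/(K_ih_i))_i$, $n\in\mathbb Z^d$; let $\mathcal G$ (from scalar to vector fields) be the multiplier with symbol $\hat{\mathbf k}=\mathbf k/|\mathbf k|$, where $\hat{\mathbf 0}$ is an arbitrarily fixed real unit vector, and let $\mathcal G^*$ be its adjoint, with symbol $\hat{\mathbf k}\,\cdot$. Put $\mathbf v^h_d=\mathcal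 G\mathcal G^*\mathbf v^h$, $\mathbf v^h_c=\mathbf v^h-\mathbf v^h_d$ and $$P^h_\pm(\cdot,t)=p^h(\cdot,t)\mp\mathcal S_\pm\mathcal G^*\mathbf v^h_d(\cdot,t-\tfrac{\Delta t}2),\qquad \mathbf V^h_\pm(\cdot,t+\tfrac{\Delta t}2)=\mathbf v^h_d(\cdot,t+\tfrac{\Delta t}2)\mp\mathcal G\mathcal S_\pm p^h(\cdot,t).$$ Let $|f|_{m+1}^2=\int|\partial_1^{m+1}\cdots\partial_d^{m+1}f|^2$ be the squared mixed Sobolev seminorm over one period (weak derivative; for vector fields, the sum over the components), and define $$Q^h(t)=\sum_{\pm}\Big(|P^h_\pm(\cdot,t)|_{m+1}^2+|\mathbf v^h_c(\cdot,t-\tfrac{\Delta t}2)|_{m+1}^2\Big),$$ $$R^h(t+\tfrac{\Delta t}2)=\sum_{\pm}\Big(|\mathbf V^h_\pm(\cdot,t+\tfrac{\Delta t}2)|_{m+1}^2+|\mathbf v^h_c(\cdot,t+\tfrac{\Delta t}2)|_{m+1}^2\Big).$$ Then $Q^h(0)$ is finite and, for all $n\in\mathbb N$, $$Q^h(n\Delta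 t)=R^h((n+\tfrac12)\Delta t)=Q^h(0).$$ -/

import Mathlib

open MeasureTheory
open scoped ENNReal ContDiff

namespace HermiteLeapfrog

noncomputable section

/-! ### Tensor-product Hermite interpolation on one cell -/

/-- The mixed derivative `∂₁^{α₁} ⋯ ∂_d^{α_d}` of a polynomial in `d` variables. -/
def polyDeriv {d : ℕ} (α : Fin d → ℕ) (q : MvPolynomial (Fin d) ℂ) : MvPolynomial (Fin d) ℂ :=
  (List.finRange d).foldr (fun i r => (MvPolynomial.pderiv i)^[α i] r) q

/-- Evaluation of a complex polynomial in `d` variables at a real point. -/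
def evalAt {d : ℕ} (x : Fin d → ℝ) (q : MvPolynomial (Fin d) ℂ) : ℂ :=
  MvPolynomial.eval (fun i => (x i : ℂ)) q

/-- The corner `(ε₁ h₁, …, ε_d h_d)`, `ε ∈ {0,1}^d`, of the cell `∏ [0, h_i]`. -/
def corner {d : ℕ} (h : Fin d → ℝ) (ε : Fin d → Fin 2) : Fin d → ℝ :=
  fun i => (ε i : ℝ) * h i

/-- `q` is the Hermite interpolant on the cell `∏ [0, h_i]` of the corner data `B`: it has degree
at most `2m+1` in each variable, and at each corner `ε` its derivatives `∂^α q`, `0 ≤ α_i ≤ m`, are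
the prescribed numbers `B ε α`. -/
def IsHermite {d : ℕ} (m : ℕ) (h : Fin d → ℝ)
    (B : (Fin d → Fin 2) → (Fin d → Fin (m + 1)) → ℂ) (q : MvPolynomial (Fin d) ℂ) : Prop :=
  (∀ i, q.degreeOf i ≤ 2 * m + 1) ∧
    ∀ (ε : Fin d → Fin 2) (α : Fin d → Fin (m + 1)),
      evalAt (corner h ε) (polyDeriv (fun i => (α i : ℕ)) q) = B ε α

/-- One-dimensional cardinal Hermite polynomials exist. -/
theorem exists_cardinal (m : ℕ) (h : ℝ) (hh : 0 < h) (e : Fin 2) (a : Fin (m + 1)) :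
    ∃ P : Polynomial ℂ, P.natDegree ≤ 2 * m + 1 ∧
      ∀ (e' : Fin 2) (a' : Fin (m + 1)),
        ((Polynomial.derivative^[(a' : ℕ)] P).eval ((((e' : ℝ) * h : ℝ)) : ℂ)) =
          if e' = e ∧ a' = a then 1 else 0 := by
  classical
  set z : Fin 2 → ℂ := fun e' => (((e' : ℝ) * h : ℝ) : ℂ) with hz
  set L : Fin 2 → Polynomial ℂ := fun e' => (Polynomial.X - Polynomial.C (z e')) ^ (m + 1) with hL
  have hne : z 0 ≠ z 1 := by
    simp only [hz]
    have h1 : (0 : ℂ) ≠ (h : ℂ) := by exact_mod_cast hh.ne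
    simpa using h1
  have hcop : IsCoprime (L 0) (L 1) :=
    (Polynomial.isCoprime_X_sub_C_of_isUnit_sub (sub_ne_zero.2 hne).isUnit).pow
  have hA : ∃ A : Polynomial ℂ, ∀ a' : Fin (m + 1),
      (Polynomial.derivative^[(a' : ℕ)] A).eval (z e) = if a' = a then 1 else 0 := by
    refine ⟨Polynomial.C ((Nat.factorial a : ℂ)⁻¹) * (Polynomial.X - Polynomial.C (z e)) ^ (a : ℕ),
      fun a' => ?_⟩
    rw [Polynomial.iterate_derivative_C_mul, Polynomial.iterate_derivative_X_sub_pow]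
    by_cases h1 : a' = a
    · subst h1
      simp [Nat.descFactorial_self, Nat.factorial_ne_zero]
    · have h2 : (a' : ℕ) ≠ a := fun h => h1 (Fin.ext h)
      rcases lt_or_gt_of_ne h2 with h3 | h3
      · have : (a : ℕ) - a' ≠ 0 := by omega
        simp [h1, this]
      · simp [h1, Nat.descFactorial_of_lt h3]
  obtain ⟨A, hA⟩ := hA
  obtain ⟨u, w, huw⟩ := hcop
  have hstep : ∃ R : Polynomial ℂ, ∀ e', L e' ∣ R - (if e' = e then A else 0) := by
    refine ⟨A * (if e = 0 then w * L 1 else u * L 0), fun e' => ?_⟩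
    fin_cases e <;> fin_cases e'
    · refine ⟨-(A * u), ?_⟩
      simp
      linear_combination A * huw
    · exact ⟨A * w, by simp; ring⟩
    · exact ⟨A * u, by simp; ring⟩
    · refine ⟨-(A * w), ?_⟩
      simp
      linear_combination A * huw
  obtain ⟨R, hR⟩ := hstep
  have hmonic : (L 0 * L 1).Monic :=
    ((Polynomial.monic_X_sub_C _).pow _).mul ((Polynomial.monic_X_sub_C _).pow _)
  have hdeg : (L 0 * L 1).natDegree = 2 * m + 2 := by
    rw [((Polynomial.monic_X_sub_C _).pow _).natDegree_mul ((Polynomial.monic_X_sub_C _).pow _)]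
    simp
    ring
  refine ⟨R %ₘ (L 0 * L 1), ?_, fun e' a' => ?_⟩
  · have := Polynomial.natDegree_modByMonic_lt R hmonic (by
      intro h1
      rw [h1] at hdeg
      simp at hdeg)
    omega
  · have hdvd : L e' ∣ R %ₘ (L 0 * L 1) - (if e' = e then A else 0) := by
      have h1 : L e' ∣ L 0 * L 1 := by
        fin_cases e'
        · exact Dvd.intro _ rfl
        · exact Dvd.intro_left _ rfl
      have h2 := Polynomial.modByMonic_add_div R (L 0 * L 1)
      have h3 : R %ₘ (L 0 * L 1) - (if e' = e then A else 0) =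
          (R - (if e' = e then A else 0)) - (L 0 * L 1) * (R /ₘ (L 0 * L 1)) := by
        linear_combination h2
      rw [h3]
      exact dvd_sub (hR e') (Dvd.dvd.mul_right h1 _)
    have hzero : (Polynomial.derivative^[(a' : ℕ)]
        (R %ₘ (L 0 * L 1) - (if e' = e then A else 0))).eval (z e') = 0 := by
      have h1 := Polynomial.pow_sub_dvd_iterate_derivative_of_pow_dvd (a' : ℕ) hdvd
      have h2 : Polynomial.X - Polynomial.C (z e') ∣ Polynomial.derivative^[(a' : ℕ)]
        (R %ₘ (L 0 * L 1) - (if e' = e then A else 0)) :=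
        (dvd_pow_self _ (by omega)).trans h1
      exact (Polynomial.dvd_iff_isRoot.1 h2)
    rw [Polynomial.iterate_derivative_sub, Polynomial.eval_sub, sub_eq_zero] at hzero
    change Polynomial.eval (z e') _ = _
    rw [hzero]
    by_cases h1 : e' = e
    · subst h1
      simp [hA]
    · simp [h1]

theorem pderiv_aeval_X {d : ℕ} (i j : Fin d) (P : Polynomial ℂ) :
    MvPolynomial.pderiv i (Polynomial.aeval (MvPolynomial.X j : MvPolynomial (Fin d) ℂ) P) =
      if i = j then Polynomial.aeval (MvPolynomial.X j : MvPolynomial (Fin d) ℂ)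
        (Polynomial.derivative P) else 0 := by
  classical
  rw [Derivation.map_aeval, MvPolynomial.pderiv_X]
  by_cases h : i = j
  · subst h; simp
  · simp [h, Ne.symm h]

/-- Product of univariate polynomials in the separate variables. -/
def tensorPoly {d : ℕ} (P : Fin d → Polynomial ℂ) : MvPolynomial (Fin d) ℂ :=
  ∏ j, Polynomial.aeval (MvPolynomial.X j : MvPolynomial (Fin d) ℂ) (P j)

theorem pderiv_tensorPoly {d : ℕ} (i : Fin d) (P : Fin d → Polynomial ℂ) :
    MvPolynomial.pderiv i (tensorPoly P) =
      tensorPoly (Function.update P i (Polynomial.derivative (P i))) := by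
  classical
  unfold tensorPoly
  rw [← Finset.mul_prod_erase _ _ (Finset.mem_univ i),
    ← Finset.mul_prod_erase (Finset.univ) (fun j => Polynomial.aeval
      (MvPolynomial.X j : MvPolynomial (Fin d) ℂ) (Function.update P i _ j)) (Finset.mem_univ i),
    Derivation.leibniz, pderiv_aeval_X]
  have h0 : MvPolynomial.pderiv i (∏ x ∈ Finset.univ.erase i,
      Polynomial.aeval (MvPolynomial.X x : MvPolynomial (Fin d) ℂ) (P x)) = 0 := by
    refine Finset.prod_induction _ (fun q => MvPolynomial.pderiv i q = 0) ?_ (by simp) ?_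
    · intro a b ha hb
      simp [Derivation.leibniz, ha, hb]
    · intro x hx
      rw [pderiv_aeval_X, if_neg (Finset.ne_of_mem_erase hx).symm]
  have h1 : ∏ x ∈ Finset.univ.erase i, Polynomial.aeval
      (MvPolynomial.X x : MvPolynomial (Fin d) ℂ)
        (Function.update P i (Polynomial.derivative (P i)) x) =
      ∏ x ∈ Finset.univ.erase i, Polynomial.aeval
        (MvPolynomial.X x : MvPolynomial (Fin d) ℂ) (P x) :=
    Finset.prod_congr rfl fun x hx => by
      rw [Function.update_of_ne (Finset.ne_of_mem_erase hx)]
  rw [h0, h1]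
  simp [mul_comm]

theorem iterate_pderiv_tensorPoly {d : ℕ} (i : Fin d) (n : ℕ) (P : Fin d → Polynomial ℂ) :
    (MvPolynomial.pderiv i)^[n] (tensorPoly P) =
      tensorPoly (Function.update P i (Polynomial.derivative^[n] (P i))) := by
  induction n with
  | zero => simp
  | succ n ih =>
    rw [Function.iterate_succ_apply', ih, pderiv_tensorPoly, Function.iterate_succ_apply']
    simp

theorem polyDeriv_tensorPoly {d : ℕ} (α : Fin d → ℕ) (P : Fin d → Polynomial ℂ) :
    polyDeriv α (tensorPoly P) = tensorPoly (fun j => Polynomial.derivative^[α j] (P j)) := by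
  classical
  have key : ∀ l : List (Fin d), l.Nodup →
      l.foldr (fun i r => (MvPolynomial.pderiv i)^[α i] r) (tensorPoly P) =
        tensorPoly (fun j => if j ∈ l then Polynomial.derivative^[α j] (P j) else P j) := by
    intro l
    induction l with
    | nil => intro _; simp
    | cons a l ih =>
      intro hl
      rw [List.nodup_cons] at hl
      rw [List.foldr_cons, ih hl.2, iterate_pderiv_tensorPoly]
      congr 1
      funext j
      by_cases hj : j = a
      · subst hj; simp [hl.1]
      · simp [hj]
  rw [polyDeriv, key _ (List.nodup_finRange d)]
  simp

theorem polyDeriv_add {d : ℕ} (α : Fin d → ℕ) (q r : MvPolynomial (Fin d) ℂ) :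
    polyDeriv α (q + r) = polyDeriv α q + polyDeriv α r := by
  unfold polyDeriv
  induction List.finRange d with
  | nil => rfl
  | cons a l ih => rw [List.foldr_cons, ih, iterate_map_add]; rfl

theorem polyDeriv_zero {d : ℕ} (α : Fin d → ℕ) :
    polyDeriv α (0 : MvPolynomial (Fin d) ℂ) = 0 := by
  unfold polyDeriv
  induction List.finRange d with
  | nil => rfl
  | cons a l ih => rw [List.foldr_cons, ih, iterate_map_zero]

theorem polyDeriv_sum {d : ℕ} {ι : Type*} (α : Fin d → ℕ) (s : Finset ι)
    (q : ι → MvPolynomial (Fin d) ℂ) :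
    polyDeriv α (∑ x ∈ s, q x) = ∑ x ∈ s, polyDeriv α (q x) :=
  map_sum (AddMonoidHom.mk' (polyDeriv α) (polyDeriv_add α)) q s

theorem polyDeriv_smul {d : ℕ} (α : Fin d → ℕ) (b : ℂ) (q : MvPolynomial (Fin d) ℂ) :
    polyDeriv α (b • q) = b • polyDeriv α q := by
  unfold polyDeriv
  induction List.finRange d with
  | nil => rfl
  | cons a l ih =>
    rw [List.foldr_cons, ih, List.foldr_cons]
    generalize List.foldr (fun i r => (MvPolynomial.pderiv i)^[α i] r) q l = r
    induction α a with
    | zero => rfl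
    | succ n ihn => rw [Function.iterate_succ_apply', ihn, Function.iterate_succ_apply']; simp

theorem degreeOf_tensorPoly_le {d : ℕ} (N : ℕ) (P : Fin d → Polynomial ℂ)
    (hP : ∀ j, (P j).natDegree ≤ N) (i : Fin d) : (tensorPoly P).degreeOf i ≤ N := by
  classical
  unfold tensorPoly
  refine (MvPolynomial.degreeOf_prod_le i _ _).trans ?_
  have h : ∀ j, (Polynomial.aeval (MvPolynomial.X j : MvPolynomial (Fin d) ℂ) (P j)).degreeOf i ≤
      if i = j then N else 0 := by
    intro j
    rw [Polynomial.aeval_eq_sum_range]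
    refine (MvPolynomial.degreeOf_sum_le i _ _).trans (Finset.sup_le fun n hn => ?_)
    rw [MvPolynomial.smul_eq_C_mul]
    refine (MvPolynomial.degreeOf_C_mul_le _ _ _).trans
      ((MvPolynomial.degreeOf_pow_le _ _ _).trans ?_)
    rw [MvPolynomial.degreeOf_X]
    have := hP j
    rw [Finset.mem_range] at hn
    split_ifs <;> simp <;> omega
  refine (Finset.sum_le_sum fun j _ => h j).trans ?_
  simp

/-- The tensor-product Hermite interpolation problem on a cell is solvable. -/
theorem exists_isHermite {d : ℕ} (m : ℕ) (h : Fin d → ℝ) (hh : ∀ i, 0 < h i)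
    (B : (Fin d → Fin 2) → (Fin d → Fin (m + 1)) → ℂ) : ∃ q, IsHermite m h B q := by
  classical
  choose P hPdeg hP using fun (i : Fin d) => exists_cardinal m (h i) (hh i)
  refine ⟨∑ ε : Fin d → Fin 2, ∑ α : Fin d → Fin (m + 1),
    B ε α • tensorPoly (fun i => P i (ε i) (α i)), fun i => ?_, fun ε α => ?_⟩
  · refine (MvPolynomial.degreeOf_sum_le i _ _).trans (Finset.sup_le fun ε _ => ?_)
    refine (MvPolynomial.degreeOf_sum_le i _ _).trans (Finset.sup_le fun α _ => ?_)
    rw [MvPolynomial.smul_eq_C_mul]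
    exact (MvPolynomial.degreeOf_C_mul_le _ _ _).trans
      (degreeOf_tensorPoly_le _ _ (fun j => hPdeg j _ _) i)
  · have hval : ∀ (ε' : Fin d → Fin 2) (α' : Fin d → Fin (m + 1)),
        evalAt (corner h ε) (polyDeriv (fun i => (α i : ℕ))
          (tensorPoly (fun i => P i (ε' i) (α' i)))) = if ε' = ε ∧ α' = α then 1 else 0 := by
      intro ε' α'
      rw [polyDeriv_tensorPoly, evalAt, tensorPoly, map_prod]
      have h1 : ∀ j, MvPolynomial.eval (fun i => (corner h ε i : ℂ))
          (Polynomial.aeval (MvPolynomial.X j : MvPolynomial (Fin d) ℂ)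
            (Polynomial.derivative^[(α j : ℕ)] (P j (ε' j) (α' j)))) =
          if ε j = ε' j ∧ α j = α' j then 1 else 0 := by
        intro j
        rw [← hP j (ε' j) (α' j) (ε j) (α j)]
        rw [← MvPolynomial.coe_aeval_eq_eval, RingHom.coe_coe, ← Polynomial.aeval_algHom_apply,
          MvPolynomial.aeval_X, Polynomial.coe_aeval_eq_eval]
        rfl
      rw [Finset.prod_congr rfl fun j _ => h1 j]
      by_cases h2 : ε' = ε ∧ α' = α
      · obtain ⟨rfl, rfl⟩ := h2
        simp
      · rw [if_neg h2]
        have : ∃ j, ¬ (ε j = ε' j ∧ α j = α' j) := by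
          by_contra hcon
          push Not at hcon
          exact h2 ⟨funext fun j => (hcon j).1.symm, funext fun j => (hcon j).2.symm⟩
        obtain ⟨j, hj⟩ := this
        exact Finset.prod_eq_zero (Finset.mem_univ j) (if_neg hj)
    rw [polyDeriv_sum, evalAt, map_sum]
    simp_rw [polyDeriv_sum, map_sum, polyDeriv_smul, MvPolynomial.smul_eval]
    have h3 : ∀ ε' α', MvPolynomial.eval (fun i => (corner h ε i : ℂ))
        (polyDeriv (fun i => (α i : ℕ)) (tensorPoly (fun i => P i (ε' i) (α' i)))) =
          if ε' = ε ∧ α' = α then 1 else 0 := hval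
    simp_rw [h3, ite_and]
    simp

/-! ### Grids, nodal data and the scheme -/

/-- A uniform periodic grid in `d` dimensions: lower corner `xmin`, mesh sizes `h i > 0` and
`K i ≥ 1` cells in direction `i`. -/
structure Grid (d : ℕ) where
  xmin : Fin d → ℝ
  h : Fin d → ℝ
  K : Fin d → ℕ
  h_pos : ∀ i, 0 < h i
  K_pos : ∀ i, 0 < K i

/-- The period in direction `i`. -/
def Grid.period {d : ℕ} (g : Grid d) (i : Fin d) : ℝ := g.K i * g.h i

/-- The periodicity box. -/
def Grid.box {d : ℕ} (g : Grid d) : Set (Fin d → ℝ) :=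
  Set.univ.pi fun i => Set.Ioc (g.xmin i) (g.xmin i + g.period i)

/-- The primary nodes are `primary i + j_i h_i`, `j ∈ ℤ^d`. -/
def Grid.primary {d : ℕ} (g : Grid d) : Fin d → ℝ := g.xmin

/-- The dual nodes are `dual i + j_i h_i`, `j ∈ ℤ^d`, i.e. `xmin i + (j_i + 1/2) h_i`. -/
def Grid.dual {d : ℕ} (g : Grid d) : Fin d → ℝ := fun i => g.xmin i + g.h i / 2

/-- Degrees of freedom: at the node with index `j ∈ ℤ^d`, the (approximate) derivatives
`∂^α u`, `0 ≤ α_i ≤ m`. -/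
abbrev NodalData (d m : ℕ) : Type := (Fin d → ℤ) → (Fin d → Fin (m + 1)) → ℂ

/-- Nodal data are periodic on the grid. -/
def NodalData.IsPeriodic {d m : ℕ} (g : Grid d) (D : NodalData d m) : Prop :=
  ∀ (j : Fin d → ℤ) (i : Fin d), D (j + Pi.single i (g.K i : ℤ)) = D j

/-- The data at the corners `j + ε`, `ε ∈ {0,1}^d`, of the cell with lower corner `j`. -/
def NodalData.corners {d m : ℕ} (D : NodalData d m) (j : Fin d → ℤ) :
    (Fin d → Fin 2) → (Fin d → Fin (m + 1)) → ℂ :=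
  fun ε => D (fun i => j i + ((ε i : ℕ) : ℤ))

/-- The Hermite interpolation polynomial on the cell with lower corner of index `j`, in coordinates
centred at that lower corner. -/
def cellPoly {d m : ℕ} (g : Grid d) (D : NodalData d m) (j : Fin d → ℤ) :
    MvPolynomial (Fin d) ℂ :=
  Classical.choose (exists_isHermite m g.h g.h_pos (D.corners j))

theorem cellPoly_spec {d m : ℕ} (g : Grid d) (D : NodalData d m) (j : Fin d → ℤ) :
    IsHermite m g.h (D.corners j) (cellPoly g D j) :=
  Classical.choose_spec (exists_isHermite m g.h g.h_pos (D.corners j))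

/-- The global piecewise polynomial Hermite interpolant of nodal data given at the nodes
`o i + j_i h_i`. -/
def interpolant {d m : ℕ} (g : Grid d) (o : Fin d → ℝ) (D : NodalData d m) :
    (Fin d → ℝ) → ℂ :=
  fun x => evalAt (fun i => x i - (o i + (⌊(x i - o i) / g.h i⌋ : ℝ) * g.h i))
    (cellPoly g D fun i => ⌊(x i - o i) / g.h i⌋)

/-- The centre of a cell, relative to its lower corner. -/
def Grid.centre {d : ℕ} (g : Grid d) : Fin d → ℝ := fun i => g.h i / 2

/-- The Laplacian of a polynomial. -/
def laplacian {d : ℕ} (q : MvPolynomial (Fin d) ℂ) : MvPolynomial (Fin d) ℂ :=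
  ∑ i, MvPolynomial.pderiv i (MvPolynomial.pderiv i q)

/-- The operator `2 ∑_{j odd} ((c Δt / 2)^j / j!) Δ^{(j-1)/2}`, with `j = 2 r + 1`. It is applied to
first derivatives of polynomials of degree at most `2m+1` in each variable, on which all terms with
`j > d (2m+1)` vanish, so that the sum over `r < d (m+1)` is the complete series. -/
def oddTaylor {d : ℕ} (m : ℕ) (c Δt : ℝ) (q : MvPolynomial (Fin d) ℂ) :
    MvPolynomial (Fin d) ℂ :=
  ∑ r ∈ Finset.range (d * (m + 1)),
    (2 * ((c * Δt / 2 : ℝ) : ℂ) ^ (2 * r + 1) / (Nat.factorial (2 * r + 1) : ℂ)) •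
      laplacian^[r] q

/-- One step of the pressure: the node `j` of the primary grid is the centre of the dual cell with
lower corner `j - 1`. -/
def stepP {d m : ℕ} (g : Grid d) (c Δt : ℝ) (p : NodalData d m) (v : Fin d → NodalData d m) :
    NodalData d m :=
  fun j α => p j α + evalAt g.centre (polyDeriv (fun i => (α i : ℕ))
    (oddTaylor m c Δt (∑ i, MvPolynomial.pderiv i (cellPoly g (v i) (fun l => j l - 1)))))

/-- One step of the velocity: the node `j` of the dual grid is the centre of the primary cell with
lower corner `j`. -/
def stepV {d m : ℕ} (g : Grid d) (c Δt : ℝ) (v : Fin d → NodalData d m) (p : NodalData d m) :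
    Fin d → NodalData d m :=
  fun i j α => v i j α + evalAt g.centre (polyDeriv (fun l => (α l : ℕ))
    (oddTaylor m c Δt (MvPolynomial.pderiv i (cellPoly g p j))))

/-- The Hermite-leapfrog scheme: the `n`-th term consists of the pressure data at time `n Δt`
and of the velocity data at time `(n - 1/2) Δt`, started from `p0` at time `0` and `v0` at
time `-Δt/2`. -/
def scheme {d m : ℕ} (g : Grid d) (c Δt : ℝ) (p0 : NodalData d m) (v0 : Fin d → NodalData d m) :
    ℕ → NodalData d m × (Fin d → NodalData d m)
  | 0 => (p0, v0)
  | n + 1 =>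
    let s := scheme g c Δt p0 v0 n
    (stepP g c Δt s.1 (stepV g c Δt s.2 s.1), stepV g c Δt s.2 s.1)

/-- The discrete pressure `p^h(·, n Δt)`. -/
def pressure {d m : ℕ} (g : Grid d) (c Δt : ℝ) (p0 : NodalData d m) (v0 : Fin d → NodalData d m)
    (n : ℕ) : (Fin d → ℝ) → ℂ :=
  interpolant g g.primary (scheme g c Δt p0 v0 n).1

/-- The discrete velocity `v^h(·, (n - 1/2) Δt)`. -/
def velocity {d m : ℕ} (g : Grid d) (c Δt : ℝ) (p0 : NodalData d m) (v0 : Fin d → NodalData d m)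
    (n : ℕ) : Fin d → (Fin d → ℝ) → ℂ :=
  fun i => interpolant g g.dual ((scheme g c Δt p0 v0 n).2 i)

/-! ### Fourier multipliers on periodic functions -/

/-- The wave vector `k_i = 2 π n_i / period_i`. -/
def waveVec {d : ℕ} (g : Grid d) (n : Fin d → ℤ) : Fin d → ℝ :=
  fun i => 2 * Real.pi * n i / g.period i

/-- The Euclidean length `|k| = (k_1² + ⋯ + k_d²)^{1/2}`. -/
def waveNum {d : ℕ} (g : Grid d) (n : Fin d → ℤ) : ℝ := √(∑ i, waveVec g n i ^ 2)

/-- The normalized wave vector `k / |k|`, with the prescribed value `e` at `k = 0`. -/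
def unitVec {d : ℕ} (g : Grid d) (e : Fin d → ℝ) (n : Fin d → ℤ) : Fin d → ℝ :=
  if n = 0 then e else fun i => waveVec g n i / waveNum g n

/-- The character `exp(i k · x)`. -/
def character {d : ℕ} (g : Grid d) (n : Fin d → ℤ) (x : Fin d → ℝ) : ℂ :=
  Complex.exp (Complex.I * ((∑ i, waveVec g n i * x i : ℝ) : ℂ))

/-- Fourier coefficients of a periodic function. -/
def fourierCoef {d : ℕ} (g : Grid d) (f : (Fin d → ℝ) → ℂ) (n : Fin d → ℤ) : ℂ :=
  ((∏ i, g.period i : ℝ) : ℂ)⁻¹ * ∫ x in g.box, f x * character g (-n) x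

/-- The Fourier multiplier with symbol `σ`. (For the functions considered here the series converges
absolutely.) -/
def multiplier {d : ℕ} (g : Grid d) (σ : (Fin d → ℤ) → ℂ) (f : (Fin d → ℝ) → ℂ) :
    (Fin d → ℝ) → ℂ :=
  fun x => ∑' n, σ n * fourierCoef g f n * character g n x

/-- The operators `S_+` (for `s = 1`) and `S_-` (for `s = -1`), with symbol
`exp(s i c |k| Δt / 2)`. -/
def opS {d : ℕ} (g : Grid d) (c Δt : ℝ) (s : ℝ) (f : (Fin d → ℝ) → ℂ) : (Fin d → ℝ) → ℂ :=
  multiplier g (fun n => Complex.exp (Complex.I * ((s * c * waveNum g n * Δt / 2 : ℝ) : ℂ))) f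

/-- The operator `G` from scalar to vector fields: multiplication by `k / |k|` in Fourier space. -/
def opG {d : ℕ} (g : Grid d) (e : Fin d → ℝ) (f : (Fin d → ℝ) → ℂ) : Fin d → (Fin d → ℝ) → ℂ :=
  fun i => multiplier g (fun n => (unitVec g e n i : ℂ)) f

/-- The adjoint `G*` of `G`: the scalar product with `k / |k|` (a real vector) in Fourier space. -/
def opGadj {d : ℕ} (g : Grid d) (e : Fin d → ℝ) (w : Fin d → (Fin d → ℝ) → ℂ) :
    (Fin d → ℝ) → ℂ :=
  fun x => ∑ i, multiplier g (fun n => (unitVec g e n i : ℂ)) (w i) x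

/-! ### The mixed Sobolev seminorm -/

/-- The classical mixed derivative `∂₁^{α₁} ⋯ ∂_d^{α_d} φ` (used for smooth `φ`). -/
def mixedDeriv {d : ℕ} (α : Fin d → ℕ) (φ : (Fin d → ℝ) → ℂ) : (Fin d → ℝ) → ℂ :=
  (List.finRange d).foldr
    (fun i f => (fun (u : (Fin d → ℝ) → ℂ) x => lineDeriv ℝ u x (Pi.single i 1))^[α i] f) φ

/-- `w` is the weak derivative `∂₁^k ⋯ ∂_d^k f` of the periodic function `f`, tested against
smooth periodic functions. -/
def IsWeakMixedDeriv {d : ℕ} (g : Grid d) (k : ℕ) (f w : (Fin d → ℝ) → ℂ) : Prop :=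
  IntegrableOn f g.box ∧ IntegrableOn w g.box ∧
    ∀ φ : (Fin d → ℝ) → ℂ, ContDiff ℝ ∞ φ →
      (∀ i, Function.Periodic φ (Pi.single i (g.period i))) →
      ∫ x in g.box, f x * mixedDeriv (fun _ => k) φ x = (-1) ^ (d * k) * ∫ x in g.box, w x * φ x

/-- The squared seminorm `|f|²_{m+1} = ∫ |∂₁^{m+1} ⋯ ∂_d^{m+1} f|²` over the periodicity box; it is
`∞` if there is no weak derivative, or if the weak derivative is not square integrable. (The weak
derivative being unique almost everywhere, the infimum runs over a single value.) -/
def seminormSq {d : ℕ} (g : Grid d) (m : ℕ) (f : (Fin d → ℝ) → ℂ) : ℝ≥0∞ :=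
  ⨅ (w : (Fin d → ℝ) → ℂ) (_ : IsWeakMixedDeriv g (m + 1) f w), ∫⁻ x in g.box, ‖w x‖ₑ ^ 2

/-- The squared seminorm of a vector field. -/
def seminormSqVec {d : ℕ} (g : Grid d) (m : ℕ) (w : Fin d → (Fin d → ℝ) → ℂ) : ℝ≥0∞ :=
  ∑ i, seminormSq g m (w i)

/-! ### The conserved quantities -/

/-- `v_d = G G* v`. -/
def partD {d : ℕ} (g : Grid d) (e : Fin d → ℝ) (v : Fin d → (Fin d → ℝ) → ℂ) :
    Fin d → (Fin d → ℝ) → ℂ :=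
  opG g e (opGadj g e v)

/-- `v_c = v - v_d`. -/
def partC {d : ℕ} (g : Grid d) (e : Fin d → ℝ) (v : Fin d → (Fin d → ℝ) → ℂ) :
    Fin d → (Fin d → ℝ) → ℂ :=
  v - partD g e v

/-- `P_± = p ∓ S_± G* v_d`, with `s = ±1`. -/
def varP {d : ℕ} (g : Grid d) (c Δt : ℝ) (e : Fin d → ℝ) (s : ℝ) (p : (Fin d → ℝ) → ℂ)
    (v : Fin d → (Fin d → ℝ) → ℂ) : (Fin d → ℝ) → ℂ :=
  p - (s : ℂ) • opS g c Δt s (opGadj g e (partD g e v))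

/-- `V_± = v_d ∓ G S_± p`, with `s = ±1`. -/
def varV {d : ℕ} (g : Grid d) (c Δt : ℝ) (e : Fin d → ℝ) (s : ℝ) (p : (Fin d → ℝ) → ℂ)
    (v : Fin d → (Fin d → ℝ) → ℂ) : Fin d → (Fin d → ℝ) → ℂ :=
  partD g e v - (s : ℂ) • opG g e (opS g c Δt s p)

/-- `Q^h(n Δt) = |P_+|² + |P_-|² + 2 |v_c|²`, formed from `p^h(n Δt)` and `v^h((n - 1/2) Δt)`. -/
def energyQ {d m : ℕ} (g : Grid d) (c Δt : ℝ) (e : Fin d → ℝ) (p0 : NodalData d m)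
    (v0 : Fin d → NodalData d m) (n : ℕ) : ℝ≥0∞ :=
  seminormSq g m (varP g c Δt e 1 (pressure g c Δt p0 v0 n) (velocity g c Δt p0 v0 n)) +
  seminormSq g m (varP g c Δt e (-1) (pressure g c Δt p0 v0 n) (velocity g c Δt p0 v0 n)) +
  2 * seminormSqVec g m (partC g e (velocity g c Δt p0 v0 n))

/-- `R^h((n + 1/2) Δt) = |V_+|² + |V_-|² + 2 |v_c|²`, formed from `p^h(n Δt)` and
`v^h((n + 1/2) Δt)`. -/
def energyR {d m : ℕ} (g : Grid d) (c Δt : ℝ) (e : Fin d → ℝ) (p0 : NodalData d m)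
    (v0 : Fin d → NodalData d m) (n : ℕ) : ℝ≥0∞ :=
  seminormSqVec g m (varV g c Δt e 1 (pressure g c Δt p0 v0 n) (velocity g c Δt p0 v0 (n + 1))) +
  seminormSqVec g m
    (varV g c Δt e (-1) (pressure g c Δt p0 v0 n) (velocity g c Δt p0 v0 (n + 1))) +
  2 * seminormSqVec g m (partC g e (velocity g c Δt p0 v0 (n + 1)))

end

end HermiteLeapfrog

/-!
The scheme is exact for trigonometric polynomials: in Fourier space the sum
`2 ∑_{j odd} (c Δt / 2)^j / j! Δ^{(j-1)/2} ∂_l` is multiplication by `2 i k_l sin(τ|k|) / |k|` with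
`τ = c Δt / 2` (`stepSymbol`). The scheme applies it to piecewise polynomials, cell by cell, and
evaluates the result at the centres of the cells. The proof rests on three facts.

*Locality.* The value at a point of `sin(τ|∂|)/|∂|` applied to `f` only depends on `f` within
distance `τ`, and `τ < h_i / 2`. Hence the Fourier series of an interpolant, multiplied by
`stepSymbol`, has at the cell centres precisely the values and derivatives that the scheme computes
from the Taylor sum (`hasSum_nodeSymbol_mul_stepSymbol`). The interpolant is a combination of
products of splines in one variable, and the propagator is built up one variable at a time. In one
variable `sin(τ|∂|)/|∂|` is an average over `[-τ, τ]` (`isLocalTaylor_of_hasSum`); further variables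
enter through the Taylor expansion of the entire function `sin(τ√u)/√u` of `u = |k|²`, whose
derivatives in `u` are obtained from it by integration in `τ` (`sincDeriv_succ`), so that they
inherit the locality (`IsLocalTaylor.hasSum_add`, `hasSum_prod_mul_sinc`).

*Orthogonality.* In the inner product of the seminorm, whose weight is `∏ k_i^{2m+2}`, a function
whose derivatives up to order `m` vanish at the nodes is orthogonal to every interpolant: the
derivative of order `2m+2` of a spline is a combination of derivatives of order at most `m` of
Dirac masses at the nodes (`IsSpline.pow_mul_cellSum_top`). By locality this applies to the
difference between the exactly propagated series and the interpolant of the increment computed by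
the scheme (`hasSum_weight_mul_sub_mul_conj`).

*Energy identity.* The squared seminorms are weighted sums of squared Fourier coefficients
(`HasFourierSeries.seminormSq_eq`). For each wave vector the contributions to `Q` and `R` are
`2|a|² + 2∑|b_i|² ∓ 2 Re(conj a · 2 i sin(τ|k|) k̂·b)`, where `a` and `b` are the coefficients of
pressure and velocity (`energy_varP_eq`, `energy_varV_eq`). The change of this expression in one
step is minus twice the real part of the product of that difference with the conjugate of the sum
of the old and the new coefficients (`density_neg_sub_density`, `density_sub_density_neg`). The sum
over all wave vectors vanishes by orthogonality.
-/

namespace HermiteLeapfrog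

noncomputable section

/-! ### The entire function `sin(τ√u)/√u` -/

/-- The Taylor coefficients `σ_n(τ) = (-1)^n τ^(2n+1) n! / (2n+1)!`, normalised so that
`∑ σ_n(τ) uⁿ / n!` is the entire function `sin(τ √u) / √u` of `u`. -/
def sincCoeff (n : ℕ) (τ : ℝ) : ℝ :=
  (-1) ^ n * τ ^ (2 * n + 1) * n.factorial / (2 * n + 1).factorial

/-- The `j`-th derivative with respect to `u` of the entire function `sin(τ √u) / √u`, as a power
series in `u`, which converges everywhere (`hasSum_sincDeriv`). -/
def sincDeriv (j : ℕ) (τ u : ℝ) : ℝ :=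
  ∑' r : ℕ, sincCoeff (j + r) τ * u ^ r / r.factorial

theorem abs_sincCoeff_le (n : ℕ) (τ : ℝ) : |sincCoeff n τ| ≤ |τ| ^ (2 * n + 1) / n.factorial := by
  have h1 : (n.factorial * n.factorial : ℝ) ≤ (2 * n + 1).factorial := by
    have : n.factorial * n.factorial ≤ (2 * n + 1).factorial := by
      refine (Nat.le_of_dvd (Nat.factorial_pos _)
        (Nat.factorial_mul_factorial_dvd_factorial_add n n)).trans
        (Nat.factorial_le (by omega))
    exact_mod_cast this
  have h2 : (0 : ℝ) < n.factorial := by positivity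
  have h3 : (0 : ℝ) < (2 * n + 1).factorial := by positivity
  rw [sincCoeff, abs_div, abs_mul, abs_mul, abs_pow, abs_pow, abs_neg, abs_one, one_pow, one_mul,
    abs_of_pos h2, abs_of_pos h3, div_le_div_iff₀ h3 h2, mul_assoc]
  gcongr

theorem abs_sincTerm_le (j r : ℕ) (τ u : ℝ) : |sincCoeff (j + r) τ * u ^ r / r.factorial| ≤
    |τ| ^ (2 * j + 1) * ((|τ| ^ 2 * |u|) ^ r / r.factorial) := by
  have h2 : (0 : ℝ) < r.factorial := by positivity
  have h3 : (1 : ℝ) ≤ (j + r).factorial := by exact_mod_cast Nat.factorial_pos (j + r)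
  rw [abs_div, abs_mul, abs_of_pos h2, abs_pow, ← mul_div_assoc]
  refine div_le_div_of_nonneg_right ?_ h2.le
  calc |sincCoeff (j + r) τ| * |u| ^ r ≤ |τ| ^ (2 * (j + r) + 1) * |u| ^ r := by
        gcongr
        exact (abs_sincCoeff_le _ _).trans (div_le_self (by positivity) h3)
    _ = _ := by rw [mul_pow, ← pow_mul]; ring

theorem summable_sincBound (j : ℕ) (a b : ℝ) :
    Summable fun r : ℕ => a ^ (2 * j + 1) * (b ^ r / (r.factorial : ℝ)) :=
  (Real.summable_pow_div_factorial b).mul_left _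

theorem summable_sincTerm (j : ℕ) (τ u : ℝ) :
    Summable fun r : ℕ => sincCoeff (j + r) τ * u ^ r / r.factorial :=
  Summable.of_norm_bounded (summable_sincBound j |τ| (|τ| ^ 2 * |u|))
    fun r => abs_sincTerm_le j r τ u

theorem hasSum_sincDeriv (j : ℕ) (τ u : ℝ) :
    HasSum (fun r : ℕ => sincCoeff (j + r) τ * u ^ r / r.factorial) (sincDeriv j τ u) :=
  (summable_sincTerm j τ u).hasSum

theorem sincDeriv_zero_right (j : ℕ) (τ : ℝ) : sincDeriv j τ 0 = sincCoeff j τ := by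
  rw [sincDeriv, tsum_eq_single 0]
  · simp
  · intro r hr
    simp [hr]

theorem mul_sincDeriv_zero (τ x : ℝ) : x * sincDeriv 0 τ (x ^ 2) = Real.sin (τ * x) := by
  refine HasSum.unique ((hasSum_sincDeriv 0 τ (x ^ 2)).mul_left x) ?_
  refine (Real.hasSum_sin (τ * x)).congr_fun fun r => ?_
  rw [sincCoeff, zero_add]
  field_simp
  ring

theorem continuous_sincCoeff (n : ℕ) : Continuous (sincCoeff n) := by
  unfold sincCoeff; fun_prop

theorem continuous_sincDeriv (j : ℕ) (u : ℝ) : Continuous fun τ => sincDeriv j τ u := by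
  rw [continuous_iff_continuousAt]
  intro τ
  have h : ContinuousOn (fun τ => sincDeriv j τ u) (Set.Icc (-(|τ| + 1)) (|τ| + 1)) := by
    refine continuousOn_tsum (u := fun r : ℕ =>
      (|τ| + 1) ^ (2 * j + 1) * (((|τ| + 1) ^ 2 * |u|) ^ r / (r.factorial : ℝ)))
      (fun r => ?_) (summable_sincBound _ _ _) ?_
    · have := continuous_sincCoeff (j + r)
      fun_prop
    · intro r t ht
      have ht' : |t| ≤ |τ| + 1 := abs_le.2 ht
      refine (abs_sincTerm_le j r t u).trans ?_
      gcongr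
  exact h.continuousAt (Icc_mem_nhds (by linarith [neg_abs_le τ]) (by linarith [le_abs_self τ]))

theorem integral_mul_sincCoeff (n : ℕ) (τ : ℝ) :
    ∫ t in (0 : ℝ)..τ, t * sincCoeff n t = -2 * sincCoeff (n + 1) τ := by
  have h : ∀ t : ℝ, t * sincCoeff n t =
      ((-1) ^ n * n.factorial / (2 * n + 1).factorial) * t ^ (2 * n + 2) := by
    intro t; rw [sincCoeff]; ring
  simp_rw [h]
  rw [intervalIntegral.integral_const_mul, integral_pow, sincCoeff]
  have e : (2 * (n + 1) + 1).factorial = (2 * n + 3) * ((2 * n + 2) * (2 * n + 1).factorial) := by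
    rw [show 2 * (n + 1) + 1 = (2 * n + 1 + 1) + 1 by ring, Nat.factorial_succ, Nat.factorial_succ]
  have e2 : (n + 1).factorial = (n + 1) * n.factorial := Nat.factorial_succ n
  rw [e, e2]
  push_cast
  have h3 : ((2 * n + 1).factorial : ℝ) ≠ 0 := by positivity
  have h4 : (2 * n + 3 : ℝ) ≠ 0 := by positivity
  have h5 : (2 * n + 2 + 1 : ℝ) ≠ 0 := by positivity
  have h6 : (n + 1 : ℝ) ≠ 0 := by positivity
  have h7 : (2 * n + 2 : ℝ) ≠ 0 := by positivity
  field_simp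
  ring

/-- Termwise integration of a uniformly dominated series. -/
theorem hasSum_intervalIntegral_of_bound {ι E : Type*} [Countable ι] [NormedAddCommGroup E]
    [NormedSpace ℝ E] {F : ι → ℝ → E} {f : ℝ → E} {U : ι → ℝ} {a b : ℝ} (hab : a ≤ b)
    (hF : ∀ i, Continuous (F i)) (hFU : ∀ i, ∀ t ∈ Set.Icc a b, ‖F i t‖ ≤ U i) (hU : Summable U)
    (hf : ∀ t ∈ Set.Icc a b, HasSum (fun i => F i t) (f t)) :
    HasSum (fun i => ∫ t in a..b, F i t) (∫ t in a..b, f t) := by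
  have hsub : ∀ t, t ∈ Set.uIoc a b → t ∈ Set.Icc a b := fun t ht => by
    rw [Set.uIoc_of_le hab] at ht
    exact Set.Ioc_subset_Icc_self ht
  exact intervalIntegral.hasSum_integral_of_dominated_convergence (fun i _ => U i)
    (fun i => (hF i).aestronglyMeasurable)
    (fun i => .of_forall fun t ht => hFU i t (hsub t ht))
    (.of_forall fun _ _ => hU) intervalIntegrable_const
    (.of_forall fun t ht => hf t (hsub t ht))

/-- Raising the order of the `u`-derivative of `sin(τ √u) / √u` amounts to an integration in `τ`. -/
theorem sincDeriv_succ (j : ℕ) {τ : ℝ} (hτ : 0 ≤ τ) (u : ℝ) :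
    sincDeriv (j + 1) τ u = -(1 / 2) * ∫ t in (0 : ℝ)..τ, t * sincDeriv j t u := by
  have h := hasSum_intervalIntegral_of_bound (a := 0) (b := τ)
    (F := fun (r : ℕ) t => t * (sincCoeff (j + r) t * u ^ r / r.factorial))
    (f := fun t => t * sincDeriv j t u)
    (U := fun r : ℕ => τ * (τ ^ (2 * j + 1) * ((τ ^ 2 * |u|) ^ r / r.factorial))) hτ
    (fun r => by have := continuous_sincCoeff (j + r); fun_prop)
    (fun r t ht => by
      have h1 : |t| ≤ τ := by rw [abs_of_nonneg ht.1]; exact ht.2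
      rw [norm_mul]
      refine mul_le_mul h1 ((abs_sincTerm_le j r t u).trans ?_) (norm_nonneg _) hτ
      gcongr)
    ((summable_sincBound j τ _).mul_left τ)
    (fun t _ => (hasSum_sincDeriv j t u).mul_left t)
  refine HasSum.unique (hasSum_sincDeriv (j + 1) τ u) ?_
  refine (h.mul_left (-(1 / 2))).congr_fun fun r => ?_
  have e : ∀ t : ℝ, t * (sincCoeff (j + r) t * u ^ r / r.factorial) =
      (u ^ r / r.factorial) * (t * sincCoeff (j + r) t) := fun t => by ring
  simp_rw [e]
  rw [intervalIntegral.integral_const_mul, integral_mul_sincCoeff,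
    show j + 1 + r = j + r + 1 by ring]
  ring

/-- Taylor expansion of `sincDeriv j τ` about `u`. -/
theorem hasSum_sincDeriv_add (j : ℕ) (τ u s : ℝ) :
    HasSum (fun r : ℕ => sincDeriv (j + r) τ u * s ^ r / r.factorial) (sincDeriv j τ (u + s)) := by
  set G : ℕ × ℕ → ℝ := fun p =>
    sincCoeff (j + p.1 + p.2) τ * u ^ p.2 / p.2.factorial * (s ^ p.1 / p.1.factorial) with hG
  have hs : Summable G := by
    have hb : Summable fun p : ℕ × ℕ => |τ| ^ (2 * j + 1) *
        (((|τ| ^ 2 * |s|) ^ p.1 / p.1.factorial) * ((|τ| ^ 2 * |u|) ^ p.2 / p.2.factorial)) :=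
      ((Real.summable_pow_div_factorial _).mul_of_nonneg (Real.summable_pow_div_factorial _)
        (fun r => by positivity) (fun r => by positivity)).mul_left _
    refine Summable.of_norm_bounded hb fun p => ?_
    rw [hG, norm_mul]
    have h1 := abs_sincTerm_le (j + p.1) p.2 τ u
    have h2 : ‖s ^ p.1 / (p.1.factorial : ℝ)‖ = |s| ^ p.1 / p.1.factorial := by
      rw [norm_div, norm_pow]; simp
    rw [h2]
    refine (mul_le_mul_of_nonneg_right h1 (by positivity)).trans (le_of_eq ?_)
    rw [mul_pow, mul_pow, ← pow_mul, ← pow_mul]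
    ring
  have h1 : HasSum (fun r : ℕ => sincDeriv (j + r) τ u * s ^ r / r.factorial) (∑' p, G p) := by
    refine HasSum.prod_fiberwise hs.hasSum fun r => ?_
    have := (hasSum_sincDeriv (j + r) τ u).mul_right (s ^ r / (r.factorial : ℝ))
    rwa [← mul_div_assoc] at this
  have h2 : HasSum (fun n : ℕ => sincCoeff (j + n) τ * (u + s) ^ n / n.factorial)
      (∑' p, G p) := by
    have e := (Finset.HasAntidiagonal.sigmaAntidiagonalEquivProd (A := ℕ)).hasSum_iff.2 hs.hasSum
    refine e.sigma fun n => ?_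
    have hfin := hasSum_fintype (fun p : Finset.HasAntidiagonal.antidiagonal n =>
      (G ∘ Finset.HasAntidiagonal.sigmaAntidiagonalEquivProd) ⟨n, p⟩)
    convert hfin using 1
    simp only [Function.comp_apply, Finset.HasAntidiagonal.sigmaAntidiagonalEquivProd_apply]
    rw [Finset.sum_coe_sort (Finset.HasAntidiagonal.antidiagonal n) (fun p => G p), add_comm u s,
      (Commute.all s u).add_pow', Finset.mul_sum, Finset.sum_div]
    refine Finset.sum_congr rfl fun p hp => ?_
    replace hp : p.1 + p.2 = n := Finset.HasAntidiagonal.mem_antidiagonal.1 hp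
    simp only [hG]
    have hc : (n.choose p.1 : ℝ) = n.factorial / (p.1.factorial * p.2.factorial) := by
      rw [← hp, Nat.cast_add_choose]
    rw [nsmul_eq_mul, hc, add_assoc, hp]
    have : (n.factorial : ℝ) ≠ 0 := by positivity
    field_simp
  rw [show sincDeriv j τ (u + s) = ∑' p, G p from
    (hasSum_sincDeriv j τ (u + s)).unique h2]
  exact h1

/-- By `sincDeriv_succ`, bounds propagate from `sin(τ √u) / √u` to its derivatives in `u`. -/
theorem norm_mul_sincDeriv_le {C : ℂ} {u U T : ℝ} (hU0 : 0 ≤ U)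
    (hU : ∀ τ ∈ Set.Icc 0 T, ‖C * sincDeriv 0 τ u‖ ≤ U) (j : ℕ) :
    ∀ τ ∈ Set.Icc 0 T, ‖C * sincDeriv j τ u‖ ≤ U * (T ^ 2 / 2) ^ j := by
  induction j with
  | zero => simpa using hU
  | succ j ih =>
    intro τ hτ
    have h1 : C * (sincDeriv (j + 1) τ u : ℂ) =
        -(1 / 2) * ∫ t in (0 : ℝ)..τ, t * (C * sincDeriv j t u) := by
      rw [sincDeriv_succ j hτ.1]
      have : ∀ t : ℝ, (t : ℂ) * (C * sincDeriv j t u) =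
          C * ((t * sincDeriv j t u : ℝ) : ℂ) := fun t => by push_cast; ring
      simp_rw [this]
      rw [intervalIntegral.integral_const_mul, intervalIntegral.integral_ofReal]
      push_cast
      ring
    rw [h1, norm_mul]
    have h2 : ‖∫ t in (0 : ℝ)..τ, (t : ℂ) * (C * sincDeriv j t u)‖ ≤
        (T * (U * (T ^ 2 / 2) ^ j)) * |τ - 0| := by
      refine intervalIntegral.norm_integral_le_of_norm_le_const fun t ht => ?_
      rw [Set.uIoc_of_le hτ.1] at ht
      have htT : t ∈ Set.Icc 0 T := ⟨ht.1.le, ht.2.trans hτ.2⟩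
      rw [norm_mul, Complex.norm_real, Real.norm_of_nonneg ht.1.le]
      exact mul_le_mul htT.2 (ih t htT) (norm_nonneg _) (htT.1.trans htT.2)
    rw [sub_zero, abs_of_nonneg hτ.1] at h2
    have hT : 0 ≤ T := hτ.1.trans hτ.2
    calc ‖(-(1 / 2) : ℂ)‖ * _ ≤ 1 / 2 * ((T * (U * (T ^ 2 / 2) ^ j)) * T) := by
          refine mul_le_mul (by norm_num) (h2.trans ?_) (norm_nonneg _) (by norm_num)
          gcongr
          exact hτ.2
      _ = _ := by rw [pow_succ]; ring

theorem abs_sincDeriv_le {u τ : ℝ} (hu : 0 ≤ u) (hτ : 0 ≤ τ) (j : ℕ) :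
    |sincDeriv j τ u| ≤ τ * (τ ^ 2 / 2) ^ j := by
  have h := norm_mul_sincDeriv_le (C := 1) (u := u) (U := τ) (T := τ) hτ (fun t ht => ?_) j τ
    ⟨hτ, le_rfl⟩
  · rwa [one_mul, Complex.norm_real] at h
  · rw [one_mul, Complex.norm_real, Real.norm_eq_abs]
    refine le_trans ?_ ht.2
    rcases hu.eq_or_lt with rfl | hu
    · rw [sincDeriv_zero_right, sincCoeff]
      simp [abs_of_nonneg ht.1]
    · have hs : 0 < √u := Real.sqrt_pos.2 hu
      have h1 := mul_sincDeriv_zero t √u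
      rw [Real.sq_sqrt hu.le] at h1
      have h2 := Real.abs_sin_le_abs (x := t * √u)
      rw [← h1, abs_mul, abs_mul, abs_of_pos hs, abs_of_nonneg ht.1, mul_comm t] at h2
      exact le_of_mul_le_mul_left h2 hs

/-! ### Locality of the propagator -/

/-- `C` and `t` are two descriptions of a function of one variable near a point: `C k` is the
`k`-th term of its Fourier series there, and `t b`, `b < B`, are the values of its derivatives
`(-∂²)ᵇ` there. The conditions say that for all `τ ∈ [0, T]` the operator `sin(τ|∂|)/|∂|` may be
evaluated on either side, as it may for a function that is a polynomial within distance `T`. -/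
structure IsLocalTaylor (κ : ℤ → ℝ) (C : ℤ → ℂ) (t : ℕ → ℂ) (B : ℕ) (T : ℝ) : Prop where
  exists_bound : ∃ U : ℤ → ℝ, Summable U ∧
    ∀ k, ∀ τ ∈ Set.Icc 0 T, ‖C k * sincDeriv 0 τ (κ k ^ 2)‖ ≤ U k
  hasSum_zero : ∀ τ ∈ Set.Icc 0 T, HasSum (fun k => C k * sincDeriv 0 τ (κ k ^ 2))
    (∑ b ∈ Finset.range B, sincCoeff b τ * (t b / b.factorial))

/-- Locality is inherited by the derivatives in `u` of `sin(τ√u)/√u`, which are integrals in `τ`. -/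
theorem IsLocalTaylor.hasSum {κ : ℤ → ℝ} {C : ℤ → ℂ} {t : ℕ → ℂ} {B : ℕ} {T : ℝ}
    (h : IsLocalTaylor κ C t B T) (j : ℕ) : ∀ τ ∈ Set.Icc 0 T,
      HasSum (fun k => C k * sincDeriv j τ (κ k ^ 2))
        (∑ b ∈ Finset.range B, sincCoeff (j + b) τ * (t b / b.factorial)) := by
  obtain ⟨U, hU, hb⟩ := h.exists_bound
  induction j with
  | zero => simpa using h.hasSum_zero
  | succ j ih =>
    intro τ hτ
    have hT : 0 ≤ T := hτ.1.trans hτ.2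
    have hU0 : ∀ k, 0 ≤ U k := fun k => (norm_nonneg _).trans (hb k 0 ⟨le_rfl, hT⟩)
    have key := hasSum_intervalIntegral_of_bound (a := 0) (b := τ)
      (F := fun (k : ℤ) (t : ℝ) => (t : ℂ) * (C k * sincDeriv j t (κ k ^ 2)))
      (f := fun x : ℝ => (x : ℂ) *
        ∑ b ∈ Finset.range B, sincCoeff (j + b) x * (t b / b.factorial))
      (U := fun k => T * (U k * (T ^ 2 / 2) ^ j)) hτ.1
      (fun k => by have := continuous_sincDeriv j (κ k ^ 2); fun_prop)
      (fun k x hx => by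
        have hxT : x ∈ Set.Icc 0 T := ⟨hx.1, hx.2.trans hτ.2⟩
        rw [norm_mul, Complex.norm_real, Real.norm_of_nonneg hx.1]
        exact mul_le_mul hxT.2 (norm_mul_sincDeriv_le (hU0 k) (hb k) j x hxT)
          (norm_nonneg _) hT)
      ((hU.mul_right _).mul_left _)
      (fun x hx => (ih x ⟨hx.1, hx.2.trans hτ.2⟩).mul_left _)
    have h1 : ∀ k, C k * (sincDeriv (j + 1) τ (κ k ^ 2) : ℂ) =
        -(1 / 2) * ∫ x in (0 : ℝ)..τ, x * (C k * sincDeriv j x (κ k ^ 2)) := by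
      intro k
      rw [sincDeriv_succ j hτ.1]
      have : ∀ x : ℝ, (x : ℂ) * (C k * sincDeriv j x (κ k ^ 2)) =
          C k * ((x * sincDeriv j x (κ k ^ 2) : ℝ) : ℂ) := fun x => by push_cast; ring
      simp_rw [this]
      rw [intervalIntegral.integral_const_mul, intervalIntegral.integral_ofReal]
      push_cast
      ring
    have h2 : (∫ x in (0 : ℝ)..τ, (x : ℂ) *
        ∑ b ∈ Finset.range B, sincCoeff (j + b) x * (t b / b.factorial)) =
        ∑ b ∈ Finset.range B, -2 * (sincCoeff (j + 1 + b) τ * (t b / b.factorial)) := by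
      simp_rw [Finset.mul_sum]
      rw [intervalIntegral.integral_finsetSum]
      · refine Finset.sum_congr rfl fun b _ => ?_
        have : ∀ x : ℝ, (x : ℂ) * (sincCoeff (j + b) x * (t b / b.factorial)) =
            (t b / b.factorial) * ((x * sincCoeff (j + b) x : ℝ) : ℂ) := fun x => by
          push_cast; ring
        simp_rw [this]
        rw [intervalIntegral.integral_const_mul, intervalIntegral.integral_ofReal,
          integral_mul_sincCoeff, show j + 1 + b = j + b + 1 by ring]
        push_cast
        ring
      · intro b _
        have := continuous_sincCoeff (j + b)
        exact Continuous.intervalIntegrable (by fun_prop) _ _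
    rw [h2, ← Finset.mul_sum] at key
    have h3 := key.mul_left (-(1 / 2))
    rw [← mul_assoc, show (-(1 / 2) : ℂ) * -2 = 1 by norm_num, one_mul] at h3
    exact h3.congr_fun h1

/-- The locality statement for `∂_u^j sin(τ√u)/√u` at `u = |∂|² + s`: by Taylor expansion it follows
from the case `s = 0` for all higher derivatives. -/
theorem IsLocalTaylor.hasSum_add {κ : ℤ → ℝ} {C : ℤ → ℂ} {t : ℕ → ℂ} {B : ℕ} {T : ℝ}
    (h : IsLocalTaylor κ C t B T) {τ : ℝ} (hτ : τ ∈ Set.Icc 0 T) (j : ℕ) (s : ℝ) :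
    HasSum (fun k => C k * sincDeriv j τ (κ k ^ 2 + s))
      (∑ b ∈ Finset.range B, sincDeriv (j + b) τ s * (t b / b.factorial)) := by
  obtain ⟨U, hU, hb⟩ := h.exists_bound
  have hT : 0 ≤ T := hτ.1.trans hτ.2
  have hU0 : ∀ k, 0 ≤ U k := fun k => (norm_nonneg _).trans (hb k 0 ⟨le_rfl, hT⟩)
  -- The double series of the Taylor expansions about `κ k ^ 2` is summed in both orders.
  set G : ℤ × ℕ → ℂ := fun p =>
    C p.1 * sincDeriv (j + p.2) τ (κ p.1 ^ 2) * (s ^ p.2 / p.2.factorial : ℝ) with hG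
  have hs : Summable G := by
    have hbd : Summable fun p : ℤ × ℕ => (T ^ 2 / 2) ^ j *
        (U p.1 * (((T ^ 2 / 2) * |s|) ^ p.2 / p.2.factorial)) :=
      (hU.mul_of_nonneg (Real.summable_pow_div_factorial _) hU0
        (fun r => by positivity)).mul_left _
    refine Summable.of_norm_bounded hbd fun p => ?_
    rw [hG, norm_mul, Complex.norm_real]
    have h2 : ‖s ^ p.2 / (p.2.factorial : ℝ)‖ = |s| ^ p.2 / p.2.factorial := by
      rw [norm_div, norm_pow]; simp
    rw [h2]
    refine (mul_le_mul_of_nonneg_right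
      (norm_mul_sincDeriv_le (hU0 p.1) (hb p.1) (j + p.2) τ hτ) (by positivity)).trans
      (le_of_eq ?_)
    rw [mul_pow, pow_add]
    ring
  have h1 : HasSum (fun k => C k * (sincDeriv j τ (κ k ^ 2 + s) : ℂ)) (∑' p, G p) := by
    refine HasSum.prod_fiberwise hs.hasSum fun k => ?_
    have := (Complex.hasSum_ofReal.2 (hasSum_sincDeriv_add j τ (κ k ^ 2) s)).mul_left (C k)
    refine this.congr_fun fun r => ?_
    simp only [hG]
    push_cast
    ring
  have h2 : HasSum (fun r : ℕ => (∑ b ∈ Finset.range B,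
      sincCoeff (j + r + b) τ * (t b / b.factorial)) * ((s ^ r / r.factorial : ℝ) : ℂ))
      (∑' p, G p) := by
    refine HasSum.prod_fiberwise ((Equiv.prodComm ℕ ℤ).hasSum_iff.2 hs.hasSum) fun r => ?_
    exact (h.hasSum (j + r) τ hτ).mul_right _
  have h3 : HasSum (fun r : ℕ => (∑ b ∈ Finset.range B,
      sincCoeff (j + r + b) τ * (t b / b.factorial)) * ((s ^ r / r.factorial : ℝ) : ℂ))
      (∑ b ∈ Finset.range B, sincDeriv (j + b) τ s * (t b / b.factorial)) := by
    have := hasSum_sum (s := Finset.range B) fun b _ =>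
      (Complex.hasSum_ofReal.2 (hasSum_sincDeriv (j + b) τ s)).mul_right (t b / b.factorial)
    refine this.congr_fun fun r => ?_
    rw [Finset.sum_mul]
    refine Finset.sum_congr rfl fun b _ => ?_
    rw [show j + r + b = j + b + r by ring]
    push_cast
    ring
  rw [← h2.unique h3]
  exact h1

theorem summable_prod_pi {d : ℕ} (c : Fin d → ℤ → ℂ) (hc : ∀ i, Summable fun k => ‖c i k‖) :
    Summable fun n : Fin d → ℤ => ∏ i, ‖c i (n i)‖ := by
  induction d with
  | zero => exact Summable.of_finite
  | succ d ih =>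
    rw [← (Fin.consEquiv fun _ => ℤ).summable_iff]
    refine ((hc 0).mul_of_nonneg (ih (fun i => c i.succ) fun i => hc i.succ)
      (fun _ => norm_nonneg _) (fun _ => Finset.prod_nonneg fun _ _ => norm_nonneg _)).congr ?_
    intro p
    simp [Fin.prod_univ_succ, Fin.consEquiv]

theorem hasSum_prod_pi {d : ℕ} (c : Fin d → ℤ → ℂ) (x : Fin d → ℂ)
    (hc : ∀ i, Summable fun k => ‖c i k‖) (hx : ∀ i, HasSum (c i) (x i)) :
    HasSum (fun n : Fin d → ℤ => ∏ i, c i (n i)) (∏ i, x i) := by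
  induction d with
  | zero => simp
  | succ d ih =>
    rw [← (Fin.consEquiv fun _ => ℤ).hasSum_iff]
    have hs : Summable fun n : Fin d → ℤ => ‖∏ i, c i.succ (n i)‖ := by
      simp_rw [norm_prod]
      exact summable_prod_pi (fun i => c i.succ) fun i => hc i.succ
    have hprod : HasSum (fun n : Fin d → ℤ => ∏ i, c i.succ (n i)) (∏ i, x (Fin.succ i)) :=
      ih (fun i => c i.succ) (fun i => x i.succ) (fun i => hc i.succ) fun i => hx i.succ
    have hmul : Summable fun p : ℤ × (Fin d → ℤ) => c 0 p.1 * ∏ i : Fin d, c i.succ (p.2 i) := by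
      refine Summable.of_norm ?_
      simp_rw [norm_mul]
      exact (hc 0).mul_of_nonneg hs (fun _ => norm_nonneg _) fun _ => norm_nonneg _
    have := HasSum.mul (hx 0) hprod hmul
    rw [Fin.prod_univ_succ]
    refine this.congr_fun fun p => ?_
    simp [Fin.prod_univ_succ, Fin.consEquiv]

theorem summable_prod_mul_sincDeriv {d : ℕ} {κ : Fin d → ℤ → ℝ} {C : Fin d → ℤ → ℂ} {τ : ℝ}
    (hτ : 0 ≤ τ) (hC : ∀ i, Summable fun k => ‖C i k‖) (j : ℕ) {s : ℝ} (hs : 0 ≤ s) :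
    Summable fun n : Fin d → ℤ =>
      (∏ i, C i (n i)) * (sincDeriv j τ (∑ i, κ i (n i) ^ 2 + s) : ℂ) := by
  refine Summable.of_norm_bounded
    ((summable_prod_pi C hC).mul_right (τ * (τ ^ 2 / 2) ^ j)) fun n => ?_
  rw [norm_mul, norm_prod, Complex.norm_real]
  gcongr
  exact abs_sincDeriv_le (add_nonneg (Finset.sum_nonneg fun i _ => sq_nonneg _) hs) hτ j

/-- Locality in several variables, when all Fourier series converge absolutely: one variable is
treated after the other. -/
theorem hasSum_prod_mul_sincDeriv {d : ℕ} {κ : Fin d → ℤ → ℝ} {C : Fin d → ℤ → ℂ}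
    {t : Fin d → ℕ → ℂ} {B : ℕ} {T : Fin d → ℝ} {τ : ℝ} (hτ0 : 0 ≤ τ) (hτ : ∀ i, τ ≤ T i)
    (hL : ∀ i, IsLocalTaylor (κ i) (C i) (t i) B (T i))
    (hC : ∀ i, Summable fun k => ‖C i k‖) (j : ℕ) {s : ℝ} (hs : 0 ≤ s) :
    HasSum (fun n : Fin d → ℤ =>
        (∏ i, C i (n i)) * (sincDeriv j τ (∑ i, κ i (n i) ^ 2 + s) : ℂ))
      (∑ b : Fin d → Fin B, sincDeriv (j + ∑ i, (b i : ℕ)) τ s *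
        ∏ i, (t i (b i) / (b i : ℕ).factorial)) := by
  induction d generalizing j s with
  | zero =>
    simp only [Finset.univ_eq_empty, Finset.prod_empty, Finset.sum_empty, zero_add, one_mul,
      add_zero, mul_one, Finset.sum_const, Finset.card_univ, Fintype.card_unique, one_smul]
    exact hasSum_unique (fun n : Fin 0 → ℤ => (sincDeriv j τ s : ℂ))
  | succ d ih =>
    have hsum := (Fin.consEquiv fun _ => ℤ).summable_iff.2
      (summable_prod_mul_sincDeriv (κ := κ) hτ0 hC j hs)
    rw [← (Fin.consEquiv fun _ => ℤ).hasSum_iff]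
    obtain ⟨A, hA⟩ := (Equiv.prodComm (Fin d → ℤ) ℤ).summable_iff.2 hsum
    have h1 : HasSum (fun n : Fin d → ℤ => ∑ b ∈ Finset.range B,
        (∏ i, C i.succ (n i)) * (sincDeriv (j + b) τ (∑ i, κ i.succ (n i) ^ 2 + s) : ℂ) *
          (t 0 b / b.factorial)) A := by
      refine HasSum.prod_fiberwise hA fun n => ?_
      have := ((hL 0).hasSum_add ⟨hτ0, hτ 0⟩ j (∑ i, κ i.succ (n i) ^ 2 + s)).mul_left
        (∏ i, C i.succ (n i))
      rw [Finset.mul_sum] at this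
      simp_rw [mul_assoc]
      refine this.congr_fun fun k => ?_
      simp [Fin.prod_univ_succ, Fin.sum_univ_succ, Fin.consEquiv, add_assoc]
      ring
    have h2 := hasSum_sum (s := Finset.range B) fun b _ =>
      (ih (fun i => hτ i.succ) (fun i => hL i.succ) (fun i => hC i.succ) (j + b) hs).mul_right
        (t 0 b / b.factorial)
    have h3 := h1.unique h2
    have h4 := (Equiv.prodComm (Fin d → ℤ) ℤ).hasSum_iff.1 hA
    rw [h3] at h4
    convert h4 using 1
    rw [← (Fin.consEquiv fun _ => Fin B).sum_comp, Fintype.sum_prod_type, Finset.sum_range]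
    refine Finset.sum_congr rfl fun b _ => ?_
    rw [Finset.sum_mul]
    refine Finset.sum_congr rfl fun b' _ => ?_
    simp [Fin.prod_univ_succ, Fin.sum_univ_succ, Fin.consEquiv, add_assoc]
    ring

/-- Locality in several variables of `sin(τ|∂|)/|∂|`. In the direction `l` the Fourier series may
fail to converge absolutely, provided the series in all variables does so. -/
theorem hasSum_prod_mul_sinc {d : ℕ} {κ : Fin d → ℤ → ℝ} {C : Fin d → ℤ → ℂ}
    {t : Fin d → ℕ → ℂ} {B : ℕ} {T : Fin d → ℝ} {τ : ℝ} (hτ0 : 0 ≤ τ) (hτ : ∀ i, τ ≤ T i)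
    (hL : ∀ i, IsLocalTaylor (κ i) (C i) (t i) B (T i)) (l : Fin d)
    (hC : ∀ i, i ≠ l → Summable fun k => ‖C i k‖)
    (hsum : Summable fun n : Fin d → ℤ =>
      (∏ i, C i (n i)) * (sincDeriv 0 τ (∑ i, κ i (n i) ^ 2) : ℂ)) :
    HasSum (fun n : Fin d → ℤ =>
        (∏ i, C i (n i)) * (sincDeriv 0 τ (∑ i, κ i (n i) ^ 2) : ℂ))
      (∑ b : Fin d → Fin B, sincCoeff (∑ i, (b i : ℕ)) τ *
        ∏ i, (t i (b i) / (b i : ℕ).factorial)) := by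
  obtain _ | d := d
  · exact l.elim0
  rw [← (Fin.insertNthEquiv (fun _ => ℤ) l).summable_iff] at hsum
  rw [← (Fin.insertNthEquiv (fun _ => ℤ) l).hasSum_iff]
  obtain ⟨A, hA⟩ := (Equiv.prodComm (Fin d → ℤ) ℤ).summable_iff.2 hsum
  have h1 : HasSum (fun n : Fin d → ℤ => ∑ b ∈ Finset.range B,
      (∏ i, C (l.succAbove i) (n i)) *
        (sincDeriv (0 + b) τ (∑ i, κ (l.succAbove i) (n i) ^ 2 + 0) : ℂ) *
        (t l b / b.factorial)) A := by
    refine HasSum.prod_fiberwise hA fun n => ?_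
    have := ((hL l).hasSum_add ⟨hτ0, hτ l⟩ 0 (∑ i, κ (l.succAbove i) (n i) ^ 2)).mul_left
      (∏ i, C (l.succAbove i) (n i))
    rw [Finset.mul_sum] at this
    simp_rw [mul_assoc, add_zero]
    refine this.congr_fun fun k => ?_
    simp [Fin.prod_univ_succAbove _ l, Fin.sum_univ_succAbove _ l, Fin.insertNthEquiv]
    ring
  have h2 := hasSum_sum (s := Finset.range B) fun b _ =>
    (hasSum_prod_mul_sincDeriv hτ0 (fun i => hτ (l.succAbove i)) (fun i => hL (l.succAbove i))
      (fun i => hC (l.succAbove i) (Fin.succAbove_ne l i)) (0 + b) le_rfl).mul_right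
      (t l b / b.factorial)
  have h3 := h1.unique h2
  have h4 := (Equiv.prodComm (Fin d → ℤ) ℤ).hasSum_iff.1 hA
  rw [h3] at h4
  convert h4 using 1
  rw [← (Fin.insertNthEquiv (fun _ => Fin B) l).sum_comp, Fintype.sum_prod_type, Finset.sum_range]
  refine Finset.sum_congr rfl fun b _ => ?_
  rw [Finset.sum_mul]
  refine Finset.sum_congr rfl fun b' _ => ?_
  simp [Fin.prod_univ_succAbove _ l, Fin.sum_univ_succAbove _ l, Fin.insertNthEquiv,
    sincDeriv_zero_right]
  ring

/-! ### Periodic splines -/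

/-- A periodic `C^m` spline of degree at most `2m+1` with `K` cells of length `h` per period: `P j`
is the polynomial on the `j`-th cell, in the coordinate centred at the left end of that cell. -/
structure IsSpline (m K : ℕ) (h : ℝ) (P : ℤ → Polynomial ℂ) : Prop where
  natDegree_le : ∀ j, (P j).natDegree ≤ 2 * m + 1
  matching : ∀ j a, a ≤ m → (Polynomial.derivative^[a] (P j)).eval (h : ℂ) =
    (Polynomial.derivative^[a] (P (j + 1))).eval 0
  periodic : ∀ j, P (j + K) = P j

/-- The piecewise polynomial function with cells `[o + j h, o + (j + 1) h)`. -/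
def piecewisePoly (o h : ℝ) (P : ℤ → Polynomial ℂ) (x : ℝ) : ℂ :=
  (P ⌊(x - o) / h⌋).eval ((x - (o + (⌊(x - o) / h⌋ : ℝ) * h) : ℝ) : ℂ)

/-- The exponent `2πi n / L` of the `n`-th character of period `L`, i.e. `i` times the wave
number. -/
def waveExp (L : ℝ) (n : ℤ) : ℂ := Complex.I * ((2 * Real.pi * n / L : ℝ) : ℂ)

/-- The Fourier coefficient of a function of period `L`, computed on `[a, a + L]`. -/
def coefOne (a L : ℝ) (f : ℝ → ℂ) (n : ℤ) : ℂ :=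
  (L : ℂ)⁻¹ * ∫ x in a..a + L, f x * Complex.exp (-(waveExp L n * x))

theorem exp_waveExp_mul_period {L : ℝ} (hL : L ≠ 0) (n : ℤ) :
    Complex.exp (-(waveExp L n * L)) = 1 := by
  rw [Complex.exp_eq_one_iff]
  refine ⟨-n, ?_⟩
  have : (L : ℂ) ≠ 0 := by exact_mod_cast hL
  rw [waveExp]
  push_cast
  field_simp

theorem norm_exp_waveExp (L : ℝ) (n : ℤ) (x : ℝ) : ‖Complex.exp (waveExp L n * x)‖ = 1 := by
  rw [waveExp, show Complex.I * ((2 * Real.pi * n / L : ℝ) : ℂ) * x =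
    ((2 * Real.pi * n / L * x : ℝ) : ℂ) * Complex.I by push_cast; ring]
  exact Complex.norm_exp_ofReal_mul_I _

theorem norm_exp_neg_waveExp (L : ℝ) (n : ℤ) (x : ℝ) :
    ‖Complex.exp (-(waveExp L n * x))‖ = 1 := by
  rw [Complex.exp_neg, norm_inv, norm_exp_waveExp, inv_one]

/-! ### Piecewise polynomials -/

theorem piecewisePoly_of_mem_Ico {o h : ℝ} (hh : 0 < h) (P : ℤ → Polynomial ℂ) {j : ℤ} {x : ℝ}
    (hx : x ∈ Set.Ico (o + j * h) (o + (j + 1) * h)) :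
    piecewisePoly o h P x = (P j).eval ((x - (o + j * h) : ℝ) : ℂ) := by
  have : ⌊(x - o) / h⌋ = j := by
    rw [Int.floor_eq_iff, le_div_iff₀ hh, div_lt_iff₀ hh]
    constructor <;> linarith [hx.1, hx.2]
  rw [piecewisePoly, this]

theorem piecewisePoly_of_mem_Icc {o h : ℝ} (hh : 0 < h) {P : ℤ → Polynomial ℂ}
    (hP : ∀ j, (P j).eval (h : ℂ) = (P (j + 1)).eval 0) {j : ℤ} {x : ℝ}
    (hx : x ∈ Set.Icc (o + j * h) (o + (j + 1) * h)) :
    piecewisePoly o h P x = (P j).eval ((x - (o + j * h) : ℝ) : ℂ) := by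
  rcases hx.2.lt_or_eq with h1 | h1
  · exact piecewisePoly_of_mem_Ico hh P ⟨hx.1, h1⟩
  · rw [piecewisePoly_of_mem_Ico hh P (j := j + 1) ⟨by push_cast; exact h1.ge, by
      push_cast; nlinarith⟩, h1]
    have e1 : (o + ((j : ℝ) + 1) * h - (o + ((j + 1 : ℤ) : ℝ) * h) : ℝ) = 0 := by push_cast; ring
    have e2 : (o + ((j : ℝ) + 1) * h - (o + (j : ℝ) * h) : ℝ) = h := by ring
    rw [e1, e2, hP, Complex.ofReal_zero]

theorem mem_Ico_floor {o h : ℝ} (hh : 0 < h) (x : ℝ) :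
    x ∈ Set.Ico (o + (⌊(x - o) / h⌋ : ℝ) * h) (o + ((⌊(x - o) / h⌋ : ℝ) + 1) * h) := by
  have h1 := Int.floor_le ((x - o) / h)
  have h2 := Int.lt_floor_add_one ((x - o) / h)
  rw [le_div_iff₀ hh] at h1
  rw [div_lt_iff₀ hh] at h2
  constructor <;> linarith

theorem continuous_piecewisePoly {o h : ℝ} (hh : 0 < h) {P : ℤ → Polynomial ℂ}
    (hP : ∀ j, (P j).eval (h : ℂ) = (P (j + 1)).eval 0) : Continuous (piecewisePoly o h P) := by
  rw [continuous_iff_continuousAt]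
  intro x
  have hx := mem_Ico_floor (o := o) hh x
  set j := ⌊(x - o) / h⌋ with hj
  have hcell : ∀ k : ℤ, ContinuousOn (piecewisePoly o h P)
      (Set.Icc (o + k * h) (o + (k + 1) * h)) := by
    intro k
    refine ContinuousOn.congr (f := fun x : ℝ => (P k).eval ((x - (o + k * h) : ℝ) : ℂ)) ?_
      fun y hy => piecewisePoly_of_mem_Icc hh hP hy
    exact ((P k).continuous.comp (by fun_prop)).continuousOn
  have h1 := (hcell (j - 1)).union_of_isClosed (hcell j) isClosed_Icc isClosed_Icc
  have e : (o + (((j - 1 : ℤ) : ℝ) + 1) * h) = o + j * h := by push_cast; ring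
  rw [e, Set.Icc_union_Icc_eq_Icc (by push_cast; nlinarith) (by nlinarith)] at h1
  refine h1.continuousAt (Icc_mem_nhds ?_ hx.2)
  push_cast
  nlinarith [hx.1]

theorem periodic_piecewisePoly {o h : ℝ} (hh : 0 < h) {P : ℤ → Polynomial ℂ} {K : ℕ}
    (hP : ∀ j, P (j + K) = P j) : Function.Periodic (piecewisePoly o h P) (K * h) := by
  intro x
  have e : (x + K * h - o) / h = (x - o) / h + ((K : ℤ) : ℝ) := by
    field_simp; push_cast; ring
  rw [piecewisePoly, piecewisePoly, e, Int.floor_add_intCast, hP]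
  congr 2
  push_cast
  ring

/-! ### Fourier coefficients of piecewise polynomials -/

/-- The integral of a piecewise polynomial times `exp(-λ x)`, cell by cell. -/
def cellSum (o h : ℝ) (K : ℕ) (P : ℤ → Polynomial ℂ) (lam : ℂ) : ℂ :=
  ∑ j ∈ Finset.range K, Complex.exp (-(lam * ((o + j * h : ℝ) : ℂ))) *
    ∫ x in (0 : ℝ)..h, (P j).eval (x : ℂ) * Complex.exp (-(lam * x))

/-- The jumps of a piecewise polynomial at the nodes, weighted with `exp(-λ x)`. -/
def jumpSum (o h : ℝ) (K : ℕ) (P : ℤ → Polynomial ℂ) (lam : ℂ) : ℂ :=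
  ∑ j ∈ Finset.range K, Complex.exp (-(lam * ((o + j * h : ℝ) : ℂ))) *
    ((P j).eval 0 - (P (j - 1)).eval (h : ℂ))

/-- Integration by parts on one cell. -/
theorem mul_integral_eval_mul_exp (P : Polynomial ℂ) (lam : ℂ) (h : ℝ) :
    lam * ∫ x in (0 : ℝ)..h, P.eval (x : ℂ) * Complex.exp (-(lam * x)) =
      P.eval 0 - P.eval (h : ℂ) * Complex.exp (-(lam * h)) +
        ∫ x in (0 : ℝ)..h, (Polynomial.derivative P).eval (x : ℂ) * Complex.exp (-(lam * x)) := by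
  have hd : ∀ x : ℝ, HasDerivAt (fun x : ℝ => P.eval (x : ℂ) * Complex.exp (-(lam * x)))
      ((Polynomial.derivative P).eval (x : ℂ) * Complex.exp (-(lam * x)) -
        lam * (P.eval (x : ℂ) * Complex.exp (-(lam * x)))) x := by
    intro x
    have h1 : HasDerivAt (fun z : ℂ => P.eval z * Complex.exp (-(lam * z)))
        ((Polynomial.derivative P).eval (x : ℂ) * Complex.exp (-(lam * x)) +
          P.eval (x : ℂ) * (Complex.exp (-(lam * x)) * -(lam * 1))) (x : ℂ) :=
      (P.hasDerivAt _).mul (((hasDerivAt_id _).const_mul lam).neg.cexp)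
    convert h1.comp_ofReal using 1
    ring
  have hc : Continuous fun x : ℝ =>
      (Polynomial.derivative P).eval (x : ℂ) * Complex.exp (-(lam * x)) :=
    ((Polynomial.derivative P).continuous.comp Complex.continuous_ofReal).mul (by fun_prop)
  have hc2 : Continuous fun x : ℝ => lam * (P.eval (x : ℂ) * Complex.exp (-(lam * x))) :=
    continuous_const.mul ((P.continuous.comp Complex.continuous_ofReal).mul (by fun_prop))
  have h2 := intervalIntegral.integral_eq_sub_of_hasDerivAt (a := 0) (b := h)
    (fun x _ => hd x) ((hc.sub hc2).intervalIntegrable _ _)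
  rw [intervalIntegral.integral_sub (hc.intervalIntegrable _ _) (hc2.intervalIntegrable _ _),
    intervalIntegral.integral_const_mul] at h2
  simp only [Complex.ofReal_zero, mul_zero, neg_zero, Complex.exp_zero, mul_one] at h2
  linear_combination -h2

/-- Integration by parts over one period: the boundary terms of neighbouring cells combine to the
jumps. -/
theorem mul_cellSum {o h : ℝ} {K : ℕ} {P : ℤ → Polynomial ℂ} {lam : ℂ}
    (hP : ∀ j, P (j + K) = P j) (hlam : Complex.exp (-(lam * ((K * h : ℝ) : ℂ))) = 1) :
    lam * cellSum o h K P lam = jumpSum o h K P lam +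
      cellSum o h K (fun j => Polynomial.derivative (P j)) lam := by
  -- The boundary terms at the right ends are those at the left ends, with the index shifted
  -- cyclically.
  have key : ∑ j ∈ Finset.range K, Complex.exp (-(lam * ((o + j * h : ℝ) : ℂ))) *
        ((P j).eval (h : ℂ) * Complex.exp (-(lam * h))) =
      ∑ j ∈ Finset.range K, Complex.exp (-(lam * ((o + j * h : ℝ) : ℂ))) *
        (P (j - 1)).eval (h : ℂ) := by
    set G : ℕ → ℂ := fun j => Complex.exp (-(lam * ((o + j * h : ℝ) : ℂ))) *
        (P (j - 1)).eval (h : ℂ) with hG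
    have h1 : ∀ j : ℕ, Complex.exp (-(lam * ((o + j * h : ℝ) : ℂ))) *
        ((P j).eval (h : ℂ) * Complex.exp (-(lam * h))) = G (j + 1) := by
      intro j
      simp only [hG]
      rw [mul_left_comm, ← Complex.exp_add, mul_comm]
      congr 2
      · push_cast; ring
      · simp
    have h2 : G K = G 0 := by
      simp only [hG]
      have e : -(lam * ((o + K * h : ℝ) : ℂ)) =
          -(lam * ((o + (0 : ℕ) * h : ℝ) : ℂ)) + -(lam * ((K * h : ℝ) : ℂ)) := by
        push_cast; ring
      rw [e, Complex.exp_add, hlam, mul_one, ← hP ((0 : ℕ) - 1)]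
      congr 3
    simp_rw [h1]
    have h3 := Finset.sum_range_succ G K
    rw [Finset.sum_range_succ' G K, h2] at h3
    exact add_right_cancel h3
  rw [cellSum, Finset.mul_sum, jumpSum, cellSum]
  simp_rw [mul_sub, Finset.sum_sub_distrib]
  rw [← key, ← Finset.sum_sub_distrib, ← Finset.sum_add_distrib]
  refine Finset.sum_congr rfl fun j _ => ?_
  rw [mul_left_comm, mul_integral_eval_mul_exp]
  ring

theorem pow_mul_cellSum {o h : ℝ} {K : ℕ} {P : ℤ → Polynomial ℂ} {lam : ℂ}
    (hP : ∀ j, P (j + K) = P j) (hlam : Complex.exp (-(lam * ((K * h : ℝ) : ℂ))) = 1) (N : ℕ) :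
    lam ^ N * cellSum o h K P lam =
      ∑ l ∈ Finset.range N, lam ^ (N - 1 - l) *
        jumpSum o h K (fun j => Polynomial.derivative^[l] (P j)) lam +
      cellSum o h K (fun j => Polynomial.derivative^[N] (P j)) lam := by
  induction N with
  | zero => simp
  | succ N ih =>
    rw [pow_succ', mul_assoc, ih, mul_add, mul_cellSum (fun j => by rw [hP]) hlam,
      Finset.sum_range_succ, Finset.mul_sum]
    simp_rw [← Function.iterate_succ_apply' (f := (Polynomial.derivative (R := ℂ)))]
    rw [show N + 1 - 1 - N = 0 by omega, pow_zero, one_mul, add_assoc]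
    congr 1
    refine Finset.sum_congr rfl fun l hl => ?_
    rw [Finset.mem_range] at hl
    rw [← mul_assoc, ← pow_succ', show N - 1 - l + 1 = N + 1 - 1 - l by omega]

theorem jumpSum_eq_zero {o h : ℝ} {K : ℕ} {P : ℤ → Polynomial ℂ} {lam : ℂ}
    (hP : ∀ j, (P j).eval (h : ℂ) = (P (j + 1)).eval 0) : jumpSum o h K P lam = 0 := by
  refine Finset.sum_eq_zero fun j _ => ?_
  rw [hP, sub_add_cancel, sub_self, mul_zero]

/-- Repeated integration by parts for splines: the derivatives of order at most `m` do not jump. -/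
theorem IsSpline.pow_mul_cellSum_of_le {m K : ℕ} {o h : ℝ} {P : ℤ → Polynomial ℂ}
    (hP : IsSpline m K h P) {lam : ℂ} (hlam : Complex.exp (-(lam * ((K * h : ℝ) : ℂ))) = 1)
    {a : ℕ} (ha : a ≤ m) : lam ^ a * cellSum o h K P lam =
      cellSum o h K (fun j => Polynomial.derivative^[a] (P j)) lam := by
  rw [pow_mul_cellSum hP.periodic hlam, Finset.sum_eq_zero, zero_add]
  intro l hl
  rw [Finset.mem_range] at hl
  rw [jumpSum_eq_zero fun j => hP.matching j l (by omega), mul_zero]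

/-- The derivative of order `2m+2` of a spline is a combination of derivatives of order at most `m`
of Dirac masses at the nodes. -/
theorem IsSpline.pow_mul_cellSum_top {m K : ℕ} {o h : ℝ} {P : ℤ → Polynomial ℂ}
    (hP : IsSpline m K h P) {lam : ℂ} (hlam : Complex.exp (-(lam * ((K * h : ℝ) : ℂ))) = 1) :
    lam ^ (2 * m + 2) * cellSum o h K P lam = ∑ a ∈ Finset.range (m + 1), lam ^ a *
      jumpSum o h K (fun j => Polynomial.derivative^[2 * m + 1 - a] (P j)) lam := by
  have h0 : cellSum o h K (fun j => Polynomial.derivative^[2 * m + 2] (P j)) lam = 0 := by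
    refine Finset.sum_eq_zero fun j _ => ?_
    simp only
    rw [Polynomial.iterate_derivative_eq_zero ((hP.natDegree_le j).trans_lt (by omega))]
    simp
  -- The jumps of the derivatives of order at most `m` vanish; the remaining ones are renumbered by
  -- the power of `λ` in front of them.
  rw [pow_mul_cellSum hP.periodic hlam, h0, add_zero,
    ← Finset.sum_range_reflect, show 2 * m + 2 = (m + 1) + (m + 1) by ring,
    Finset.sum_range_add, Finset.sum_eq_zero (s := Finset.range (m + 1)) (f := fun x =>
      lam ^ (m + 1 + (m + 1) - 1 - (m + 1 + (m + 1) - 1 - ((m + 1) + x))) *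
      jumpSum o h K (fun j => Polynomial.derivative^[m + 1 + (m + 1) - 1 - (m + 1 + x)] (P j)) lam),
    add_zero]
  · refine Finset.sum_congr rfl fun a ha => ?_
    rw [Finset.mem_range] at ha
    rw [show m + 1 + (m + 1) - 1 - (m + 1 + (m + 1) - 1 - a) = a by omega,
      show m + 1 + (m + 1) - 1 - a = 2 * m + 1 - a by omega]
  · intro x hx
    rw [Finset.mem_range] at hx
    rw [jumpSum_eq_zero fun j => hP.matching j _ (by omega), mul_zero]

theorem integral_piecewisePoly_cell {o h : ℝ} (hh : 0 < h) (P : ℤ → Polynomial ℂ) (lam : ℂ)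
    (j : ℤ) : ∫ x in (o + j * h)..(o + (j + 1) * h),
      piecewisePoly o h P x * Complex.exp (-(lam * x)) =
    Complex.exp (-(lam * ((o + j * h : ℝ) : ℂ))) *
      ∫ x in (0 : ℝ)..h, (P j).eval (x : ℂ) * Complex.exp (-(lam * x)) := by
  have h1 : ∫ x in (o + j * h)..(o + (j + 1) * h),
      piecewisePoly o h P x * Complex.exp (-(lam * x)) =
      ∫ x in (o + j * h)..(o + (j + 1) * h),
        (P j).eval ((x - (o + j * h) : ℝ) : ℂ) * Complex.exp (-(lam * x)) := by
    rw [intervalIntegral.integral_of_le (by nlinarith), intervalIntegral.integral_of_le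
      (by nlinarith), ← integral_Ico_eq_integral_Ioc, ← integral_Ico_eq_integral_Ioc]
    refine setIntegral_congr_fun measurableSet_Ico fun x hx => ?_
    rw [piecewisePoly_of_mem_Ico hh P hx]
  rw [h1, ← intervalIntegral.integral_const_mul]
  have h2 := intervalIntegral.integral_comp_sub_right (a := o + j * h) (b := o + (j + 1) * h)
    (fun x : ℝ => Complex.exp (-(lam * ((o + j * h : ℝ) : ℂ))) *
      ((P j).eval (x : ℂ) * Complex.exp (-(lam * x)))) (o + j * h)
  rw [sub_self, show o + ((j : ℝ) + 1) * h - (o + j * h) = h by ring] at h2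
  rw [← h2]
  congr 1
  funext x
  rw [mul_left_comm, ← Complex.exp_add]
  congr 2
  push_cast
  ring

theorem coefOne_piecewisePoly {o h : ℝ} (hh : 0 < h) {P : ℤ → Polynomial ℂ}
    (hP : ∀ j, (P j).eval (h : ℂ) = (P (j + 1)).eval 0) (K : ℕ) (n : ℤ) :
    coefOne o (K * h) (piecewisePoly o h P) n =
      ((K * h : ℝ) : ℂ)⁻¹ * cellSum o h K P (waveExp (K * h) n) := by
  have hc : Continuous fun x : ℝ =>
      piecewisePoly o h P x * Complex.exp (-(waveExp (K * h) n * x)) :=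
    (continuous_piecewisePoly hh hP).mul (by fun_prop)
  have h1 := intervalIntegral.sum_integral_adjacent_intervals (a := fun j : ℕ => o + j * h)
    (n := K) (fun k _ => hc.intervalIntegrable (μ := volume) (o + k * h) (o + (k + 1 : ℕ) * h))
  rw [coefOne, cellSum]
  congr 1
  simp only [Nat.cast_zero, zero_mul, add_zero] at h1
  rw [← h1]
  refine Finset.sum_congr rfl fun j _ => ?_
  have := integral_piecewisePoly_cell (o := o) hh P (waveExp (K * h) n) (j : ℤ)
  push_cast at this ⊢
  exact this

theorem coefOne_eq_of_periodic {L : ℝ} {f : ℝ → ℂ} (hL : L ≠ 0) (hf : Function.Periodic f L)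
    (a b : ℝ) (n : ℤ) : coefOne a L f n = coefOne b L f n := by
  have hp : Function.Periodic (fun x : ℝ => f x * Complex.exp (-(waveExp L n * x))) L := by
    intro x
    simp only
    rw [hf x]
    congr 1
    rw [Complex.ofReal_add, mul_add, neg_add, Complex.exp_add, exp_waveExp_mul_period hL, mul_one]
  rw [coefOne, coefOne, hp.intervalIntegral_add_eq a b]

/-! ### Fourier inversion for splines -/

theorem norm_waveExp {L : ℝ} (hL : 0 < L) (n : ℤ) :
    ‖waveExp L n‖ = 2 * Real.pi / L * |(n : ℝ)| := by
  rw [waveExp, norm_mul, Complex.norm_I, one_mul, Complex.norm_real, Real.norm_eq_abs,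
    abs_div, abs_mul, abs_mul, abs_of_pos hL, abs_of_pos Real.pi_pos, abs_two]
  ring

theorem norm_jumpSum_le (o h : ℝ) (K : ℕ) (P : ℤ → Polynomial ℂ) (L : ℝ) (n : ℤ) :
    ‖jumpSum o h K P (waveExp L n)‖ ≤
      ∑ j ∈ Finset.range K, ‖(P j).eval 0 - (P (j - 1)).eval (h : ℂ)‖ := by
  refine (norm_sum_le _ _).trans (le_of_eq (Finset.sum_congr rfl fun j _ => ?_))
  rw [norm_mul, norm_exp_neg_waveExp, one_mul]

/-- The Fourier coefficients of a `C^m` spline decay like `|n|^(-m-2)`. -/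
theorem IsSpline.exists_norm_cellSum_le {m K : ℕ} {o h : ℝ} (hh : 0 < h) (hK : 0 < K)
    {P : ℤ → Polynomial ℂ} (hP : IsSpline m K h P) : ∃ C : ℝ, 0 ≤ C ∧ ∀ n : ℤ, n ≠ 0 →
      ‖cellSum o h K P (waveExp (K * h) n)‖ * |(n : ℝ)| ^ (m + 2) ≤ C := by
  have hL : (0 : ℝ) < K * h := by positivity
  set r : ℝ := 2 * Real.pi / (K * h) with hr
  have hr0 : 0 < r := by positivity
  set J : ℕ → ℝ := fun a => ∑ j ∈ Finset.range K,
    ‖(Polynomial.derivative^[2 * m + 1 - a] (P j)).eval 0 -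
      (Polynomial.derivative^[2 * m + 1 - a] (P (j - 1))).eval (h : ℂ)‖ with hJ
  have hJ0 : ∀ a, 0 ≤ J a := fun a => Finset.sum_nonneg fun _ _ => norm_nonneg _
  refine ⟨(∑ a ∈ Finset.range (m + 1), r ^ a * J a) / r ^ (2 * m + 2),
    div_nonneg (Finset.sum_nonneg fun a _ => mul_nonneg (by positivity) (hJ0 a)) (by positivity),
    fun n hn => ?_⟩
  have hn1 : (1 : ℝ) ≤ |(n : ℝ)| := by exact_mod_cast Int.one_le_abs hn
  have h1 := congrArg norm (hP.pow_mul_cellSum_top (o := o)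
    (lam := waveExp (K * h) n) (by exact_mod_cast exp_waveExp_mul_period hL.ne' n))
  rw [norm_mul, norm_pow, norm_waveExp hL, ← hr] at h1
  have h2 : ‖∑ a ∈ Finset.range (m + 1), waveExp (K * h) n ^ a *
      jumpSum o h K (fun j => Polynomial.derivative^[2 * m + 1 - a] (P j)) (waveExp (K * h) n)‖ ≤
      (∑ a ∈ Finset.range (m + 1), r ^ a * J a) * |(n : ℝ)| ^ m := by
    refine (norm_sum_le _ _).trans ?_
    rw [Finset.sum_mul]
    refine Finset.sum_le_sum fun a ha => ?_
    rw [Finset.mem_range] at ha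
    rw [norm_mul, norm_pow, norm_waveExp hL, ← hr, mul_pow]
    calc _ ≤ r ^ a * |(n : ℝ)| ^ m * J a := by
          gcongr
          · omega
          · exact norm_jumpSum_le _ _ _ _ _ _
      _ = _ := by ring
  rw [← h1, mul_pow] at h2
  rw [le_div_iff₀ (by positivity)]
  have hpos : 0 < |(n : ℝ)| ^ m := by positivity
  refine le_of_mul_le_mul_right (le_trans (le_of_eq ?_) h2) hpos
  ring

theorem summable_of_int_decay {f : ℤ → ℂ} {C : ℝ}
    (hf : ∀ n : ℤ, n ≠ 0 → ‖f n‖ * |(n : ℝ)| ^ 2 ≤ C) : Summable fun n => ‖f n‖ := by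
  have h1 : Summable fun n : ℤ => C * (1 / (n : ℝ) ^ 2) :=
    (Real.summable_one_div_int_pow.2 (by norm_num)).mul_left C
  refine Summable.of_norm_bounded_eventually h1 ?_
  filter_upwards [(Set.finite_singleton (0 : ℤ)).compl_mem_cofinite] with n hn
  have hn' : n ≠ 0 := hn
  have : (0 : ℝ) < (n : ℝ) ^ 2 := by positivity
  have h2 := hf n hn'
  rw [sq_abs] at h2
  rw [norm_norm, mul_one_div, le_div_iff₀ this]
  exact h2

theorem IsSpline.coefOne_eq {m K : ℕ} {o h : ℝ} (hh : 0 < h) (hK : 0 < K)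
    {P : ℤ → Polynomial ℂ} (hP : IsSpline m K h P) (b : ℝ) (n : ℤ) :
    coefOne b (K * h) (piecewisePoly o h P) n =
      ((K * h : ℝ) : ℂ)⁻¹ * cellSum o h K P (waveExp (K * h) n) := by
  rw [coefOne_eq_of_periodic (by positivity) (periodic_piecewisePoly hh hP.periodic) b o]
  exact coefOne_piecewisePoly hh (fun j => hP.matching j 0 (Nat.zero_le _)) K n

theorem IsSpline.coefOne_iterate_derivative {m K : ℕ} {o h : ℝ} (hh : 0 < h) (hK : 0 < K)
    {P : ℤ → Polynomial ℂ} (hP : IsSpline m K h P) (b : ℝ) (n : ℤ) {a : ℕ} (ha : a ≤ m) :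
    coefOne b (K * h) (piecewisePoly o h fun j => Polynomial.derivative^[a] (P j)) n =
      waveExp (K * h) n ^ a * coefOne b (K * h) (piecewisePoly o h P) n := by
  have hL : (K * h : ℝ) ≠ 0 := by positivity
  rw [hP.coefOne_eq hh hK, coefOne_eq_of_periodic hL (periodic_piecewisePoly hh
      fun j => by rw [hP.periodic]) b o,
    coefOne_piecewisePoly hh fun j => hP.matching j a ha, mul_left_comm,
    hP.pow_mul_cellSum_of_le (by exact_mod_cast exp_waveExp_mul_period hL n) ha]

theorem IsSpline.summable_coefOne {m K : ℕ} {o h : ℝ} (hh : 0 < h) (hK : 0 < K)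
    {P : ℤ → Polynomial ℂ} (hP : IsSpline m K h P) (b : ℝ) {a : ℕ} (ha : a ≤ m) :
    Summable fun n =>
      ‖waveExp (K * h) n ^ a * coefOne b (K * h) (piecewisePoly o h P) n‖ := by
  have hL : (0 : ℝ) < K * h := by positivity
  obtain ⟨C, hC0, hC⟩ := hP.exists_norm_cellSum_le (o := o) hh hK
  refine summable_of_int_decay (C := (2 * Real.pi / (K * h)) ^ a * (K * h)⁻¹ * C) fun n hn => ?_
  have hn1 : (1 : ℝ) ≤ |(n : ℝ)| := by exact_mod_cast Int.one_le_abs hn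
  rw [hP.coefOne_eq hh hK, norm_mul, norm_pow, norm_waveExp hL, norm_mul, norm_inv,
    Complex.norm_real, Real.norm_of_nonneg hL.le, mul_pow]
  calc _ = (2 * Real.pi / (K * h)) ^ a * (K * h)⁻¹ *
        (‖cellSum o h K P (waveExp (K * h) n)‖ * |(n : ℝ)| ^ (a + 2)) := by ring
    _ ≤ (2 * Real.pi / (K * h)) ^ a * (K * h)⁻¹ *
        (‖cellSum o h K P (waveExp (K * h) n)‖ * |(n : ℝ)| ^ (m + 2)) := by gcongr
    _ ≤ _ := by gcongr; exact hC n hn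

/-- A continuous periodic function is the sum of its Fourier series if that series converges
absolutely. -/
theorem hasSum_coefOne {L : ℝ} (hL : 0 < L) {f : ℝ → ℂ} (hf : Continuous f)
    (hp : Function.Periodic f L) (b : ℝ) (hs : Summable fun n => ‖coefOne b L f n‖) (x : ℝ) :
    HasSum (fun n => coefOne b L f n * Complex.exp (waveExp L n * x)) (f x) := by
  have : Fact (0 < L) := ⟨hL⟩
  have hcont : Continuous (hp.lift : AddCircle L → ℂ) := continuous_coinduced_dom.2 hf
  set F : C(AddCircle L, ℂ) := ⟨hp.lift, hcont⟩ with hF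
  have hFx : ∀ y : ℝ, F (y : AddCircle L) = f y := fun y => rfl
  have hexp : ∀ (n : ℤ) (y : ℝ), (fourier n (y : AddCircle L) : ℂ) =
      Complex.exp (waveExp L n * y) := by
    intro n y
    rw [fourier_coe_apply, waveExp]
    congr 1
    push_cast
    ring
  have hcoef : fourierCoeff F = coefOne b L f := by
    funext n
    rw [fourierCoeff_eq_intervalIntegral F n b, coefOne]
    simp_rw [hFx, hexp]
    rw [Complex.real_smul]
    push_cast
    rw [one_div]
    congr 2
    funext y
    rw [smul_eq_mul, mul_comm]
    congr 2
    rw [waveExp, waveExp]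
    push_cast
    ring
  have := has_pointwise_sum_fourier_series_of_summable (f := F)
    (by rw [hcoef]; exact hs.of_norm) (x : AddCircle L)
  rw [hcoef] at this
  simpa only [hexp, smul_eq_mul, hFx] using this

/-- Fourier inversion for the derivatives up to order `m` of a `C^m` spline. -/
theorem IsSpline.hasSum_deriv {m K : ℕ} {o h : ℝ} (hh : 0 < h) (hK : 0 < K)
    {P : ℤ → Polynomial ℂ} (hP : IsSpline m K h P) (b : ℝ) {a : ℕ} (ha : a ≤ m) (x : ℝ) :
    HasSum (fun n => waveExp (K * h) n ^ a * coefOne b (K * h) (piecewisePoly o h P) n *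
      Complex.exp (waveExp (K * h) n * x))
      (piecewisePoly o h (fun j => Polynomial.derivative^[a] (P j)) x) := by
  have hL : (0 : ℝ) < K * h := by positivity
  simp_rw [← hP.coefOne_iterate_derivative hh hK b _ ha]
  refine hasSum_coefOne hL (continuous_piecewisePoly hh fun j => hP.matching j a ha)
    (periodic_piecewisePoly hh fun j => by rw [hP.periodic]) b ?_ x
  simp_rw [hP.coefOne_iterate_derivative hh hK b _ ha]
  exact hP.summable_coefOne hh hK b ha

/-- The conjugate of the Fourier coefficients of a spline, times `κ^(2m+2)`, is a combination of
the symbols of the evaluations at the nodes of the derivatives up to order `m`. -/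
theorem IsSpline.exists_conj_coefOne {m K : ℕ} {o h : ℝ} (hh : 0 < h) (hK : 0 < K)
    {P : ℤ → Polynomial ℂ} (hP : IsSpline m K h P) (b : ℝ) :
    ∃ w : Fin K → Fin (m + 1) → ℂ, ∀ n : ℤ,
      ((2 * Real.pi * n / (K * h) : ℝ) : ℂ) ^ (2 * m + 2) *
        (starRingEnd ℂ) (coefOne b (K * h) (piecewisePoly o h P) n) =
      ∑ j, ∑ a, w j a * (waveExp (K * h) n ^ (a : ℕ) *
        Complex.exp (waveExp (K * h) n * ((o + (j : ℕ) * h : ℝ) : ℂ))) := by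
  have hL : (0 : ℝ) < K * h := by positivity
  set jump : Fin K → Fin (m + 1) → ℂ := fun j a =>
    (Polynomial.derivative^[2 * m + 1 - a] (P (j : ℕ))).eval 0 -
      (Polynomial.derivative^[2 * m + 1 - a] (P ((j : ℕ) - 1))).eval (h : ℂ) with hjump
  refine ⟨fun j a => (-1) ^ (m + 1) * ((K * h : ℝ) : ℂ)⁻¹ * (-1) ^ (a : ℕ) *
    (starRingEnd ℂ) (jump j a), fun n => ?_⟩
  have hconj : (starRingEnd ℂ) (waveExp (K * h) n) = -waveExp (K * h) n := by
    rw [waveExp, map_mul, Complex.conj_I, Complex.conj_ofReal, neg_mul]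
  have h1 : waveExp (K * h) n ^ (2 * m + 2) *
      cellSum o h K P (waveExp (K * h) n) =
      ∑ j : Fin K, ∑ a : Fin (m + 1), waveExp (K * h) n ^ (a : ℕ) *
        (Complex.exp (-(waveExp (K * h) n * ((o + (j : ℕ) * h : ℝ) : ℂ))) * jump j a) := by
    rw [hP.pow_mul_cellSum_top (by exact_mod_cast exp_waveExp_mul_period hL.ne' n),
      Finset.sum_range, Finset.sum_comm]
    refine Finset.sum_congr rfl fun a _ => ?_
    rw [jumpSum, Finset.sum_range, Finset.mul_sum]
  have h2 : ((2 * Real.pi * n / (K * h) : ℝ) : ℂ) ^ (2 * m + 2) =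
      (-1) ^ (m + 1) * waveExp (K * h) n ^ (2 * m + 2) := by
    rw [waveExp, mul_pow, show 2 * m + 2 = 2 * (m + 1) by ring, pow_mul Complex.I, Complex.I_sq,
      ← mul_assoc, ← mul_pow]
    norm_num
  have h3 := congrArg (starRingEnd ℂ) h1
  rw [map_mul, map_pow, hconj, Even.neg_pow ⟨m + 1, by ring⟩] at h3
  rw [hP.coefOne_eq hh hK, map_mul, h2, map_inv₀, Complex.conj_ofReal]
  calc _ = (-1) ^ (m + 1) * ((K * h : ℝ) : ℂ)⁻¹ * (waveExp (K * h) n ^ (2 * m + 2) *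
        (starRingEnd ℂ) (cellSum o h K P (waveExp (K * h) n))) := by ring
    _ = _ := by
      rw [h3, map_sum, Finset.mul_sum]
      refine Finset.sum_congr rfl fun j _ => ?_
      rw [map_sum, Finset.mul_sum]
      refine Finset.sum_congr rfl fun a _ => ?_
      rw [map_mul, map_pow, hconj, map_mul, ← Complex.exp_conj, map_neg, map_mul, hconj,
        Complex.conj_ofReal, neg_pow, neg_mul, neg_neg]
      ring

/-! ### Splines near the midpoint of a cell -/

/-- `sin(τx)/x` is half the Fourier transform of the indicator function of `[-τ, τ]`. -/
theorem sincDeriv_zero_eq_integral {τ : ℝ} (x : ℝ) :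
    (sincDeriv 0 τ (x ^ 2) : ℂ) =
      1 / 2 * ∫ y in (-τ)..τ, Complex.exp (Complex.I * x * y) := by
  rcases eq_or_ne x 0 with rfl | hx
  · rw [zero_pow two_ne_zero, sincDeriv_zero_right, sincCoeff]
    simp
    ring
  · have hx' : (x : ℂ) ≠ 0 := by exact_mod_cast hx
    have h1 := congrArg (fun r : ℝ => (r : ℂ)) (mul_sincDeriv_zero τ x)
    simp only [Complex.ofReal_mul, Complex.ofReal_sin] at h1
    rw [integral_exp_mul_complex (mul_ne_zero Complex.I_ne_zero hx')]
    have h2 : (sincDeriv 0 τ (x ^ 2) : ℂ) = Complex.sin (τ * x) / x := by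
      rw [← h1]; field_simp
    have hI := Complex.I_sq
    rw [h2, Complex.sin]
    have e1 : Complex.I * x * τ = τ * x * Complex.I := by ring
    have e2 : Complex.I * x * ((-τ : ℝ) : ℂ) = -(τ * x) * Complex.I := by push_cast; ring
    rw [e1, e2]
    field_simp
    rw [hI]
    ring

theorem sum_range_two_mul {M : Type*} [AddCommMonoid M] (B : ℕ) (f : ℕ → M) :
    ∑ i ∈ Finset.range (2 * B), f i = ∑ b ∈ Finset.range B, (f (2 * b) + f (2 * b + 1)) := by
  induction B with
  | zero => simp
  | succ B ih =>
    rw [show 2 * (B + 1) = 2 * B + 1 + 1 by ring, Finset.sum_range_succ, Finset.sum_range_succ,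
      Finset.sum_range_succ, ih, add_assoc]

/-- The average of a polynomial over `[-τ, τ]`, up to the factor `τ`, is the Taylor sum of
`sin(τ|∂|)/|∂|`. -/
theorem integral_eval_symm {Q : Polynomial ℂ} {B : ℕ} (hQ : Q.natDegree < 2 * B) (τ : ℝ) :
    1 / 2 * ∫ x in (-τ)..τ, Q.eval (x : ℂ) = ∑ b ∈ Finset.range B, (sincCoeff b τ : ℂ) *
      ((-1) ^ b * (Polynomial.derivative^[2 * b] Q).eval 0 / b.factorial) := by
  simp_rw [Polynomial.eval_eq_sum_range' hQ]
  rw [intervalIntegral.integral_finsetSum fun i _ =>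
    Continuous.intervalIntegrable (by fun_prop) _ _, Finset.mul_sum, sum_range_two_mul]
  refine Finset.sum_congr rfl fun b _ => ?_
  have hint : ∀ n : ℕ, ∫ x in (-τ)..τ, Q.coeff n * (x : ℂ) ^ n =
      Q.coeff n * (((τ ^ (n + 1) - (-τ) ^ (n + 1)) / (n + 1) : ℝ) : ℂ) := by
    intro n
    rw [intervalIntegral.integral_const_mul, ← integral_pow, ← intervalIntegral.integral_ofReal]
    simp
  rw [hint, hint, Odd.neg_pow ⟨b, rfl⟩, Even.neg_pow ⟨b + 1, by ring⟩, sub_self]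
  have h1 : (Polynomial.derivative^[2 * b] Q).eval 0 =
      ((2 * b).factorial : ℂ) * Q.coeff (2 * b) := by
    rw [← Polynomial.coeff_zero_eq_eval_zero, Polynomial.coeff_iterate_derivative, zero_add,
      Nat.descFactorial_self, nsmul_eq_mul]
  rw [h1, sincCoeff, Nat.factorial_succ]
  have h2 : ((2 * b).factorial : ℂ) ≠ 0 := by exact_mod_cast (Nat.factorial_pos _).ne'
  have h3 : (b.factorial : ℂ) ≠ 0 := by exact_mod_cast (Nat.factorial_pos _).ne'
  have h4 : (2 * b + 1 : ℂ) ≠ 0 := by exact_mod_cast (Nat.succ_ne_zero (2 * b))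
  have h5 : ((-1 : ℂ) ^ b) * (-1) ^ b = 1 := by rw [← mul_pow]; norm_num
  push_cast
  field_simp
  linear_combination (-(2 * τ ^ (2 * b + 1) * Q.coeff (2 * b)) : ℂ) * h5

/-- If a Fourier series converges absolutely to a polynomial on `[-T, T]`, the operators
`sin(τ|∂|)/|∂|`, `0 ≤ τ ≤ T`, can be computed at `0` from that polynomial: they are averages over
`[-τ, τ]`. -/
theorem isLocalTaylor_of_hasSum {L T : ℝ} {c : ℤ → ℂ} (hc : Summable fun k => ‖c k‖)
    {Q : Polynomial ℂ} {B : ℕ} (hQ : Q.natDegree < 2 * B)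
    (h : ∀ x ∈ Set.Icc (-T) T,
      HasSum (fun k => c k * Complex.exp (waveExp L k * x)) (Q.eval (x : ℂ))) :
    IsLocalTaylor (fun k => 2 * Real.pi * k / L) c
      (fun b => (-1) ^ b * (Polynomial.derivative^[2 * b] Q).eval 0) B T where
  exists_bound := by
    refine ⟨fun k => ‖c k‖ * T, hc.mul_right T, fun k τ hτ => ?_⟩
    rw [norm_mul, Complex.norm_real]
    exact mul_le_mul_of_nonneg_left
      ((abs_sincDeriv_le (sq_nonneg _) hτ.1 0).trans (by simpa using hτ.2)) (norm_nonneg _)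
  hasSum_zero := by
    intro τ hτ
    have h1 := hasSum_intervalIntegral_of_bound (a := -τ) (b := τ)
      (F := fun (k : ℤ) (x : ℝ) => c k * Complex.exp (waveExp L k * x))
      (U := fun k => ‖c k‖) (by linarith [hτ.1]) (fun k => by fun_prop)
      (fun k x _ => by rw [norm_mul, norm_exp_waveExp, mul_one]) hc
      (fun x hx => h x ⟨by linarith [hx.1, hτ.2], hx.2.trans hτ.2⟩)
    rw [← integral_eval_symm hQ τ]
    refine (h1.mul_left (1 / 2)).congr_fun fun k => ?_
    rw [sincDeriv_zero_eq_integral, intervalIntegral.integral_const_mul, waveExp]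
    ring

/-- The same for the derivative of the Fourier series, whose terms need not be summable: since
`k · sin(τk)/k = sin(τk)`, the propagator restores absolute convergence. -/
theorem isLocalTaylor_deriv_of_hasSum {L T : ℝ} {c : ℤ → ℂ} (hc : Summable fun k => ‖c k‖)
    {Q : Polynomial ℂ} {B : ℕ} (hQ : Q.natDegree < 2 * B)
    (h : ∀ x ∈ Set.Icc (-T) T,
      HasSum (fun k => c k * Complex.exp (waveExp L k * x)) (Q.eval (x : ℂ))) :
    IsLocalTaylor (fun k => 2 * Real.pi * k / L) (fun k => waveExp L k * c k)
      (fun b => (-1) ^ b * (Polynomial.derivative^[2 * b] (Polynomial.derivative Q)).eval 0)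
      B T := by
  have key : ∀ (k : ℤ) (τ : ℝ), waveExp L k * c k *
      (sincDeriv 0 τ ((2 * Real.pi * k / L) ^ 2) : ℂ) =
      c k * (Complex.I * (Real.sin (τ * (2 * Real.pi * k / L)) : ℂ)) := by
    intro k τ
    rw [← mul_sincDeriv_zero, waveExp]
    push_cast
    ring
  constructor
  · refine ⟨fun k => ‖c k‖, hc, fun k τ hτ => ?_⟩
    rw [key, norm_mul, norm_mul, Complex.norm_I, one_mul, Complex.norm_real]
    exact mul_le_of_le_one_right (norm_nonneg _) (Real.abs_sin_le_one _)
  · intro τ hτ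
    have hQ' : (Polynomial.derivative Q).natDegree < 2 * B :=
      (Polynomial.natDegree_derivative_le Q).trans_lt (by omega)
    rw [← integral_eval_symm hQ' τ]
    have hint : ∫ x in (-τ)..τ, (Polynomial.derivative Q).eval (x : ℂ) =
        Q.eval (τ : ℂ) - Q.eval ((-τ : ℝ) : ℂ) :=
      intervalIntegral.integral_eq_sub_of_hasDerivAt (f := fun x : ℝ => Q.eval (x : ℂ))
        (fun x _ => (Q.hasDerivAt (x : ℂ)).comp_ofReal)
        (((Polynomial.derivative Q).continuous.comp
          Complex.continuous_ofReal).intervalIntegrable _ _)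
    rw [hint]
    have h1 := h τ ⟨by linarith [hτ.1, hτ.2], hτ.2⟩
    have h2 := h (-τ) ⟨by linarith [hτ.1, hτ.2], by linarith [hτ.1, hτ.2]⟩
    refine ((h1.sub h2).mul_left (1 / 2)).congr_fun fun k => ?_
    have e1 : waveExp L k * (τ : ℂ) = (τ * (2 * Real.pi * k / L) : ℂ) * Complex.I := by
      rw [waveExp]; push_cast; ring
    have e2 : waveExp L k * ((-τ : ℝ) : ℂ) = -(τ * (2 * Real.pi * k / L) : ℂ) * Complex.I := by
      rw [waveExp]; push_cast; ring
    rw [key, Complex.ofReal_sin, Complex.sin, e1, e2]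
    push_cast
    linear_combination (1 / 2 * c k * (Complex.exp (-(τ * (2 * Real.pi * k / L)) * Complex.I) -
      Complex.exp ((τ * (2 * Real.pi * k / L)) * Complex.I))) * Complex.I_sq

/-- The polynomial `P` re-centred at the midpoint `h / 2` of its cell. -/
def recentre (h : ℝ) (P : Polynomial ℂ) : Polynomial ℂ :=
  P.comp (Polynomial.X + Polynomial.C ((h / 2 : ℝ) : ℂ))

theorem eval_iterate_derivative_recentre (h : ℝ) (P : Polynomial ℂ) (n : ℕ) :
    (Polynomial.derivative^[n] (recentre h P)).eval 0 =
      (Polynomial.derivative^[n] P).eval ((h / 2 : ℝ) : ℂ) := by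
  have hd : ∀ P : Polynomial ℂ,
      Polynomial.derivative (recentre h P) = recentre h (Polynomial.derivative P) := fun P => by
    simp [recentre, Polynomial.derivative_comp]
  induction n generalizing P with
  | zero => simp [recentre]
  | succ n ih => rw [Function.iterate_succ_apply, hd, ih, Function.iterate_succ_apply]

theorem IsSpline.hasSum_recentre {m K : ℕ} {o h : ℝ} (hh : 0 < h) (hK : 0 < K)
    {P : ℤ → Polynomial ℂ} (hP : IsSpline m K h P) (b : ℝ) {a : ℕ} (ha : a ≤ m) (l : ℤ) {x : ℝ}
    (hx : x ∈ Set.Icc (-(h / 2)) (h / 2)) :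
    HasSum (fun k => waveExp (K * h) k ^ a * coefOne b (K * h) (piecewisePoly o h P) k *
      Complex.exp (waveExp (K * h) k * ((o + l * h + h / 2 : ℝ) : ℂ)) *
      Complex.exp (waveExp (K * h) k * x))
      ((recentre h (Polynomial.derivative^[a] (P l))).eval (x : ℂ)) := by
  have h1 := hP.hasSum_deriv (o := o) hh hK b ha (o + l * h + h / 2 + x)
  rw [piecewisePoly_of_mem_Icc hh (fun j => hP.matching j a ha) (j := l)
    ⟨by linarith [hx.1], by linarith [hx.2]⟩] at h1
  have e : (recentre h (Polynomial.derivative^[a] (P l))).eval (x : ℂ) =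
      (Polynomial.derivative^[a] (P l)).eval ((o + l * h + h / 2 + x - (o + l * h) : ℝ) : ℂ) := by
    rw [recentre, Polynomial.eval_comp]
    congr 1
    simp
    ring
  rw [e]
  refine h1.congr_fun fun k => ?_
  rw [mul_assoc, ← Complex.exp_add]
  congr 2
  push_cast
  ring

theorem IsSpline.summable_coefOne_mul_exp {m K : ℕ} {o h : ℝ} (hh : 0 < h) (hK : 0 < K)
    {P : ℤ → Polynomial ℂ} (hP : IsSpline m K h P) (b : ℝ) {a : ℕ} (ha : a ≤ m) (y : ℝ) :
    Summable fun k => ‖waveExp (K * h) k ^ a * coefOne b (K * h) (piecewisePoly o h P) k *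
      Complex.exp (waveExp (K * h) k * y)‖ := by
  simp_rw [norm_mul _ (Complex.exp _), norm_exp_waveExp, mul_one]
  exact hP.summable_coefOne hh hK b ha

theorem natDegree_recentre_iterate_lt {m : ℕ} {P : Polynomial ℂ} (hP : P.natDegree ≤ 2 * m + 1)
    (h : ℝ) (a : ℕ) : (recentre h (Polynomial.derivative^[a] P)).natDegree < 2 * (m + 1) := by
  rw [recentre, ← Polynomial.taylor_apply, Polynomial.natDegree_taylor]
  have := Polynomial.natDegree_iterate_derivative P a
  omega

/-- Near the midpoint of a cell a spline is a polynomial. -/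
theorem IsSpline.isLocalTaylor {m K : ℕ} {o h : ℝ} (hh : 0 < h) (hK : 0 < K)
    {P : ℤ → Polynomial ℂ} (hP : IsSpline m K h P) (b : ℝ) {a : ℕ} (ha : a ≤ m) (l : ℤ) :
    IsLocalTaylor (fun k => 2 * Real.pi * k / (K * h))
      (fun k => waveExp (K * h) k ^ a * coefOne b (K * h) (piecewisePoly o h P) k *
        Complex.exp (waveExp (K * h) k * ((o + l * h + h / 2 : ℝ) : ℂ)))
      (fun n => (-1) ^ n * (Polynomial.derivative^[a + 2 * n] (P l)).eval ((h / 2 : ℝ) : ℂ))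
      (m + 1) (h / 2) := by
  have := isLocalTaylor_of_hasSum (hP.summable_coefOne_mul_exp (o := o) hh hK b ha _)
    (natDegree_recentre_iterate_lt (hP.natDegree_le l) h a)
    fun x hx => hP.hasSum_recentre hh hK b ha l hx
  simp_rw [eval_iterate_derivative_recentre, ← Function.iterate_add_apply, add_comm _ a] at this
  exact this

theorem IsSpline.isLocalTaylor_deriv {m K : ℕ} {o h : ℝ} (hh : 0 < h) (hK : 0 < K)
    {P : ℤ → Polynomial ℂ} (hP : IsSpline m K h P) (b : ℝ) {a : ℕ} (ha : a ≤ m) (l : ℤ) :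
    IsLocalTaylor (fun k => 2 * Real.pi * k / (K * h))
      (fun k => waveExp (K * h) k *
        (waveExp (K * h) k ^ a * coefOne b (K * h) (piecewisePoly o h P) k *
        Complex.exp (waveExp (K * h) k * ((o + l * h + h / 2 : ℝ) : ℂ))))
      (fun n => (-1) ^ n * (Polynomial.derivative^[a + 1 + 2 * n] (P l)).eval ((h / 2 : ℝ) : ℂ))
      (m + 1) (h / 2) := by
  have := isLocalTaylor_deriv_of_hasSum (hP.summable_coefOne_mul_exp (o := o) hh hK b ha _)
    (natDegree_recentre_iterate_lt (hP.natDegree_le l) h a)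
    fun x hx => hP.hasSum_recentre hh hK b ha l hx
  simp_rw [← Function.iterate_succ_apply (f := (Polynomial.derivative (R := ℂ))),
    eval_iterate_derivative_recentre, ← Function.iterate_add_apply] at this
  have e : ∀ n, a + 1 + 2 * n = 2 * n + 1 + a := fun n => by omega
  simp_rw [e]
  exact this

/-! ### Uniqueness of Hermite interpolation -/

theorem eq_zero_of_hermite_data_eq_zero {m : ℕ} {h : ℝ} (hh : 0 < h) {R : Polynomial ℂ}
    (hdeg : R.natDegree ≤ 2 * m + 1)
    (hR : ∀ (e : Fin 2) (a : Fin (m + 1)),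
      (Polynomial.derivative^[(a : ℕ)] R).eval ((((e : ℝ) * h : ℝ)) : ℂ) = 0) : R = 0 := by
  by_contra hne
  set z : Fin 2 → ℂ := fun e => (((e : ℝ) * h : ℝ) : ℂ) with hz
  have hz01 : z 0 ≠ z 1 := by
    simp only [hz]
    have h1 : (0 : ℂ) ≠ (h : ℂ) := by exact_mod_cast hh.ne
    simpa using h1
  have hdvd : ∀ e, (Polynomial.X - Polynomial.C (z e)) ^ (m + 1) ∣ R := fun e => by
    rw [← Polynomial.le_rootMultiplicity_iff hne]
    refine (Polynomial.lt_rootMultiplicity_iff_isRoot_iterate_derivative hne).2 fun a ha => ?_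
    exact hR e ⟨a, by omega⟩
  have hcop : IsCoprime ((Polynomial.X - Polynomial.C (z 0)) ^ (m + 1))
      ((Polynomial.X - Polynomial.C (z 1)) ^ (m + 1)) :=
    (Polynomial.isCoprime_X_sub_C_of_isUnit_sub (sub_ne_zero.2 hz01).isUnit).pow
  have h1 := Polynomial.natDegree_le_of_dvd (hcop.mul_dvd (hdvd 0) (hdvd 1)) hne
  rw [((Polynomial.monic_X_sub_C _).pow _).natDegree_mul ((Polynomial.monic_X_sub_C _).pow _)] at h1
  simp at h1
  omega

/-- The one-dimensional cardinal Hermite polynomials. -/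
def cardinal (m : ℕ) (h : ℝ) (hh : 0 < h) (e : Fin 2) (a : Fin (m + 1)) : Polynomial ℂ :=
  Classical.choose (exists_cardinal m h hh e a)

theorem natDegree_cardinal_le (m : ℕ) (h : ℝ) (hh : 0 < h) (e : Fin 2) (a : Fin (m + 1)) :
    (cardinal m h hh e a).natDegree ≤ 2 * m + 1 :=
  (Classical.choose_spec (exists_cardinal m h hh e a)).1

theorem eval_cardinal (m : ℕ) (h : ℝ) (hh : 0 < h) (e : Fin 2) (a : Fin (m + 1)) (e' : Fin 2)
    (a' : Fin (m + 1)) : (Polynomial.derivative^[(a' : ℕ)] (cardinal m h hh e a)).eval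
      ((((e' : ℝ) * h : ℝ)) : ℂ) = if e' = e ∧ a' = a then 1 else 0 :=
  (Classical.choose_spec (exists_cardinal m h hh e a)).2 e' a'

/-- A polynomial of degree at most `2m+1` is recovered from its Hermite data. -/
theorem eq_sum_cardinal {m : ℕ} {h : ℝ} (hh : 0 < h) {P : Polynomial ℂ}
    (hdeg : P.natDegree ≤ 2 * m + 1) :
    P = ∑ e : Fin 2, ∑ a : Fin (m + 1), Polynomial.C
      ((Polynomial.derivative^[(a : ℕ)] P).eval ((((e : ℝ) * h : ℝ)) : ℂ)) *
        cardinal m h hh e a := by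
  rw [← sub_eq_zero]
  refine eq_zero_of_hermite_data_eq_zero hh (m := m) ?_ fun e a => ?_
  · refine (Polynomial.natDegree_sub_le _ _).trans (max_le hdeg ?_)
    refine Polynomial.natDegree_sum_le_of_forall_le _ _ fun e _ =>
      Polynomial.natDegree_sum_le_of_forall_le _ _ fun a _ => ?_
    exact (Polynomial.natDegree_C_mul_le _ _).trans (natDegree_cardinal_le m h hh e a)
  · simp_rw [Polynomial.iterate_derivative_sub, Polynomial.iterate_derivative_sum,
      Polynomial.iterate_derivative_C_mul, Polynomial.eval_sub, Polynomial.eval_finsetSum,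
      Polynomial.eval_mul, Polynomial.eval_C, eval_cardinal, ite_and]
    simp

theorem evalAt_tensorPoly {d : ℕ} (x : Fin d → ℝ) (P : Fin d → Polynomial ℂ) :
    evalAt x (tensorPoly P) = ∏ i, (P i).eval (x i : ℂ) := by
  rw [evalAt, tensorPoly, map_prod]
  refine Finset.prod_congr rfl fun i _ => ?_
  rw [← MvPolynomial.coe_aeval_eq_eval, RingHom.coe_coe, ← Polynomial.aeval_algHom_apply,
    MvPolynomial.aeval_X, Polynomial.coe_aeval_eq_eval]

theorem tensorPoly_sum {d : ℕ} {ι : Type*} [Fintype ι] (c : Fin d → ι → ℂ)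
    (P : Fin d → ι → Polynomial ℂ) :
    tensorPoly (fun i => ∑ e, Polynomial.C (c i e) * P i e) =
      ∑ ε : Fin d → ι, (∏ i, c i (ε i)) • tensorPoly (fun i => P i (ε i)) := by
  classical
  unfold tensorPoly
  simp_rw [map_sum]
  rw [Finset.prod_univ_sum, Fintype.piFinset_univ]
  refine Finset.sum_congr rfl fun ε _ => ?_
  simp_rw [map_mul, Polynomial.aeval_C]
  rw [Finset.prod_mul_distrib, Algebra.smul_def, map_prod]

theorem monomial_eq_tensorPoly {d : ℕ} (s : Fin d →₀ ℕ) (b : ℂ) :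
    MvPolynomial.monomial s b = b • tensorPoly (fun i => (Polynomial.X : Polynomial ℂ) ^ s i) := by
  unfold tensorPoly
  simp_rw [map_pow, Polynomial.aeval_X]
  rw [MvPolynomial.monomial_eq, MvPolynomial.smul_eq_C_mul, Finsupp.prod_fintype]
  simp

/-- A polynomial of degree at most `2m+1` in each variable is recovered from its Hermite data.
Both sides are linear, so that it suffices to treat monomials, which are products of polynomials in
one variable. -/
theorem eq_sum_tensor_cardinal {d m : ℕ} {h : Fin d → ℝ} (hh : ∀ i, 0 < h i)
    {q : MvPolynomial (Fin d) ℂ} (hq : ∀ i, q.degreeOf i ≤ 2 * m + 1) :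
    q = ∑ ε : Fin d → Fin 2 × Fin (m + 1),
      evalAt (corner h fun i => (ε i).1) (polyDeriv (fun i => ((ε i).2 : ℕ)) q) •
        tensorPoly (fun i => cardinal m (h i) (hh i) (ε i).1 (ε i).2) := by
  have hmono : ∀ s ∈ q.support, MvPolynomial.monomial s (q.coeff s) =
      ∑ ε : Fin d → Fin 2 × Fin (m + 1),
      evalAt (corner h fun i => (ε i).1) (polyDeriv (fun i => ((ε i).2 : ℕ))
        (MvPolynomial.monomial s (q.coeff s))) •
        tensorPoly (fun i => cardinal m (h i) (hh i) (ε i).1 (ε i).2) := by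
    intro s hs
    have hdeg : ∀ i, ((Polynomial.X : Polynomial ℂ) ^ s i).natDegree ≤ 2 * m + 1 := fun i => by
      rw [Polynomial.natDegree_X_pow]
      exact (MvPolynomial.monomial_le_degreeOf i hs).trans (hq i)
    have h1 : tensorPoly (fun i => (Polynomial.X : Polynomial ℂ) ^ s i) =
        ∑ ε : Fin d → Fin 2 × Fin (m + 1), (∏ i, (Polynomial.derivative^[((ε i).2 : ℕ)]
          ((Polynomial.X : Polynomial ℂ) ^ s i)).eval (((((ε i).1 : ℝ) * h i : ℝ)) : ℂ)) •
        tensorPoly (fun i => cardinal m (h i) (hh i) (ε i).1 (ε i).2) := by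
      rw [← tensorPoly_sum (fun i (p : Fin 2 × Fin (m + 1)) =>
        (Polynomial.derivative^[(p.2 : ℕ)] ((Polynomial.X : Polynomial ℂ) ^ s i)).eval
          ((((p.1 : ℝ) * h i : ℝ)) : ℂ)) (fun i p => cardinal m (h i) (hh i) p.1 p.2)]
      congr 1
      funext i
      rw [Fintype.sum_prod_type]
      exact eq_sum_cardinal (hh i) (hdeg i)
    rw [monomial_eq_tensorPoly]
    conv_lhs => rw [h1]
    rw [Finset.smul_sum]
    refine Finset.sum_congr rfl fun ε _ => ?_
    rw [polyDeriv_smul, polyDeriv_tensorPoly, smul_smul]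
    congr 1
    rw [evalAt, MvPolynomial.smul_eval]
    congr 1
    exact (evalAt_tensorPoly _ _).symm
  conv_lhs => rw [q.as_sum, Finset.sum_congr rfl hmono]
  rw [Finset.sum_comm]
  refine Finset.sum_congr rfl fun ε _ => ?_
  rw [← Finset.sum_smul]
  congr 1
  conv_rhs => rw [q.as_sum]
  rw [polyDeriv_sum, evalAt, map_sum]
  rfl

theorem IsHermite.unique {d m : ℕ} {h : Fin d → ℝ} (hh : ∀ i, 0 < h i)
    {B : (Fin d → Fin 2) → (Fin d → Fin (m + 1)) → ℂ} {q r : MvPolynomial (Fin d) ℂ}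
    (hq : IsHermite m h B q) (hr : IsHermite m h B r) : q = r := by
  rw [eq_sum_tensor_cardinal hh hq.1, eq_sum_tensor_cardinal hh hr.1]
  refine Finset.sum_congr rfl fun ε _ => ?_
  rw [hq.2 (fun i => (ε i).1) fun i => (ε i).2, hr.2 (fun i => (ε i).1) fun i => (ε i).2]

/-! ### The interpolant as a sum of products of splines -/

/-- The cardinal spline of the node with index `j` modulo `K` and the derivative of order `a`, on
the cell with index `l`. The contributions of the two ends of the cell are added, since for `K = 1` both
ends are the same node. -/
def cardinalSpline (m : ℕ) (h : ℝ) (hh : 0 < h) (K : ℕ) (j : Fin K) (a : Fin (m + 1)) (l : ℤ) :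
    Polynomial ℂ :=
  (if (K : ℤ) ∣ l - (j : ℕ) then cardinal m h hh 0 a else 0) +
    if (K : ℤ) ∣ l + 1 - (j : ℕ) then cardinal m h hh 1 a else 0

theorem eval_cardinalSpline (m : ℕ) (h : ℝ) (hh : 0 < h) (K : ℕ) (j : Fin K) (a : Fin (m + 1))
    (l : ℤ) (e : Fin 2) (a' : Fin (m + 1)) :
    (Polynomial.derivative^[(a' : ℕ)] (cardinalSpline m h hh K j a l)).eval
      ((((e : ℝ) * h : ℝ)) : ℂ) =
      if (K : ℤ) ∣ l + (e : ℕ) - (j : ℕ) ∧ a' = a then 1 else 0 := by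
  have h1 : ∀ (p : Prop) [Decidable p] (e' : Fin 2), (Polynomial.derivative^[(a' : ℕ)]
      (if p then cardinal m h hh e' a else 0)).eval ((((e : ℝ) * h : ℝ)) : ℂ) =
      if p ∧ e = e' ∧ a' = a then 1 else 0 := by
    intro p _ e'
    by_cases hp : p
    · simp only [hp, if_true, true_and, eval_cardinal]
    · simp [hp]
  rw [cardinalSpline, iterate_map_add, Polynomial.eval_add, h1, h1]
  fin_cases e <;> simp

theorem natDegree_cardinalSpline_le (m : ℕ) (h : ℝ) (hh : 0 < h) (K : ℕ) (j : Fin K)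
    (a : Fin (m + 1)) (l : ℤ) : (cardinalSpline m h hh K j a l).natDegree ≤ 2 * m + 1 := by
  refine (Polynomial.natDegree_add_le _ _).trans (max_le ?_ ?_) <;> split_ifs <;>
    simp [natDegree_cardinal_le]

theorem isSpline_cardinalSpline (m : ℕ) (h : ℝ) (hh : 0 < h) (K : ℕ) (j : Fin K)
    (a : Fin (m + 1)) : IsSpline m K h (cardinalSpline m h hh K j a) where
  natDegree_le := natDegree_cardinalSpline_le m h hh K j a
  matching := by
    intro l a' ha'
    have h0 := eval_cardinalSpline m h hh K j a (l + 1) 0 ⟨a', by omega⟩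
    have h1 := eval_cardinalSpline m h hh K j a l 1 ⟨a', by omega⟩
    simp only [Fin.val_zero, Fin.val_one, Nat.cast_zero, Nat.cast_one, zero_mul, one_mul, add_zero,
      Complex.ofReal_zero] at h0 h1
    rw [h0, h1]
  periodic := by
    intro l
    have e1 : l + K - (j : ℕ) = l - (j : ℕ) + K := by ring
    have e2 : l + K + 1 - (j : ℕ) = l + 1 - (j : ℕ) + K := by ring
    simp only [cardinalSpline, e1, e2, dvd_add_self_right]

theorem NodalData.IsPeriodic.eq_of_dvd {d m : ℕ} {g : Grid d} {D : NodalData d m}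
    (hD : D.IsPeriodic g) {j j' : Fin d → ℤ} (h : ∀ i, (g.K i : ℤ) ∣ j i - j' i) : D j = D j' := by
  let S : AddSubgroup (Fin d → ℤ) :=
    { carrier := {v | ∀ j, D (j + v) = D j}
      add_mem' := fun {a b} ha hb j => by rw [← add_assoc, hb, ha]
      zero_mem' := fun j => by rw [add_zero]
      neg_mem' := fun {a} ha j => by rw [← ha, neg_add_cancel_right] }
  have hS : j - j' ∈ S := by
    choose z hz using h
    have e : j - j' = ∑ i, z i • Pi.single i (g.K i : ℤ) := by
      funext i
      rw [Finset.sum_apply, Finset.sum_eq_single i]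
      · simp [hz, mul_comm]
      · intro k _ hk
        simp [Pi.single_eq_of_ne hk.symm]
      · simp
    rw [e]
    exact S.sum_mem fun i _ => S.zsmul_mem (fun k => hD k i) _
  have := hS j'
  rwa [add_sub_cancel] at this

/-- The residue of an integer modulo `K > 0`. -/
def residue (K : ℕ) (hK : 0 < K) (l : ℤ) : Fin K :=
  ⟨(l % K).toNat, by
    have h1 := Int.emod_nonneg l (b := K) (by omega)
    have h2 := Int.emod_lt_of_pos l (b := K) (by omega)
    omega⟩

theorem dvd_sub_iff_residue {K : ℕ} (hK : 0 < K) (l : ℤ) (j : Fin K) :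
    (K : ℤ) ∣ l - (j : ℕ) ↔ j = residue K hK l := by
  have h1 := Int.emod_nonneg l (b := K) (by omega)
  have h3 : ((j : ℕ) : ℤ) % K = (j : ℕ) := Int.emod_eq_of_lt (by omega) (by exact_mod_cast j.2)
  rw [← Int.modEq_iff_dvd, Int.ModEq, h3, Fin.ext_iff]
  change (j : ℕ) = l % K ↔ (j : ℕ) = (l % K).toNat
  omega

/-- The product cardinal spline of a node and a multi-index, on the cell with index `l`. -/
def tensorSpline {d : ℕ} (m : ℕ) (g : Grid d) (j : (i : Fin d) → Fin (g.K i))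
    (α : Fin d → Fin (m + 1)) (i : Fin d) : ℤ → Polynomial ℂ :=
  cardinalSpline m (g.h i) (g.h_pos i) (g.K i) (j i) (α i)

theorem isSpline_tensorSpline {d : ℕ} (m : ℕ) (g : Grid d) (j : (i : Fin d) → Fin (g.K i))
    (α : Fin d → Fin (m + 1)) (i : Fin d) :
    IsSpline m (g.K i) (g.h i) (tensorSpline m g j α i) :=
  isSpline_cardinalSpline _ _ _ _ _ _

/-- Only the product cardinal spline of the node `l + ε` and the multi-index `α'` has a nonzero
derivative of order `α'` at the corner `ε` of the cell `l`. -/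
theorem sum_mul_prod_eval_tensorSpline {d m : ℕ} (g : Grid d) {D : NodalData d m}
    (hD : D.IsPeriodic g) (l : Fin d → ℤ) (ε : Fin d → Fin 2) (α' : Fin d → Fin (m + 1)) :
    ∑ j : (i : Fin d) → Fin (g.K i), ∑ α : Fin d → Fin (m + 1), D (fun i => ((j i : ℕ) : ℤ)) α *
      ∏ i, (Polynomial.derivative^[(α' i : ℕ)] (tensorSpline m g j α i (l i))).eval
        ((((ε i : ℝ) * g.h i : ℝ)) : ℂ) = D (fun i => l i + ((ε i : ℕ) : ℤ)) α' := by
  classical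
  set j₀ : (i : Fin d) → Fin (g.K i) := fun i => residue (g.K i) (g.K_pos i) (l i + (ε i : ℕ))
    with hj₀
  have hprod : ∀ (j : (i : Fin d) → Fin (g.K i)) (α : Fin d → Fin (m + 1)),
      ∏ i, (Polynomial.derivative^[(α' i : ℕ)] (tensorSpline m g j α i (l i))).eval
        ((((ε i : ℝ) * g.h i : ℝ)) : ℂ) = if j = j₀ ∧ α' = α then 1 else 0 := by
    intro j α
    have : ∀ i, (Polynomial.derivative^[(α' i : ℕ)] (tensorSpline m g j α i (l i))).eval
        ((((ε i : ℝ) * g.h i : ℝ)) : ℂ) = if j i = j₀ i ∧ α' i = α i then 1 else 0 := fun i => by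
      rw [tensorSpline, eval_cardinalSpline]
      simp only [dvd_sub_iff_residue (g.K_pos i), hj₀]
    rw [Finset.prod_congr rfl fun i _ => this i, Finset.prod_ite_zero]
    simp [funext_iff, forall_and]
  simp_rw [hprod, ite_and]
  simp only [mul_ite, mul_one, mul_zero]
  rw [Finset.sum_eq_single j₀ (fun j _ hj => by simp [hj]) (by simp)]
  simp only [if_true, Finset.sum_ite_eq, Finset.mem_univ]
  rw [hD.eq_of_dvd fun i => ?_]
  rw [← neg_sub, dvd_neg]
  exact (dvd_sub_iff_residue (g.K_pos i) _ _).2 rfl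

theorem cellPoly_eq {d m : ℕ} (g : Grid d) {D : NodalData d m} (hD : D.IsPeriodic g)
    (l : Fin d → ℤ) : cellPoly g D l =
      ∑ j : (i : Fin d) → Fin (g.K i), ∑ α : Fin d → Fin (m + 1),
        D (fun i => ((j i : ℕ) : ℤ)) α • tensorPoly (fun i => tensorSpline m g j α i (l i)) := by
  refine (cellPoly_spec g D l).unique g.h_pos ⟨fun i => ?_, fun ε α' => ?_⟩
  · refine (MvPolynomial.degreeOf_sum_le i _ _).trans (Finset.sup_le fun j _ => ?_)
    refine (MvPolynomial.degreeOf_sum_le i _ _).trans (Finset.sup_le fun α _ => ?_)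
    rw [MvPolynomial.smul_eq_C_mul]
    exact (MvPolynomial.degreeOf_C_mul_le _ _ _).trans
      (degreeOf_tensorPoly_le _ _ (fun k => (isSpline_tensorSpline m g j α k).natDegree_le _) i)
  · have := sum_mul_prod_eval_tensorSpline g hD l ε α'
    simp_rw [polyDeriv_sum, evalAt, map_sum, polyDeriv_smul, MvPolynomial.smul_eval,
      polyDeriv_tensorPoly]
    rw [NodalData.corners, ← this]
    refine Finset.sum_congr rfl fun j _ => Finset.sum_congr rfl fun α _ => ?_
    congr 1
    exact evalAt_tensorPoly _ _

theorem interpolant_eq {d m : ℕ} (g : Grid d) (o : Fin d → ℝ) {D : NodalData d m}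
    (hD : D.IsPeriodic g) (x : Fin d → ℝ) : interpolant g o D x =
      ∑ j : (i : Fin d) → Fin (g.K i), ∑ α : Fin d → Fin (m + 1),
        D (fun i => ((j i : ℕ) : ℤ)) α *
          ∏ i, piecewisePoly (o i) (g.h i) (tensorSpline m g j α i) (x i) := by
  rw [interpolant, cellPoly_eq g hD, evalAt, map_sum]
  simp_rw [map_sum, MvPolynomial.smul_eval]
  refine Finset.sum_congr rfl fun j _ => Finset.sum_congr rfl fun α _ => ?_
  congr 1
  exact evalAt_tensorPoly _ _

/-! ### Powers of the Laplacian on products -/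

theorem laplacian_tensorPoly {d : ℕ} (P : Fin d → Polynomial ℂ) :
    laplacian (tensorPoly P) =
      ∑ i, tensorPoly (Function.update P i (Polynomial.derivative^[2] (P i))) := by
  refine Finset.sum_congr rfl fun i _ => ?_
  rw [← iterate_pderiv_tensorPoly]
  rfl

theorem laplacian_add {d : ℕ} (p q : MvPolynomial (Fin d) ℂ) :
    laplacian (p + q) = laplacian p + laplacian q := by
  simp [laplacian, Finset.sum_add_distrib]

theorem laplacian_smul {d : ℕ} (b : ℂ) (p : MvPolynomial (Fin d) ℂ) :
    laplacian (b • p) = b • laplacian p := by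
  simp [laplacian, Finset.smul_sum]

/-- The linear map sending the monomial `X^b` to `∏ (∂_i²)^{b_i}` applied to `tensorPoly P`. It
turns multiplication by `∑ X_i` into the Laplacian, and so reduces powers of the Laplacian to the
multinomial theorem. -/
def symbolMap {d : ℕ} (P : Fin d → Polynomial ℂ) :
    MvPolynomial (Fin d) ℂ →ₗ[ℂ] MvPolynomial (Fin d) ℂ :=
  (MvPolynomial.basisMonomials (Fin d) ℂ).constr ℂ
    fun b => tensorPoly fun i => Polynomial.derivative^[2 * b i] (P i)

theorem symbolMap_monomial {d : ℕ} (P : Fin d → Polynomial ℂ) (b : Fin d →₀ ℕ) :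
    symbolMap P (MvPolynomial.monomial b 1) =
      tensorPoly fun i => Polynomial.derivative^[2 * b i] (P i) := by
  have h : (MvPolynomial.basisMonomials (Fin d) ℂ) b = MvPolynomial.monomial b 1 := by
    rw [MvPolynomial.coe_basisMonomials]
  rw [← h, symbolMap, Module.Basis.constr_basis]

theorem laplacian_symbolMap {d : ℕ} (P : Fin d → Polynomial ℂ) (f : MvPolynomial (Fin d) ℂ) :
    laplacian (symbolMap P f) = symbolMap P ((∑ i, MvPolynomial.X i) * f) := by
  induction f using MvPolynomial.induction_on' with
  | monomial u a =>
    have hu : MvPolynomial.monomial u a = a • MvPolynomial.monomial u (1 : ℂ) := by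
      rw [MvPolynomial.smul_monomial, smul_eq_mul, mul_one]
    rw [hu, map_smul, laplacian_smul, mul_smul_comm, map_smul, symbolMap_monomial,
      laplacian_tensorPoly, Finset.sum_mul, map_sum]
    congr 1
    refine Finset.sum_congr rfl fun i _ => ?_
    rw [MvPolynomial.X, MvPolynomial.monomial_mul, one_mul, symbolMap_monomial]
    congr 1
    funext k
    rcases eq_or_ne k i with rfl | hk
    · rw [Function.update_self, ← Function.iterate_add_apply]
      congr 2
      simp
      ring
    · rw [Function.update_of_ne hk]
      simp [Finsupp.single_eq_of_ne hk]
  | add p q hp hq => rw [map_add, laplacian_add, hp, hq, mul_add, map_add]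

theorem iterate_laplacian_tensorPoly {d : ℕ} (P : Fin d → Polynomial ℂ) (r : ℕ) :
    laplacian^[r] (tensorPoly P) = ∑ k ∈ Finset.piAntidiag Finset.univ r,
      (Nat.multinomial Finset.univ k : ℂ) •
        tensorPoly fun i => Polynomial.derivative^[2 * k i] (P i) := by
  have h : ∀ r, laplacian^[r] (tensorPoly P) = symbolMap P ((∑ i, MvPolynomial.X i) ^ r) := by
    intro r
    induction r with
    | zero =>
      have := symbolMap_monomial P 0
      simp only [Finsupp.coe_zero, Pi.zero_apply, mul_zero, Function.iterate_zero, id_eq] at this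
      simpa using this.symm
    | succ r ih => rw [Function.iterate_succ_apply', ih, laplacian_symbolMap, pow_succ']
  rw [h, Finset.sum_pow_eq_sum_piAntidiag, map_sum]
  refine Finset.sum_congr rfl fun k _ => ?_
  have e : ∏ i, (MvPolynomial.X i : MvPolynomial (Fin d) ℂ) ^ k i =
      MvPolynomial.monomial (Finsupp.equivFunOnFinite.symm k) 1 := by
    rw [MvPolynomial.monomial_eq, Finsupp.prod_fintype _ _ (by simp)]
    simp
  rw [e, ← nsmul_eq_mul, map_nsmul, symbolMap_monomial, Nat.cast_smul_eq_nsmul]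
  rfl

/-- The Taylor operator of the scheme on products of polynomials in one variable, in terms of the
Taylor coefficients of `sin(τ√u)/√u`. -/
theorem evalAt_oddTaylor_tensorPoly {d : ℕ} (hd : 0 < d) (m : ℕ) (c Δt : ℝ)
    {P : Fin d → Polynomial ℂ} (hP : ∀ i, (P i).natDegree ≤ 2 * m + 1) (α : Fin d → ℕ)
    (x : Fin d → ℝ) :
    evalAt x (polyDeriv α (oddTaylor m c Δt (tensorPoly P))) =
      2 * ∑ b : Fin d → Fin (m + 1), (sincCoeff (∑ i, (b i : ℕ)) (c * Δt / 2) : ℂ) *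
        ∏ i, ((-1) ^ (b i : ℕ) * (Polynomial.derivative^[α i + 2 * b i] (P i)).eval (x i : ℂ) /
          (b i : ℕ).factorial) := by
  set τ : ℝ := c * Δt / 2 with hτ
  set F : (Fin d → ℕ) → ℂ := fun k => 2 * ((sincCoeff (∑ i, k i) τ : ℂ) *
    ∏ i, ((-1) ^ (k i) * (Polynomial.derivative^[α i + 2 * k i] (P i)).eval (x i : ℂ) /
      (k i).factorial)) with hF
  have hval : ∀ k : Fin d → ℕ, evalAt x (polyDeriv α
      (tensorPoly fun i => Polynomial.derivative^[2 * k i] (P i))) =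
      ∏ i, (Polynomial.derivative^[α i + 2 * k i] (P i)).eval (x i : ℂ) := fun k => by
    rw [polyDeriv_tensorPoly, evalAt_tensorPoly]
    simp_rw [← Function.iterate_add_apply]
  have hterm : ∀ r, ∀ k ∈ Finset.piAntidiag Finset.univ r,
      (2 * (τ : ℂ) ^ (2 * r + 1) / ((2 * r + 1).factorial : ℂ)) *
        ((Nat.multinomial Finset.univ k : ℂ) *
          ∏ i, (Polynomial.derivative^[α i + 2 * k i] (P i)).eval (x i : ℂ)) = F k := by
    intro r k hk
    rw [Finset.mem_piAntidiag] at hk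
    have hsum : ∑ i, k i = r := hk.1
    have h1 := congrArg (fun n : ℕ => (n : ℂ)) (Nat.multinomial_spec Finset.univ k)
    simp only [Nat.cast_mul, Nat.cast_prod] at h1
    have h2 : (∏ i, ((k i).factorial : ℂ)) ≠ 0 :=
      Finset.prod_ne_zero_iff.2 fun i _ => by exact_mod_cast (Nat.factorial_pos _).ne'
    simp only [hF, sincCoeff]
    rw [Finset.prod_div_distrib, Finset.prod_mul_distrib, Finset.prod_pow_eq_pow_sum, hsum]
    rw [hsum] at h1
    have h3 : ((2 * r + 1).factorial : ℂ) ≠ 0 := by exact_mod_cast (Nat.factorial_pos _).ne'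
    have h5 : ((-1 : ℂ) ^ r) * (-1) ^ r = 1 := by rw [← mul_pow]; norm_num
    push_cast
    field_simp
    rw [← h1]
    linear_combination (-(τ : ℂ) ^ (2 * r + 1) *
      (∏ i, ((k i).factorial : ℂ)) * (Nat.multinomial Finset.univ k : ℂ) *
      ∏ i, (Polynomial.derivative^[α i + 2 * k i] (P i)).eval (x i : ℂ)) * h5
  -- Because of the degree bound only multi-indices with entries at most `m` contribute, and these
  -- have order at most `d m < d (m + 1)`.
  have hzero : ∀ k : Fin d → ℕ, (∃ i, m + 1 ≤ k i) → F k = 0 := by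
    rintro k ⟨i, hi⟩
    have : ∏ i, ((-1) ^ (k i) * (Polynomial.derivative^[α i + 2 * k i] (P i)).eval (x i : ℂ) /
      ((k i).factorial : ℂ)) = 0 := by
      refine Finset.prod_eq_zero (Finset.mem_univ i) ?_
      rw [Polynomial.iterate_derivative_eq_zero ((hP i).trans_lt (by omega))]
      simp
    simp only [hF, this, mul_zero]
  have hL : evalAt x (polyDeriv α (oddTaylor m c Δt (tensorPoly P))) =
      ∑ r ∈ Finset.range (d * (m + 1)), ∑ k ∈ Finset.piAntidiag Finset.univ r, F k := by
    rw [oddTaylor, polyDeriv_sum, evalAt, map_sum]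
    refine Finset.sum_congr rfl fun r _ => ?_
    rw [polyDeriv_smul, MvPolynomial.smul_eval, iterate_laplacian_tensorPoly, polyDeriv_sum,
      map_sum, Finset.mul_sum]
    refine Finset.sum_congr rfl fun k hk => ?_
    rw [polyDeriv_smul, MvPolynomial.smul_eval, ← hterm r k hk, ← hval]
    rfl
  have hR : 2 * ∑ b : Fin d → Fin (m + 1), (sincCoeff (∑ i, (b i : ℕ)) τ : ℂ) *
        ∏ i, ((-1) ^ (b i : ℕ) * (Polynomial.derivative^[α i + 2 * b i] (P i)).eval (x i : ℂ) /
          (b i : ℕ).factorial) =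
      ∑ k ∈ Fintype.piFinset fun _ : Fin d => Finset.range (m + 1), F k := by
    rw [Finset.mul_sum]
    refine Finset.sum_bij (fun b _ i => (b i : ℕ)) ?_ ?_ ?_ ?_
    · intro b _
      rw [Fintype.mem_piFinset]
      exact fun i => Finset.mem_range.2 (b i).2
    · intro b _ b' _ h
      funext i
      exact Fin.ext (congrFun h i)
    · intro k hk
      rw [Fintype.mem_piFinset] at hk
      exact ⟨fun i => ⟨k i, Finset.mem_range.1 (hk i)⟩, Finset.mem_univ _, rfl⟩
    · intro b _
      rfl
  rw [hL, hR, ← Finset.sum_fiberwise_of_maps_to (t := Finset.range (d * (m + 1)))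
    (g := fun k : Fin d → ℕ => ∑ i, k i)]
  · refine Finset.sum_congr rfl fun r _ => ?_
    symm
    refine Finset.sum_subset (fun k hk => ?_) fun k hk hk' => ?_
    · rw [Finset.mem_filter] at hk
      rw [Finset.mem_piAntidiag]
      exact ⟨hk.2, fun i _ => Finset.mem_univ i⟩
    · refine hzero k ?_
      rw [Finset.mem_piAntidiag] at hk
      by_contra hcon
      push Not at hcon
      refine hk' (Finset.mem_filter.2 ⟨?_, hk.1⟩)
      rw [Fintype.mem_piFinset]
      exact fun i => Finset.mem_range.2 (hcon i)
  · intro k hk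
    rw [Fintype.mem_piFinset] at hk
    rw [Finset.mem_range]
    calc ∑ i, k i ≤ ∑ _i : Fin d, m :=
          Finset.sum_le_sum fun i _ => Nat.lt_succ_iff.1 (Finset.mem_range.1 (hk i))
      _ = d * m := by simp
      _ < d * (m + 1) := by
          rw [mul_add, mul_one]
          omega

/-! ### Characters and Fourier series on the periodicity box -/

theorem Grid.period_pos {d : ℕ} (g : Grid d) (i : Fin d) : 0 < g.period i :=
  mul_pos (by exact_mod_cast g.K_pos i) (g.h_pos i)

/-- The volume of the periodicity box. -/
def Grid.vol {d : ℕ} (g : Grid d) : ℝ := ∏ i, g.period i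

theorem Grid.vol_pos {d : ℕ} (g : Grid d) : 0 < g.vol := Finset.prod_pos fun i _ => g.period_pos i

theorem Grid.measurableSet_box {d : ℕ} (g : Grid d) : MeasurableSet g.box :=
  MeasurableSet.univ_pi fun _ => measurableSet_Ioc

theorem Grid.restrict_box {d : ℕ} (g : Grid d) : volume.restrict g.box =
    Measure.pi fun i => volume.restrict (Set.Ioc (g.xmin i) (g.xmin i + g.period i)) := by
  rw [Grid.box, volume_pi, Measure.restrict_pi_pi]

theorem Grid.box_subset_Icc {d : ℕ} (g : Grid d) :
    g.box ⊆ Set.Icc g.xmin fun i => g.xmin i + g.period i := by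
  intro x hx
  rw [Grid.box, Set.mem_univ_pi] at hx
  exact ⟨fun i => (hx i).1.le, fun i => (hx i).2⟩

instance {d : ℕ} (g : Grid d) : IsFiniteMeasure (volume.restrict g.box) :=
  ⟨by
    rw [Measure.restrict_apply_univ]
    exact (measure_mono g.box_subset_Icc).trans_lt isCompact_Icc.measure_lt_top⟩

theorem Grid.integrableOn_box {d : ℕ} (g : Grid d) {f : (Fin d → ℝ) → ℂ} (hf : Continuous f) :
    IntegrableOn f g.box :=
  (hf.integrableOn_Icc).mono_set g.box_subset_Icc

theorem Grid.integral_box_prod {d : ℕ} (g : Grid d) (f : Fin d → ℝ → ℂ) :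
    ∫ x in g.box, ∏ i, f i (x i) =
      ∏ i, ∫ x in (g.xmin i)..(g.xmin i + g.period i), f i x := by
  rw [g.restrict_box, integral_fintype_prod_eq_prod]
  refine Finset.prod_congr rfl fun i _ => ?_
  rw [intervalIntegral.integral_of_le (by linarith [g.period_pos i])]

theorem character_eq_prod {d : ℕ} (g : Grid d) (n : Fin d → ℤ) (x : Fin d → ℝ) :
    character g n x = ∏ i, Complex.exp (waveExp (g.period i) (n i) * x i) := by
  rw [character, ← Complex.exp_sum]
  congr 1
  rw [Complex.ofReal_sum, Finset.mul_sum]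
  refine Finset.sum_congr rfl fun i _ => ?_
  rw [waveExp, waveVec]
  push_cast
  ring

theorem waveExp_add (L : ℝ) (n k : ℤ) : waveExp L (n + k) = waveExp L n + waveExp L k := by
  rw [waveExp, waveExp, waveExp]; push_cast; ring

theorem norm_character {d : ℕ} (g : Grid d) (n : Fin d → ℤ) (x : Fin d → ℝ) :
    ‖character g n x‖ = 1 := by
  rw [character_eq_prod, norm_prod]
  exact Finset.prod_eq_one fun i _ => norm_exp_waveExp _ _ _

theorem continuous_character {d : ℕ} (g : Grid d) (n : Fin d → ℤ) : Continuous (character g n) := by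
  unfold character; fun_prop

theorem contDiff_character {d : ℕ} (g : Grid d) (n : Fin d → ℤ) :
    ContDiff ℝ ∞ (character g n) := by
  unfold character
  have h0 : ContDiff ℝ ∞ fun x : Fin d → ℝ => ∑ i, waveVec g n i * x i :=
    ContDiff.sum fun i _ => contDiff_const.mul (contDiff_apply ℝ ℝ i)
  have h : ContDiff ℝ ∞ fun x : Fin d → ℝ => ((∑ i, waveVec g n i * x i : ℝ) : ℂ) :=
    Complex.ofRealCLM.contDiff.comp h0
  exact (contDiff_const.mul h).cexp

theorem character_add {d : ℕ} (g : Grid d) (n k : Fin d → ℤ) (x : Fin d → ℝ) :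
    character g (n + k) x = character g n x * character g k x := by
  simp_rw [character_eq_prod, ← Finset.prod_mul_distrib, ← Complex.exp_add, Pi.add_apply,
    waveExp_add, add_mul]

theorem conj_character {d : ℕ} (g : Grid d) (n : Fin d → ℤ) (x : Fin d → ℝ) :
    (starRingEnd ℂ) (character g n x) = character g (-n) x := by
  rw [character, character, ← Complex.exp_conj, map_mul, Complex.conj_I, Complex.conj_ofReal]
  congr 1
  have : waveVec g (-n) = -waveVec g n := by
    funext i; simp [waveVec]; ring
  simp [this]

theorem periodic_character {d : ℕ} (g : Grid d) (n : Fin d → ℤ) (i : Fin d) :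
    Function.Periodic (character g n) (Pi.single i (g.period i)) := by
  intro x
  rw [character_eq_prod, character_eq_prod]
  refine Finset.prod_congr rfl fun k _ => ?_
  rcases eq_or_ne k i with rfl | hk
  · rw [Pi.add_apply, Pi.single_eq_same, Complex.ofReal_add, mul_add, Complex.exp_add]
    have h := exp_waveExp_mul_period (g.period_pos k).ne' (n k)
    rw [Complex.exp_neg, inv_eq_one] at h
    rw [h, mul_one]
  · rw [Pi.add_apply, Pi.single_eq_of_ne hk, add_zero]

theorem integral_exp_waveExp {L : ℝ} (hL : 0 < L) (a : ℝ) (n : ℤ) :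
    ∫ x in a..a + L, Complex.exp (waveExp L n * x) = if n = 0 then (L : ℂ) else 0 := by
  split_ifs with h
  · subst h
    simp [waveExp]
  · have hne : waveExp L n ≠ 0 := by
      rw [waveExp]
      refine mul_ne_zero Complex.I_ne_zero ?_
      have : (2 * Real.pi * n / L : ℝ) ≠ 0 := by
        have : (n : ℝ) ≠ 0 := by exact_mod_cast h
        positivity
      exact_mod_cast this
    have h1 := exp_waveExp_mul_period hL.ne' n
    rw [Complex.exp_neg, inv_eq_one] at h1
    rw [integral_exp_mul_complex hne, Complex.ofReal_add, mul_add, Complex.exp_add, h1, mul_one,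
      sub_self, zero_div]

theorem integral_character {d : ℕ} (g : Grid d) (n : Fin d → ℤ) :
    ∫ x in g.box, character g n x = if n = 0 then (g.vol : ℂ) else 0 := by
  simp_rw [character_eq_prod]
  rw [g.integral_box_prod fun i x => Complex.exp (waveExp (g.period i) (n i) * x)]
  simp_rw [integral_exp_waveExp (g.period_pos _)]
  rw [Finset.prod_ite_zero, Grid.vol]
  simp [funext_iff]

theorem integral_character_mul {d : ℕ} (g : Grid d) (n k : Fin d → ℤ) :
    ∫ x in g.box, character g n x * character g (-k) x = if n = k then (g.vol : ℂ) else 0 := by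
  simp_rw [← character_add, integral_character, ← sub_eq_add_neg, sub_eq_zero]

/-- `f` is the sum of an absolutely convergent Fourier series with coefficients `a`. -/
structure HasFourierSeries {d : ℕ} (g : Grid d) (f : (Fin d → ℝ) → ℂ) (a : (Fin d → ℤ) → ℂ) :
    Prop where
  summable : Summable fun n => ‖a n‖
  hasSum : ∀ x, HasSum (fun n => a n * character g n x) (f x)

namespace HasFourierSeries

variable {d : ℕ} {g : Grid d} {f f' : (Fin d → ℝ) → ℂ} {a a' : (Fin d → ℤ) → ℂ}

theorem continuous (h : HasFourierSeries g f a) : Continuous f := by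
  have : f = fun x => ∑' n, a n * character g n x := funext fun x => (h.hasSum x).tsum_eq.symm
  rw [this]
  refine continuous_tsum (fun n => continuous_const.mul (continuous_character g n)) h.summable ?_
  intro n x
  rw [norm_mul, norm_character, mul_one]

theorem hasSum_integral_mul (h : HasFourierSeries g f a) {ψ : (Fin d → ℝ) → ℂ}
    (hψ : IntegrableOn ψ g.box) :
    HasSum (fun n => a n * ∫ x in g.box, character g n x * ψ x) (∫ x in g.box, f x * ψ x) := by
  have hint : ∀ n, Integrable (fun x => a n * (character g n x * ψ x)) (volume.restrict g.box) :=
    fun n => (hψ.bdd_mul (c := 1) (continuous_character g n).aestronglyMeasurable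
      (.of_forall fun x => (norm_character g n x).le)).const_mul _
  have h1 := hasSum_integral_of_summable_integral_norm hint (by
    simp_rw [norm_mul, norm_character, one_mul, integral_const_mul]
    exact h.summable.mul_right _)
  simp_rw [integral_const_mul] at h1
  have e : ∀ x, f x * ψ x = ∑' n, a n * (character g n x * ψ x) := fun x => by
    rw [← (((h.hasSum x).mul_right (ψ x)).tsum_eq)]
    simp_rw [mul_assoc]
  simp_rw [e]
  exact h1

theorem fourierCoef_eq (h : HasFourierSeries g f a) (n : Fin d → ℤ) : fourierCoef g f n = a n := by
  have h1 := h.hasSum_integral_mul (g.integrableOn_box (continuous_character g (-n)))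
  simp_rw [integral_character_mul] at h1
  rw [fourierCoef, h1.unique (hasSum_single n fun k hk => by simp [hk]), if_pos rfl]
  have : (g.vol : ℂ) ≠ 0 := by exact_mod_cast g.vol_pos.ne'
  rw [show (∏ i, g.period i) = g.vol from rfl, mul_left_comm, inv_mul_cancel₀ this, mul_one]

theorem sub (h : HasFourierSeries g f a) (h' : HasFourierSeries g f' a') :
    HasFourierSeries g (f - f') (fun n => a n - a' n) where
  summable := Summable.of_nonneg_of_le (fun _ => norm_nonneg _) (fun _ => norm_sub_le _ _)
    (h.summable.add h'.summable)
  hasSum x := by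
    refine ((h.hasSum x).sub (h'.hasSum x)).congr_fun fun n => ?_
    ring

theorem smul (h : HasFourierSeries g f a) (b : ℂ) :
    HasFourierSeries g (b • f) (fun n => b * a n) where
  summable := by
    simp_rw [norm_mul]
    exact h.summable.mul_left _
  hasSum x := by
    refine ((h.hasSum x).mul_left b).congr_fun fun n => ?_
    ring

theorem sum {ι : Type*} {s : Finset ι} {F : ι → (Fin d → ℝ) → ℂ} {A : ι → (Fin d → ℤ) → ℂ}
    (h : ∀ i ∈ s, HasFourierSeries g (F i) (A i)) :
    HasFourierSeries g (fun x => ∑ i ∈ s, F i x) (fun n => ∑ i ∈ s, A i n) where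
  summable := Summable.of_nonneg_of_le (fun _ => norm_nonneg _) (fun _ => norm_sum_le _ _)
    (summable_sum fun i hi => (h i hi).summable)
  hasSum x := by
    refine (hasSum_sum fun i hi => (h i hi).hasSum x).congr_fun fun n => ?_
    rw [Finset.sum_mul]

theorem multiplier (h : HasFourierSeries g f a) {σ : (Fin d → ℤ) → ℂ} (hσ : ∀ n, ‖σ n‖ ≤ 1) :
    HasFourierSeries g (multiplier g σ f) (fun n => σ n * a n) := by
  have hs : Summable fun n => ‖σ n * a n‖ := by
    refine Summable.of_nonneg_of_le (fun _ => norm_nonneg _) (fun n => ?_) h.summable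
    rw [norm_mul]
    exact mul_le_of_le_one_left (norm_nonneg _) (hσ n)
  refine ⟨hs, fun x => ?_⟩
  simp_rw [HermiteLeapfrog.multiplier, h.fourierCoef_eq]
  refine Summable.hasSum (Summable.of_norm ?_)
  simp_rw [norm_mul _ (character g _ x), norm_character, mul_one]
  exact hs

end HasFourierSeries

/-! ### Integration by parts for smooth periodic functions -/

/-- Smooth functions with the periods of the grid. -/
def IsSmoothPeriodic {d : ℕ} (g : Grid d) (φ : (Fin d → ℝ) → ℂ) : Prop :=
  ContDiff ℝ ∞ φ ∧ ∀ i, Function.Periodic φ (Pi.single i (g.period i))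

theorem IsSmoothPeriodic.lineDeriv {d : ℕ} {g : Grid d} {φ : (Fin d → ℝ) → ℂ}
    (h : IsSmoothPeriodic g φ) (i : Fin d) :
    IsSmoothPeriodic g fun x => _root_.lineDeriv ℝ φ x (Pi.single i 1) := by
  have hd : Differentiable ℝ φ := h.1.differentiable (by simp)
  constructor
  · have : (fun x => _root_.lineDeriv ℝ φ x (Pi.single i 1)) =
        fun x => fderiv ℝ φ x (Pi.single i 1) :=
      funext fun x => (hd x).lineDeriv_eq_fderiv
    rw [this]
    exact (h.1.fderiv_right (by simp)).clm_apply contDiff_const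
  · intro k x
    simp only [_root_.lineDeriv]
    congr 1
    funext t
    rw [add_right_comm, h.2 k]

/-- The divergence theorem on the box: the contributions of opposite faces cancel. -/
theorem IsSmoothPeriodic.integral_lineDeriv {d : ℕ} {g : Grid d} {φ : (Fin d → ℝ) → ℂ}
    (h : IsSmoothPeriodic g φ) (i : Fin d) :
    ∫ x in g.box, _root_.lineDeriv ℝ φ x (Pi.single i 1) = 0 := by
  obtain _ | d := d
  · exact i.elim0
  have hd : Differentiable ℝ φ := h.1.differentiable (by simp)
  have hc : Continuous fun x => fderiv ℝ φ x (Pi.single i 1) :=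
    ((h.1.continuous_fderiv (by simp)).clm_apply continuous_const)
  simp_rw [fun x => (hd x).lineDeriv_eq_fderiv (v := Pi.single i 1)]
  have hle : g.xmin ≤ fun i => g.xmin i + g.period i := fun i => by
    simpa using (g.period_pos i).le
  have hsum : ∀ x, ∑ k, (if k = i then fderiv ℝ φ x else 0) (Pi.single k 1) =
      fderiv ℝ φ x (Pi.single i 1) := fun x => by
    rw [Finset.sum_eq_single i (fun k _ hk => by simp [hk]) (by simp), if_pos rfl]
  have h1 := integral_divergence_of_hasFDerivAt_off_countable' g.xmin
    (fun i => g.xmin i + g.period i) hle (fun k => if k = i then φ else 0)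
    (fun k x => if k = i then fderiv ℝ φ x else 0) ∅ Set.countable_empty
    (fun k => by
      by_cases hk : k = i
      · simp only [hk, if_true]; exact hd.continuous.continuousOn
      · simp only [hk, if_false]; exact continuousOn_const)
    (fun x _ k => by
      by_cases hk : k = i
      · simp only [hk, if_true]; exact (hd x).hasFDerivAt
      · simp only [hk, if_false]; exact hasFDerivAt_const _ _)
    (by
      simp_rw [hsum]
      exact hc.integrableOn_Icc)
  simp_rw [hsum] at h1
  rw [Grid.box, volume_pi, setIntegral_congr_set Measure.univ_pi_Ioc_ae_eq_Icc, ← volume_pi, h1]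
  refine Finset.sum_eq_zero fun k _ => ?_
  rw [sub_eq_zero]
  congr 1
  funext x
  by_cases hk : k = i
  · subst hk
    simp only [if_true]
    rw [← h.2 k (k.insertNth (g.xmin k) x)]
    congr 1
    funext l
    refine Fin.succAboveCases k ?_ (fun l => ?_) l
    · simp
    · simp
  · simp [hk]

theorem IsSmoothPeriodic.mul {d : ℕ} {g : Grid d} {φ ψ : (Fin d → ℝ) → ℂ}
    (h : IsSmoothPeriodic g φ) (h' : IsSmoothPeriodic g ψ) :
    IsSmoothPeriodic g fun x => φ x * ψ x :=
  ⟨h.1.mul h'.1, fun i x => by simp only [h.2 i x, h'.2 i x]⟩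

theorem isSmoothPeriodic_character {d : ℕ} (g : Grid d) (n : Fin d → ℤ) :
    IsSmoothPeriodic g (character g n) :=
  ⟨contDiff_character g n, periodic_character g n⟩

theorem hasLineDerivAt_character {d : ℕ} (g : Grid d) (n : Fin d → ℤ) (i : Fin d)
    (x : Fin d → ℝ) : HasLineDerivAt ℝ (character g n)
      (waveExp (g.period i) (n i) * character g n x) x (Pi.single i 1) := by
  have e : ∀ t : ℝ, character g n (x + t • Pi.single i 1) =
      character g n x * Complex.exp (waveExp (g.period i) (n i) * t) := by
    intro t
    rw [character_eq_prod, character_eq_prod, ← Finset.mul_prod_erase _ _ (Finset.mem_univ i),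
      ← Finset.mul_prod_erase _ (fun k => Complex.exp (waveExp (g.period k) (n k) * x k))
        (Finset.mem_univ i), Finset.prod_congr rfl (g := fun k =>
          Complex.exp (waveExp (g.period k) (n k) * x k)) fun k hk => by
        simp [Pi.single_eq_of_ne (Finset.ne_of_mem_erase hk)]]
    simp only [Pi.add_apply, Pi.smul_apply, Pi.single_eq_same, smul_eq_mul, mul_one,
      Complex.ofReal_add, mul_add, Complex.exp_add]
    ring
  unfold HasLineDerivAt
  simp_rw [e]
  have h1 : HasDerivAt (fun t : ℂ => character g n x *
      Complex.exp (waveExp (g.period i) (n i) * t)) (character g n x *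
      (Complex.exp (waveExp (g.period i) (n i) * (0 : ℝ)) * (waveExp (g.period i) (n i) * 1)))
      ((0 : ℝ) : ℂ) :=
    (((hasDerivAt_id _).const_mul _).cexp).const_mul _
  refine h1.comp_ofReal.congr_deriv ?_
  simp [mul_comm]

theorem IsSmoothPeriodic.integral_character_mul_lineDeriv {d : ℕ} {g : Grid d}
    {φ : (Fin d → ℝ) → ℂ} (h : IsSmoothPeriodic g φ) (n : Fin d → ℤ) (i : Fin d) :
    ∫ x in g.box, character g n x * _root_.lineDeriv ℝ φ x (Pi.single i 1) =
      -waveExp (g.period i) (n i) * ∫ x in g.box, character g n x * φ x := by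
  have hd : Differentiable ℝ φ := h.1.differentiable (by simp)
  have h1 := ((isSmoothPeriodic_character g n).mul h).integral_lineDeriv i
  have h2 : ∀ x, _root_.lineDeriv ℝ (fun x => character g n x * φ x) x (Pi.single i 1) =
      waveExp (g.period i) (n i) * (character g n x * φ x) +
        character g n x * _root_.lineDeriv ℝ φ x (Pi.single i 1) := by
    intro x
    have h3 := (hasLineDerivAt_character g n i x)
    have h4 : HasLineDerivAt ℝ φ (_root_.lineDeriv ℝ φ x (Pi.single i 1)) x (Pi.single i 1) :=
      ((hd x).lineDifferentiableAt).hasLineDerivAt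
    have h5 : HasLineDerivAt ℝ (fun x => character g n x * φ x) _ x (Pi.single i 1) :=
      HasDerivAt.mul h3 h4
    rw [h5.lineDeriv]
    simp
    ring
  simp_rw [h2] at h1
  rw [integral_add, integral_const_mul] at h1
  · linear_combination h1
  · exact (g.integrableOn_box (((continuous_character g n).mul hd.continuous))).const_mul _
  · exact g.integrableOn_box ((continuous_character g n).mul (h.lineDeriv i).1.continuous)

/-- Repeated integration by parts against a character. -/
theorem IsSmoothPeriodic.integral_character_mul_mixedDeriv {d : ℕ} {g : Grid d}
    {φ : (Fin d → ℝ) → ℂ} (h : IsSmoothPeriodic g φ) (k : ℕ) (n : Fin d → ℤ) :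
    ∫ x in g.box, character g n x * mixedDeriv (fun _ => k) φ x =
      (-1) ^ (d * k) * (∏ i, waveExp (g.period i) (n i) ^ k) *
        ∫ x in g.box, character g n x * φ x := by
  have hone : ∀ (i : Fin d) (r : ℕ) (ψ : (Fin d → ℝ) → ℂ), IsSmoothPeriodic g ψ →
      IsSmoothPeriodic g ((fun (u : (Fin d → ℝ) → ℂ) x =>
        _root_.lineDeriv ℝ u x (Pi.single i 1))^[r] ψ) ∧
      ∫ x in g.box, character g n x * ((fun (u : (Fin d → ℝ) → ℂ) x =>
        _root_.lineDeriv ℝ u x (Pi.single i 1))^[r] ψ) x =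
      (-waveExp (g.period i) (n i)) ^ r * ∫ x in g.box, character g n x * ψ x := by
    intro i r ψ hψ
    induction r with
    | zero => simpa using hψ
    | succ r ih =>
      rw [Function.iterate_succ_apply']
      refine ⟨ih.1.lineDeriv i, ?_⟩
      rw [ih.1.integral_character_mul_lineDeriv, ih.2, pow_succ']
      ring
  have hlist : ∀ l : List (Fin d), IsSmoothPeriodic g (l.foldr
      (fun i f => (fun (u : (Fin d → ℝ) → ℂ) x =>
        _root_.lineDeriv ℝ u x (Pi.single i 1))^[k] f) φ) ∧
      ∫ x in g.box, character g n x * (l.foldr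
        (fun i f => (fun (u : (Fin d → ℝ) → ℂ) x => _root_.lineDeriv ℝ u x (Pi.single i 1))^[k] f)
          φ) x =
      (l.map fun i => (-waveExp (g.period i) (n i)) ^ k).prod *
        ∫ x in g.box, character g n x * φ x := by
    intro l
    induction l with
    | nil => simpa using h
    | cons i l ih =>
      rw [List.foldr_cons]
      refine ⟨(hone i k _ ih.1).1, ?_⟩
      rw [(hone i k _ ih.1).2, ih.2, List.map_cons, List.prod_cons, mul_assoc]
  rw [mixedDeriv, (hlist _).2]
  congr 1
  rw [← List.ofFn_eq_map, List.prod_ofFn]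
  simp_rw [neg_pow (waveExp _ _)]
  rw [Finset.prod_mul_distrib, mul_comm d k, pow_mul]
  simp

theorem IsSmoothPeriodic.mixedDeriv {d : ℕ} {g : Grid d} {φ : (Fin d → ℝ) → ℂ}
    (h : IsSmoothPeriodic g φ) (α : Fin d → ℕ) : IsSmoothPeriodic g (mixedDeriv α φ) := by
  unfold HermiteLeapfrog.mixedDeriv
  induction List.finRange d with
  | nil => exact h
  | cons i l ih =>
    rw [List.foldr_cons]
    induction α i with
    | zero => exact ih
    | succ r ihr =>
      rw [Function.iterate_succ_apply']
      exact ihr.lineDeriv i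

/-! ### The mixed Sobolev seminorm in terms of Fourier coefficients -/

/-- The Fourier multiplier `∏ |k_i|^{2(m+1)}` of the squared seminorm. -/
def weight {d : ℕ} (g : Grid d) (m : ℕ) (n : Fin d → ℤ) : ℝ := ∏ i, waveVec g n i ^ (2 * m + 2)

theorem weight_nonneg {d : ℕ} (g : Grid d) (m : ℕ) (n : Fin d → ℤ) : 0 ≤ weight g m n :=
  Finset.prod_nonneg fun i _ => Even.pow_nonneg ⟨m + 1, by ring⟩ _

/-- The normalised characters as elements of `L²` of the box. -/
def charLp {d : ℕ} (g : Grid d) (n : Fin d → ℤ) : Lp ℂ 2 (volume.restrict g.box) :=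
  MemLp.toLp (fun x => ((√g.vol)⁻¹ : ℂ) * character g n x)
    (MemLp.of_bound (C := (√g.vol)⁻¹)
      (continuous_const.mul (continuous_character g n)).aestronglyMeasurable
      (.of_forall fun x => by
        rw [norm_mul, norm_character, mul_one, norm_inv, Complex.norm_real,
          Real.norm_of_nonneg (Real.sqrt_nonneg _)]))

theorem charLp_ae {d : ℕ} (g : Grid d) (n : Fin d → ℤ) :
    charLp g n =ᵐ[volume.restrict g.box] fun x => ((√g.vol)⁻¹ : ℂ) * character g n x :=
  MemLp.coeFn_toLp _

theorem inner_charLp {d : ℕ} (g : Grid d) (n : Fin d → ℤ) (w : Lp ℂ 2 (volume.restrict g.box)) :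
    inner ℂ (charLp g n) w = ((√g.vol)⁻¹ : ℂ) * ∫ x in g.box, w x * character g (-n) x := by
  rw [L2.inner_def, ← integral_const_mul]
  refine integral_congr_ae ?_
  filter_upwards [charLp_ae g n] with x hx
  rw [hx, RCLike.inner_apply, map_mul, conj_character, map_inv₀, Complex.conj_ofReal]
  ring

theorem orthonormal_charLp {d : ℕ} (g : Grid d) : Orthonormal ℂ (charLp g) := by
  rw [orthonormal_iff_ite]
  intro n k
  rw [inner_charLp]
  have h1 : ∫ x in g.box, charLp g k x * character g (-n) x =
      ((√g.vol)⁻¹ : ℂ) * ∫ x in g.box, character g k x * character g (-n) x := by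
    rw [← integral_const_mul]
    refine integral_congr_ae ?_
    filter_upwards [charLp_ae g k] with x hx
    rw [hx, mul_assoc]
  rw [h1, integral_character_mul, ← mul_assoc, ← mul_inv]
  have h2 : (√g.vol : ℂ) * √g.vol = g.vol := by
    rw [← Complex.ofReal_mul, Real.mul_self_sqrt g.vol_pos.le]
  have h3 : (g.vol : ℂ) ≠ 0 := by exact_mod_cast g.vol_pos.ne'
  rw [h2]
  by_cases h : n = k
  · simp [h, h3]
  · simp [h, Ne.symm h]

theorem enorm_sq_lintegral_eq {d : ℕ} {g : Grid d} (w : Lp ℂ 2 (volume.restrict g.box)) :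
    ∫⁻ x in g.box, ‖w x‖ₑ ^ 2 = ENNReal.ofReal (‖w‖ ^ 2) := by
  have h := eLpNorm_eq_lintegral_rpow_enorm_toReal (f := w) (μ := volume.restrict g.box)
    (p := 2) (by simp) (by simp)
  rw [ENNReal.ofReal_pow (norm_nonneg _), Lp.norm_def, ENNReal.ofReal_toReal (Lp.eLpNorm_ne_top w),
    h, ← ENNReal.rpow_natCast, ← ENNReal.rpow_mul]
  simp

/-- An `L²` function with given square-summable Fourier coefficients. -/
theorem exists_Lp_of_summable {d : ℕ} (g : Grid d) {b : (Fin d → ℤ) → ℂ}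
    (hb : Summable fun n => ‖b n‖ ^ 2) :
    ∃ w : Lp ℂ 2 (volume.restrict g.box), HasSum (fun n => b n • charLp g n) w ∧
      ‖w‖ ^ 2 = ∑' n, ‖b n‖ ^ 2 := by
  have ho := orthonormal_charLp g
  have hs : Summable fun n => b n • charLp g n :=
    (ho.orthogonalFamily.summable_iff_norm_sq_summable b).2 hb
  obtain ⟨w, hw⟩ := hs
  refine ⟨w, hw, ?_⟩
  have hcoef : ∀ n, inner ℂ (charLp g n) w = b n := by
    intro n
    have h1 := hw.mapL (innerSL ℂ (charLp g n))
    refine h1.unique ?_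
    simp only [innerSL_apply_apply, inner_smul_right, orthonormal_iff_ite.1 ho]
    have h0 := hasSum_single n (f := fun k => b k * if n = k then (1 : ℂ) else 0)
      fun k hk => by simp [Ne.symm hk]
    rwa [if_pos rfl, mul_one] at h0
  have h2 := hw.mapL (innerSL ℂ w)
  simp only [innerSL_apply_apply, inner_smul_right] at h2
  have h3 : ∀ n, b n * inner ℂ w (charLp g n) = ((‖b n‖ ^ 2 : ℝ) : ℂ) := fun n => by
    rw [← inner_conj_symm, hcoef, Complex.mul_conj, Complex.normSq_eq_norm_sq]
  simp_rw [h3] at h2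
  rw [inner_self_eq_norm_sq_to_K] at h2
  have h4 : HasSum (fun n => ‖b n‖ ^ 2) (‖w‖ ^ 2) := by
    rw [← Complex.hasSum_ofReal]
    simpa using h2
  exact h4.tsum_eq.symm

theorem norm_prod_waveExp_sq {d : ℕ} (g : Grid d) (m : ℕ) (n : Fin d → ℤ) :
    ‖∏ i, waveExp (g.period i) (n i) ^ (m + 1)‖ ^ 2 = weight g m n := by
  rw [norm_prod, ← Finset.prod_pow, weight]
  refine Finset.prod_congr rfl fun i _ => ?_
  rw [norm_pow, waveExp, norm_mul, Complex.norm_I, one_mul, Complex.norm_real, ← pow_mul,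
    mul_comm (m + 1) 2, mul_add, mul_one, Real.norm_eq_abs, Even.pow_abs ⟨m + 1, by ring⟩]
  rfl

theorem HasFourierSeries.hasSum_integral_mul_mixedDeriv {d : ℕ} {g : Grid d}
    {f : (Fin d → ℝ) → ℂ} {a : (Fin d → ℤ) → ℂ} (h : HasFourierSeries g f a)
    {φ : (Fin d → ℝ) → ℂ} (hφ : IsSmoothPeriodic g φ) (k : ℕ) :
    HasSum (fun n => (-1) ^ (d * k) * (a n * (∏ i, waveExp (g.period i) (n i) ^ k) *
        ∫ x in g.box, character g n x * φ x))
      (∫ x in g.box, f x * mixedDeriv (fun _ => k) φ x) := by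
  have := h.hasSum_integral_mul (g.integrableOn_box (hφ.mixedDeriv fun _ => k).1.continuous)
  simp_rw [hφ.integral_character_mul_mixedDeriv] at this
  refine this.congr_fun fun n => ?_
  ring

/-- The squared seminorm is the weighted sum of the squared Fourier coefficients: a weak derivative
with the right Fourier coefficients exists by completeness of `L²`, and any weak derivative has
these coefficients, so that Bessel's inequality applies. -/
theorem HasFourierSeries.seminormSq_eq {d : ℕ} {g : Grid d}
    {f : (Fin d → ℝ) → ℂ} {a : (Fin d → ℤ) → ℂ} (h : HasFourierSeries g f a) (m : ℕ)
    (hs : Summable fun n => weight g m n * ‖a n‖ ^ 2) :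
    seminormSq g m f = ENNReal.ofReal (g.vol * ∑' n, weight g m n * ‖a n‖ ^ 2) := by
  set lam : (Fin d → ℤ) → ℂ := fun n => ∏ i, waveExp (g.period i) (n i) ^ (m + 1) with hlam
  have hlam2 : ∀ n, ‖lam n‖ ^ 2 = weight g m n := norm_prod_waveExp_sq g m
  have hV : (0 : ℝ) < √g.vol := Real.sqrt_pos.2 g.vol_pos
  have hVV : √g.vol * √g.vol = g.vol := Real.mul_self_sqrt g.vol_pos.le
  have hVne : (√g.vol : ℂ) ≠ 0 := by exact_mod_cast hV.ne'
  have hnorm : ∀ n, ‖(√g.vol : ℂ) * (lam n * a n)‖ ^ 2 = g.vol * (weight g m n * ‖a n‖ ^ 2) := by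
    intro n
    rw [norm_mul, norm_mul, Complex.norm_real, Real.norm_of_nonneg hV.le, mul_pow, mul_pow, hlam2,
      pow_two, hVV]
  refine le_antisymm ?_ ?_
  -- The sum in `L²` of the differentiated Fourier series is a weak derivative.
  · obtain ⟨w, hw, hwn⟩ := exists_Lp_of_summable g
      (b := fun n => (√g.vol : ℂ) * (lam n * a n)) (by simp_rw [hnorm]; exact hs.mul_left _)
    simp_rw [hnorm, tsum_mul_left] at hwn
    rw [← hwn, ← enorm_sq_lintegral_eq]
    refine iInf₂_le (w : (Fin d → ℝ) → ℂ) ⟨g.integrableOn_box h.continuous,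
      (Lp.memLp w).integrable (by norm_num), fun φ hφ1 hφ2 => ?_⟩
    have hφ : IsSmoothPeriodic g φ := ⟨hφ1, hφ2⟩
    obtain ⟨C, hC⟩ := isCompact_Icc.exists_bound_of_continuousOn (s := Set.Icc g.xmin
      fun i => g.xmin i + g.period i) hφ1.continuous.continuousOn
    have hmem : MemLp (fun x => (starRingEnd ℂ) (φ x)) 2 (volume.restrict g.box) := by
      refine MemLp.of_bound (C := C) (Complex.continuous_conj.comp
        hφ1.continuous).aestronglyMeasurable ?_
      filter_upwards [ae_restrict_mem g.measurableSet_box] with x hx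
      rw [RCLike.norm_conj]
      exact hC x (g.box_subset_Icc hx)
    have hinner : ∀ v : Lp ℂ 2 (volume.restrict g.box),
        inner ℂ hmem.toLp v = ∫ x in g.box, v x * φ x := by
      intro v
      rw [L2.inner_def]
      refine integral_congr_ae ?_
      filter_upwards [hmem.coeFn_toLp] with x hx
      rw [hx, RCLike.inner_apply, Complex.conj_conj]
    have h1 := hw.mapL (innerSL ℂ hmem.toLp)
    simp only [innerSL_apply_apply, inner_smul_right] at h1
    rw [hinner] at h1
    have h2 : ∀ n, inner ℂ hmem.toLp (charLp g n) =
        ((√g.vol)⁻¹ : ℂ) * ∫ x in g.box, character g n x * φ x := by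
      intro n
      rw [hinner, ← integral_const_mul]
      refine integral_congr_ae ?_
      filter_upwards [charLp_ae g n] with x hx
      rw [hx, mul_assoc]
    refine (h.hasSum_integral_mul_mixedDeriv hφ (m + 1)).unique ?_
    refine (h1.mul_left _).congr_fun fun n => ?_
    rw [h2]
    simp only [hlam]
    field_simp
  -- The Fourier coefficients of a weak derivative are found by testing with characters.
  · refine le_iInf₂ fun w hw => ?_
    by_cases hfin : ∫⁻ x in g.box, ‖w x‖ₑ ^ 2 = ⊤
    · rw [hfin]; exact le_top
    have hmem : MemLp w 2 (volume.restrict g.box) := by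
      refine ⟨hw.2.1.aestronglyMeasurable, ?_⟩
      rw [eLpNorm_lt_top_iff_lintegral_rpow_enorm_lt_top (by simp) (by simp)]
      simpa using lt_top_iff_ne_top.2 hfin
    have hcoef : ∀ n, inner ℂ (charLp g n) (MemLp.toLp w hmem) = (√g.vol : ℂ) * (lam n * a n) := by
      intro n
      have h1 := hw.2.2 _ (contDiff_character g (-n)) (periodic_character g (-n))
      have h2 := h.hasSum_integral_mul_mixedDeriv (isSmoothPeriodic_character g (-n)) (m + 1)
      simp_rw [integral_character_mul] at h2
      have h3 := h2.unique (hasSum_single n fun k hk => by simp [hk])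
      rw [if_pos rfl, h1] at h3
      have h4 : ((-1 : ℂ) ^ (d * (m + 1))) ≠ 0 := pow_ne_zero _ (by norm_num)
      have h5 := mul_left_cancel₀ h4 h3
      have h6 : ∫ x in g.box, (MemLp.toLp w hmem) x * character g (-n) x =
          ∫ x in g.box, w x * character g (-n) x := by
        refine integral_congr_ae ?_
        filter_upwards [hmem.coeFn_toLp] with x hx
        rw [hx]
      have h7 : (g.vol : ℂ) = √g.vol * √g.vol := by rw [← Complex.ofReal_mul, hVV]
      rw [inner_charLp, h6, h5, h7]
      simp only [hlam]
      field_simp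
    have hB := (orthonormal_charLp g).tsum_inner_products_le (MemLp.toLp w hmem)
    simp_rw [hcoef, hnorm, tsum_mul_left] at hB
    refine (ENNReal.ofReal_le_ofReal hB).trans (le_of_eq ?_)
    rw [← enorm_sq_lintegral_eq]
    refine lintegral_congr_ae ?_
    filter_upwards [hmem.coeFn_toLp] with x hx
    rw [hx]

/-! ### Fourier series of Hermite interpolants -/

/-- The Fourier coefficients of the Hermite interpolant of periodic nodal data `D`, written as a
linear expression in `D`. (By periodicity the base point `0` of `coefOne` is immaterial.) -/
def interpCoef {d m : ℕ} (g : Grid d) (o : Fin d → ℝ) (D : NodalData d m) (n : Fin d → ℤ) : ℂ :=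
  ∑ j : (i : Fin d) → Fin (g.K i), ∑ α : Fin d → Fin (m + 1), D (fun i => ((j i : ℕ) : ℤ)) α *
    ∏ i, coefOne 0 (g.K i * g.h i) (piecewisePoly (o i) (g.h i) (tensorSpline m g j α i)) (n i)

theorem interpCoef_add {d m : ℕ} (g : Grid d) (o : Fin d → ℝ) (D E : NodalData d m)
    (n : Fin d → ℤ) : interpCoef g o (D + E) n = interpCoef g o D n + interpCoef g o E n := by
  simp only [interpCoef, Pi.add_apply, add_mul, Finset.sum_add_distrib]

/-- The value at `y` of the derivative `∂^α` of the character with index `n`. -/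
def nodeSymbol {d : ℕ} (g : Grid d) (α : Fin d → ℕ) (y : Fin d → ℝ) (n : Fin d → ℤ) : ℂ :=
  ∏ i, (waveExp (g.K i * g.h i) (n i) ^ α i * Complex.exp (waveExp (g.K i * g.h i) (n i) * y i))

theorem hasFourierSeries_interpolant {d m : ℕ} (g : Grid d) (o : Fin d → ℝ) {D : NodalData d m}
    (hD : D.IsPeriodic g) : HasFourierSeries g (interpolant g o D) (interpCoef g o D) := by
  have e : interpolant g o D = fun x => ∑ j : (i : Fin d) → Fin (g.K i),
      ∑ α : Fin d → Fin (m + 1), (D (fun i => ((j i : ℕ) : ℤ)) α •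
        fun x : Fin d → ℝ =>
          ∏ i, piecewisePoly (o i) (g.h i) (tensorSpline m g j α i) (x i)) x := by
    funext x
    rw [interpolant_eq g o hD]
    rfl
  rw [e]
  refine HasFourierSeries.sum fun j _ => HasFourierSeries.sum fun α _ =>
    HasFourierSeries.smul ⟨?_, fun x => ?_⟩ _
  · simp_rw [norm_prod]
    refine summable_prod_pi (fun i => coefOne 0 (g.K i * g.h i)
      (piecewisePoly (o i) (g.h i) (tensorSpline m g j α i))) fun i => ?_
    simpa using (isSpline_tensorSpline m g j α i).summable_coefOne (o := o i) (g.h_pos i)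
      (g.K_pos i) 0 (Nat.zero_le _)
  · simp_rw [character_eq_prod, ← Finset.prod_mul_distrib, Grid.period]
    refine hasSum_prod_pi (fun i k => coefOne 0 (g.K i * g.h i)
      (piecewisePoly (o i) (g.h i) (tensorSpline m g j α i)) k *
        Complex.exp (waveExp (g.K i * g.h i) k * x i)) _ (fun i => ?_) fun i => ?_
    · simpa using (isSpline_tensorSpline m g j α i).summable_coefOne_mul_exp (o := o i) (g.h_pos i)
        (g.K_pos i) 0 (Nat.zero_le _) (x i)
    · simpa using (isSpline_tensorSpline m g j α i).hasSum_deriv (o := o i) (g.h_pos i)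
        (g.K_pos i) 0 (Nat.zero_le _) (x i)

/-- The nodal data are recovered from the Fourier coefficients of the interpolant. -/
theorem hasSum_nodeSymbol_mul_interpCoef {d m : ℕ} (g : Grid d) (o : Fin d → ℝ)
    {D : NodalData d m} (hD : D.IsPeriodic g) (l : Fin d → ℤ) (α : Fin d → Fin (m + 1)) :
    HasSum (fun n => nodeSymbol g (fun i => α i) (fun i => o i + l i * g.h i) n *
      interpCoef g o D n) (D l α) := by
  have h0 := sum_mul_prod_eval_tensorSpline g hD l (fun _ => 0) α
  simp only [Fin.val_zero, Nat.cast_zero, zero_mul, Complex.ofReal_zero, add_zero] at h0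
  rw [← h0]
  have h1 : ∀ (j : (i : Fin d) → Fin (g.K i)) (β : Fin d → Fin (m + 1)),
      HasSum (fun n : Fin d → ℤ => ∏ i, (waveExp (g.K i * g.h i) (n i) ^ (α i : ℕ) *
        coefOne 0 (g.K i * g.h i) (piecewisePoly (o i) (g.h i) (tensorSpline m g j β i)) (n i) *
        Complex.exp (waveExp (g.K i * g.h i) (n i) * ((o i + l i * g.h i : ℝ) : ℂ))))
      (∏ i, (Polynomial.derivative^[(α i : ℕ)] (tensorSpline m g j β i (l i))).eval 0) := by
    intro j β
    have hS := isSpline_tensorSpline m g j β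
    have hα : ∀ i, (α i : ℕ) ≤ m := fun i => Nat.lt_succ_iff.1 (α i).2
    refine hasSum_prod_pi (fun i k => waveExp (g.K i * g.h i) k ^ (α i : ℕ) *
        coefOne 0 (g.K i * g.h i) (piecewisePoly (o i) (g.h i) (tensorSpline m g j β i)) k *
        Complex.exp (waveExp (g.K i * g.h i) k * ((o i + l i * g.h i : ℝ) : ℂ))) _
      (fun i => (hS i).summable_coefOne_mul_exp (g.h_pos i) (g.K_pos i) 0 (hα i) _) fun i => ?_
    have h2 := (hS i).hasSum_deriv (o := o i) (g.h_pos i) (g.K_pos i) 0 (hα i) (o i + l i * g.h i)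
    rw [piecewisePoly_of_mem_Ico (g.h_pos i) _ (j := l i)
      ⟨le_rfl, by linarith [g.h_pos i]⟩] at h2
    simpa using h2
  refine (hasSum_sum fun j _ => hasSum_sum fun β _ => (h1 j β).mul_left
    (D (fun i => ((j i : ℕ) : ℤ)) β)).congr_fun fun n => ?_
  rw [nodeSymbol, interpCoef, Finset.mul_sum]
  refine Finset.sum_congr rfl fun j _ => ?_
  rw [Finset.mul_sum]
  refine Finset.sum_congr rfl fun β _ => ?_
  rw [mul_left_comm, ← Finset.prod_mul_distrib]
  congr 1
  refine Finset.prod_congr rfl fun i _ => ?_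
  ring

/-- The mixed derivative of order `2m+2` in each variable of an interpolant is a combination of
derivatives of Dirac masses at the nodes. -/
theorem exists_weight_mul_conj_interpCoef {d m : ℕ} (g : Grid d) (o : Fin d → ℝ)
    (D : NodalData d m) :
    ∃ w : ((i : Fin d) → Fin (g.K i)) → (Fin d → Fin (m + 1)) → ℂ, ∀ n,
      (weight g m n : ℂ) * (starRingEnd ℂ) (interpCoef g o D n) = ∑ j, ∑ α, w j α *
        nodeSymbol g (fun i => α i) (fun i => o i + ((j i : ℕ) : ℤ) * g.h i) n := by
  classical
  choose w hw using fun (j : (i : Fin d) → Fin (g.K i)) (α : Fin d → Fin (m + 1)) (i : Fin d) =>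
    (isSpline_tensorSpline m g j α i).exists_conj_coefOne (o := o i) (g.h_pos i) (g.K_pos i) 0
  refine ⟨fun j' α' => ∑ j : (i : Fin d) → Fin (g.K i), ∑ α : Fin d → Fin (m + 1),
    (starRingEnd ℂ) (D (fun i => ((j i : ℕ) : ℤ)) α) * ∏ i, w j α i (j' i) (α' i), fun n => ?_⟩
  have h1 : ∀ j α, (weight g m n : ℂ) * (starRingEnd ℂ) (∏ i, coefOne 0 (g.K i * g.h i)
      (piecewisePoly (o i) (g.h i) (tensorSpline m g j α i)) (n i)) =
      ∑ j' : (i : Fin d) → Fin (g.K i), ∑ α' : Fin d → Fin (m + 1),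
        (∏ i, w j α i (j' i) (α' i)) *
          nodeSymbol g (fun i => α' i) (fun i => o i + ((j' i : ℕ) : ℤ) * g.h i) n := by
    intro j α
    rw [weight, map_prod, Complex.ofReal_prod, ← Finset.prod_mul_distrib]
    have h2 := fun i => (congrArg (· * (starRingEnd ℂ) (coefOne 0 (g.K i * g.h i)
      (piecewisePoly (o i) (g.h i) (tensorSpline m g j α i)) (n i)))
        (Complex.ofReal_pow (waveVec g n i) (2 * m + 2))).trans (hw j α i (n i))
    rw [Finset.prod_congr rfl fun i _ => h2 i, Finset.prod_univ_sum, Fintype.piFinset_univ]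
    refine Finset.sum_congr rfl fun j' _ => ?_
    rw [Finset.prod_univ_sum, Fintype.piFinset_univ]
    refine Finset.sum_congr rfl fun α' _ => ?_
    rw [nodeSymbol, ← Finset.prod_mul_distrib]
    refine Finset.prod_congr rfl fun i _ => ?_
    push_cast
    ring
  rw [interpCoef, map_sum, Finset.mul_sum]
  simp_rw [map_sum, map_mul, Finset.mul_sum, mul_left_comm (weight g m n : ℂ), h1, Finset.mul_sum,
    Finset.sum_mul, mul_assoc]
  rw [Finset.sum_congr rfl fun j _ => Finset.sum_comm, Finset.sum_comm]
  refine Finset.sum_congr rfl fun j' _ => ?_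
  rw [Finset.sum_congr rfl fun j _ => Finset.sum_comm, Finset.sum_comm]

/-- Galerkin orthogonality of Hermite interpolation: if a Fourier series has the nodal values of
the data `E`, then its difference from the interpolant of `E` is orthogonal to every
interpolant with respect to the weighted inner product. -/
theorem hasSum_weight_mul_sub_mul_conj {d m : ℕ} (g : Grid d) (o : Fin d → ℝ)
    {E : NodalData d m} (hE : E.IsPeriodic g) {A : (Fin d → ℤ) → ℂ}
    (hA : ∀ l (α : Fin d → Fin (m + 1)), HasSum (fun n =>
      nodeSymbol g (fun i => α i) (fun i => o i + l i * g.h i) n * A n) (E l α))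
    (D : NodalData d m) :
    HasSum (fun n => (weight g m n : ℂ) *
      ((A n - interpCoef g o E n) * (starRingEnd ℂ) (interpCoef g o D n))) 0 := by
  obtain ⟨w, hw⟩ := exists_weight_mul_conj_interpCoef g o D
  have h1 := hasSum_sum (s := Finset.univ) fun j (_ : j ∈ Finset.univ) =>
    hasSum_sum (s := Finset.univ) fun (α : Fin d → Fin (m + 1)) (_ : α ∈ Finset.univ) =>
      ((hA (fun i => ((j i : Fin (g.K i)) : ℕ)) α).sub (hasSum_nodeSymbol_mul_interpCoef g o hE
        (fun i => ((j i : Fin (g.K i)) : ℕ)) α)).mul_left (w j α)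
  simp only [sub_self, mul_zero, Finset.sum_const_zero] at h1
  refine h1.congr_fun fun n => ?_
  rw [mul_left_comm, hw, Finset.mul_sum]
  refine Finset.sum_congr rfl fun j _ => ?_
  rw [Finset.mul_sum]
  refine Finset.sum_congr rfl fun α _ => ?_
  ring

theorem summable_weight_mul_norm_interpCoef_sq {d m : ℕ} (g : Grid d) (o : Fin d → ℝ)
    {D : NodalData d m} (hD : D.IsPeriodic g) :
    Summable fun n => weight g m n * ‖interpCoef g o D n‖ ^ 2 := by
  obtain ⟨w, hw⟩ := exists_weight_mul_conj_interpCoef g o D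
  have h1 := hasSum_sum (s := Finset.univ) fun j (_ : j ∈ Finset.univ) =>
    hasSum_sum (s := Finset.univ) fun (α : Fin d → Fin (m + 1)) (_ : α ∈ Finset.univ) =>
      (hasSum_nodeSymbol_mul_interpCoef g o hD
        (fun i => ((j i : Fin (g.K i)) : ℕ)) α).mul_left (w j α)
  rw [← Complex.summable_ofReal]
  refine h1.summable.congr fun n => ?_
  rw [Complex.ofReal_mul, ← Complex.normSq_eq_norm_sq, Complex.normSq_eq_conj_mul_self,
    ← mul_assoc, hw, Finset.sum_mul]
  refine Finset.sum_congr rfl fun j _ => ?_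
  rw [Finset.sum_mul]
  refine Finset.sum_congr rfl fun α _ => ?_
  ring_nf

/-! ### The Taylor step in Fourier space -/

theorem abs_mul_sincDeriv_zero_le_one (τ : ℝ) {x s : ℝ} (h : x ^ 2 ≤ s) :
    |x * sincDeriv 0 τ s| ≤ 1 := by
  have hs : 0 ≤ s := (sq_nonneg x).trans h
  have h1 := mul_sincDeriv_zero τ (√s)
  rw [Real.sq_sqrt hs] at h1
  calc |x * sincDeriv 0 τ s| ≤ |√s * sincDeriv 0 τ s| := by
        rw [abs_mul, abs_mul]
        exact mul_le_mul_of_nonneg_right ((Real.abs_le_sqrt h).trans (le_abs_self _))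
          (abs_nonneg _)
    _ ≤ 1 := by rw [h1]; exact Real.abs_sin_le_one _

theorem oddTaylor_add {d : ℕ} (m : ℕ) (c Δt : ℝ) (p q : MvPolynomial (Fin d) ℂ) :
    oddTaylor m c Δt (p + q) = oddTaylor m c Δt p + oddTaylor m c Δt q := by
  rw [oddTaylor, oddTaylor, oddTaylor, ← Finset.sum_add_distrib]
  refine Finset.sum_congr rfl fun r hr => ?_
  clear hr
  rw [← smul_add]
  congr 1
  induction r with
  | zero => rfl
  | succ r ih => simp only [Function.iterate_succ_apply', ih, laplacian_add]

theorem oddTaylor_smul {d : ℕ} (m : ℕ) (c Δt : ℝ) (b : ℂ) (p : MvPolynomial (Fin d) ℂ) :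
    oddTaylor m c Δt (b • p) = b • oddTaylor m c Δt p := by
  rw [oddTaylor, oddTaylor, Finset.smul_sum]
  refine Finset.sum_congr rfl fun r hr => ?_
  clear hr
  rw [smul_comm]
  congr 1
  induction r with
  | zero => rfl
  | succ r ih => simp only [Function.iterate_succ_apply', ih, laplacian_smul]

/-- The value at `x` of `∂^α` applied to the odd Taylor sum, as a linear functional. -/
def taylorValue {d : ℕ} (m : ℕ) (c Δt : ℝ) (α : Fin d → ℕ) (x : Fin d → ℝ) :
    MvPolynomial (Fin d) ℂ →ₗ[ℂ] ℂ where
  toFun q := evalAt x (polyDeriv α (oddTaylor m c Δt q))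
  map_add' p q := by rw [oddTaylor_add, polyDeriv_add, evalAt, map_add]; rfl
  map_smul' b p := by
    rw [oddTaylor_smul, polyDeriv_smul, evalAt, MvPolynomial.smul_eval]; rfl

/-- The Fourier multiplier `2 i k_l sin(τ|k|) / |k|`, with `τ = c Δt / 2`, of the operator
`2 ∑_{j odd} (c Δt / 2)^j / j! Δ^{(j-1)/2} ∂_l`. -/
def stepSymbol {d : ℕ} (g : Grid d) (c Δt : ℝ) (l : Fin d) (n : Fin d → ℤ) : ℂ :=
  2 * (waveExp (g.K l * g.h l) (n l) *
    (sincDeriv 0 (c * Δt / 2) (∑ i, waveVec g n i ^ 2) : ℂ))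

/-- Locality of the propagator for products of splines. -/
theorem hasSum_nodeSymbol_mul_stepSymbol_prod {d : ℕ} (m : ℕ) (g : Grid d) (o : Fin d → ℝ)
    {c Δt : ℝ} (h0 : 0 ≤ c * Δt) (hCFL : ∀ i, c * Δt ≤ g.h i) (l : Fin d → ℤ)
    (α : Fin d → Fin (m + 1)) (i₀ : Fin d) {P : Fin d → ℤ → Polynomial ℂ}
    (hP : ∀ i, IsSpline m (g.K i) (g.h i) (P i)) :
    HasSum (fun n => nodeSymbol g (fun i => α i) (fun i => o i + l i * g.h i + g.h i / 2) n *
        (stepSymbol g c Δt i₀ n *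
          ∏ i, coefOne 0 (g.K i * g.h i) (piecewisePoly (o i) (g.h i) (P i)) (n i)))
      (taylorValue m c Δt (fun i => α i) g.centre
        (MvPolynomial.pderiv i₀ (tensorPoly fun i => P i (l i)))) := by
  classical
  have hα : ∀ i, (α i : ℕ) ≤ m := fun i => Nat.lt_succ_iff.1 (α i).2
  set τ : ℝ := c * Δt / 2 with hτ
  have hτ0 : 0 ≤ τ := by positivity
  set cf : Fin d → ℤ → ℂ := fun i k => waveExp (g.K i * g.h i) k ^ (α i : ℕ) *
    coefOne 0 (g.K i * g.h i) (piecewisePoly (o i) (g.h i) (P i)) k *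
    Complex.exp (waveExp (g.K i * g.h i) k * ((o i + l i * g.h i + g.h i / 2 : ℝ) : ℂ)) with hcf
  set C : Fin d → ℤ → ℂ := fun i k =>
    if i = i₀ then waveExp (g.K i * g.h i) k * cf i k else cf i k with hC
  set Q : Fin d → Polynomial ℂ := Function.update (fun i => P i (l i)) i₀
    (Polynomial.derivative (P i₀ (l i₀))) with hQ
  set t : Fin d → ℕ → ℂ := fun i b => (-1) ^ b *
    (Polynomial.derivative^[(α i : ℕ) + 2 * b] (Q i)).eval ((g.h i / 2 : ℝ) : ℂ) with ht
  have hcs : ∀ i, Summable fun k => ‖cf i k‖ := fun i =>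
    (hP i).summable_coefOne_mul_exp (g.h_pos i) (g.K_pos i) 0 (hα i) _
  have hL : ∀ i, IsLocalTaylor (fun k => 2 * Real.pi * k / (g.K i * g.h i)) (C i) (t i) (m + 1)
      (g.h i / 2) := by
    intro i
    by_cases hi : i = i₀
    · subst hi
      have h1 := (hP i).isLocalTaylor_deriv (o := o i) (g.h_pos i) (g.K_pos i) 0 (hα i) (l i)
      have e : ∀ b, Polynomial.derivative^[(α i : ℕ) + 1 + 2 * b] (P i (l i)) =
          Polynomial.derivative^[(α i : ℕ) + 2 * b] (Q i) := fun b => by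
        rw [hQ, Function.update_self, ← Function.iterate_succ_apply]
        congr 1
        omega
      simp_rw [e] at h1
      simpa only [hC, if_pos] using h1
    · have h1 := (hP i).isLocalTaylor (o := o i) (g.h_pos i) (g.K_pos i) 0 (hα i) (l i)
      have e : Q i = P i (l i) := Function.update_of_ne hi _ _
      simpa only [hC, if_neg hi, ht, e] using h1
  have hprod : ∀ n : Fin d → ℤ, ∏ i, C i (n i) =
      waveExp (g.K i₀ * g.h i₀) (n i₀) * ∏ i, cf i (n i) := by
    intro n
    have : ∀ i, C i (n i) =
        (if i = i₀ then waveExp (g.K i * g.h i) (n i) else 1) * cf i (n i) := fun i => by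
      simp only [hC]; split_ifs <;> simp
    rw [Finset.prod_congr rfl fun i _ => this i, Finset.prod_mul_distrib]
    simp
  -- The factor `k_{i₀}` alone would destroy absolute convergence, but `|k_{i₀} sin(τ|k|)/|k|| ≤ 1`.
  have hsum : Summable fun n : Fin d → ℤ => (∏ i, C i (n i)) *
      (sincDeriv 0 τ (∑ i, (2 * Real.pi * (n i) / (g.K i * g.h i)) ^ 2) : ℂ) := by
    refine Summable.of_norm_bounded (summable_prod_pi cf hcs) fun n => ?_
    rw [hprod, mul_right_comm, norm_mul, norm_prod]
    refine mul_le_of_le_one_left (Finset.prod_nonneg fun _ _ => norm_nonneg _) ?_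
    rw [waveExp, mul_assoc, norm_mul, Complex.norm_I, one_mul, ← Complex.ofReal_mul,
      Complex.norm_real]
    exact abs_mul_sincDeriv_zero_le_one τ (Finset.single_le_sum
      (f := fun i => (2 * Real.pi * (n i) / (g.K i * g.h i)) ^ 2) (fun i _ => sq_nonneg _)
        (Finset.mem_univ i₀))
  have h1 := (hasSum_prod_mul_sinc hτ0 (fun i => by have := hCFL i; rw [hτ]; linarith) hL i₀
    (fun i hi => by simpa only [hC, if_neg hi] using hcs i) hsum).mul_left 2
  have hQdeg : ∀ i, (Q i).natDegree ≤ 2 * m + 1 := by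
    intro i
    by_cases hi : i = i₀
    · subst hi
      rw [hQ, Function.update_self]
      exact (Polynomial.natDegree_derivative_le _).trans
        (by have := (hP i).natDegree_le (l i); omega)
    · rw [hQ, Function.update_of_ne hi]
      exact (hP i).natDegree_le (l i)
  have hval : taylorValue m c Δt (fun i => α i) g.centre
      (MvPolynomial.pderiv i₀ (tensorPoly fun i => P i (l i))) =
      2 * ∑ b : Fin d → Fin (m + 1), (sincCoeff (∑ i, (b i : ℕ)) τ : ℂ) *
        ∏ i, (t i (b i) / (b i : ℕ).factorial) := by
    rw [pderiv_tensorPoly]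
    exact evalAt_oddTaylor_tensorPoly i₀.pos m c Δt hQdeg _ _
  rw [hval]
  refine h1.congr_fun fun n => ?_
  have e : nodeSymbol g (fun i => α i) (fun i => o i + l i * g.h i + g.h i / 2) n *
      ∏ i, coefOne 0 (g.K i * g.h i) (piecewisePoly (o i) (g.h i) (P i)) (n i) =
      ∏ i, cf i (n i) := by
    rw [nodeSymbol, ← Finset.prod_mul_distrib]
    refine Finset.prod_congr rfl fun i _ => ?_
    simp only [hcf]
    ring
  have e2 : ∑ i, (2 * Real.pi * (n i) / (g.K i * g.h i)) ^ 2 = ∑ i, waveVec g n i ^ 2 := rfl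
  rw [mul_left_comm, e, hprod, stepSymbol, e2]
  ring

/-- The Fourier series obtained from an interpolant by multiplication with the exact propagator
symbol has the nodal values prescribed by the Taylor step at the cell centres: under the CFL
condition these values only depend on the polynomial in the cell. -/
theorem hasSum_nodeSymbol_mul_stepSymbol {d m : ℕ} (g : Grid d) (o : Fin d → ℝ)
    {c Δt : ℝ} (h0 : 0 ≤ c * Δt) (hCFL : ∀ i, c * Δt ≤ g.h i) {D : NodalData d m}
    (hD : D.IsPeriodic g) (l : Fin d → ℤ) (α : Fin d → Fin (m + 1)) (i₀ : Fin d) :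
    HasSum (fun n => nodeSymbol g (fun i => α i) (fun i => o i + l i * g.h i + g.h i / 2) n *
        (stepSymbol g c Δt i₀ n * interpCoef g o D n))
      (taylorValue m c Δt (fun i => α i) g.centre
        (MvPolynomial.pderiv i₀ (cellPoly g D l))) := by
  rw [cellPoly_eq g hD]
  simp_rw [map_sum, Derivation.map_smul, map_smul]
  refine (hasSum_sum fun j _ => hasSum_sum fun β _ =>
    (hasSum_nodeSymbol_mul_stepSymbol_prod m g o h0 hCFL l α i₀
      (isSpline_tensorSpline m g j β)).const_smul (D (fun i => ((j i : ℕ) : ℤ)) β)).congr_fun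
        fun n => ?_
  rw [interpCoef, Finset.mul_sum, Finset.mul_sum]
  refine Finset.sum_congr rfl fun j _ => ?_
  rw [Finset.mul_sum, Finset.mul_sum]
  refine Finset.sum_congr rfl fun β _ => ?_
  rw [smul_eq_mul]
  ring

/-! ### The scheme in Fourier space -/

theorem cellPoly_add_period {d m : ℕ} (g : Grid d) {D : NodalData d m} (hD : D.IsPeriodic g)
    (l : Fin d → ℤ) (i : Fin d) : cellPoly g D (l + Pi.single i (g.K i : ℤ)) = cellPoly g D l := by
  have : D.corners (l + Pi.single i (g.K i : ℤ)) = D.corners l := by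
    funext ε
    rw [NodalData.corners, NodalData.corners, ← hD (fun k => l k + ((ε k : ℕ) : ℤ)) i]
    congr 1
    funext k
    simp only [Pi.add_apply]
    ring
  rw [cellPoly, cellPoly]
  congr 1
  rw [this]

/-- The increment of the `i`-th velocity component in one step. -/
def incV {d m : ℕ} (g : Grid d) (c Δt : ℝ) (p : NodalData d m) (i : Fin d) : NodalData d m :=
  fun j α => taylorValue m c Δt (fun l => α l) g.centre (MvPolynomial.pderiv i (cellPoly g p j))

/-- The increment of the pressure in one step. -/
def incP {d m : ℕ} (g : Grid d) (c Δt : ℝ) (v : Fin d → NodalData d m) : NodalData d m :=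
  fun j α => taylorValue m c Δt (fun l => α l) g.centre
    (∑ i, MvPolynomial.pderiv i (cellPoly g (v i) (fun l => j l - 1)))

theorem stepV_eq_add_incV {d m : ℕ} (g : Grid d) (c Δt : ℝ) (v : Fin d → NodalData d m)
    (p : NodalData d m) (i : Fin d) : stepV g c Δt v p i = v i + incV g c Δt p i := rfl

theorem stepP_eq_add_incP {d m : ℕ} (g : Grid d) (c Δt : ℝ) (p : NodalData d m)
    (v : Fin d → NodalData d m) : stepP g c Δt p v = p + incP g c Δt v := rfl

theorem NodalData.IsPeriodic.add {d m : ℕ} {g : Grid d} {D E : NodalData d m}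
    (hD : D.IsPeriodic g) (hE : E.IsPeriodic g) : (D + E).IsPeriodic g := fun j i => by
  rw [Pi.add_apply, Pi.add_apply, hD j i, hE j i]

theorem isPeriodic_incV {d m : ℕ} (g : Grid d) (c Δt : ℝ) {p : NodalData d m}
    (hp : p.IsPeriodic g) (i : Fin d) : (incV g c Δt p i).IsPeriodic g := fun j k => by
  funext α
  rw [incV, incV, cellPoly_add_period g hp]

theorem isPeriodic_incP {d m : ℕ} (g : Grid d) (c Δt : ℝ) {v : Fin d → NodalData d m}
    (hv : ∀ i, (v i).IsPeriodic g) : (incP g c Δt v).IsPeriodic g := fun j k => by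
  funext α
  have e : (fun l => (j + Pi.single k (g.K k : ℤ) : Fin d → ℤ) l - 1) =
      (fun l => j l - 1) + Pi.single k (g.K k : ℤ) := by
    funext l
    simp only [Pi.add_apply]
    ring
  simp only [incP, e, cellPoly_add_period g (hv _)]

theorem hasSum_incV {d m : ℕ} (g : Grid d) {c Δt : ℝ} (h0 : 0 ≤ c * Δt)
    (hCFL : ∀ i, c * Δt ≤ g.h i) {p : NodalData d m} (hp : p.IsPeriodic g) (i : Fin d)
    (l : Fin d → ℤ) (α : Fin d → Fin (m + 1)) :
    HasSum (fun n => nodeSymbol g (fun i => α i) (fun i => g.dual i + l i * g.h i) n *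
      (stepSymbol g c Δt i n * interpCoef g g.primary p n)) (incV g c Δt p i l α) := by
  have h := hasSum_nodeSymbol_mul_stepSymbol g g.primary h0 hCFL hp l α i
  have e : (fun i => g.dual i + l i * g.h i) =
      fun i => g.primary i + l i * g.h i + g.h i / 2 := by
    funext i; simp only [Grid.dual, Grid.primary]; ring
  rw [e]
  exact h

theorem hasSum_incP {d m : ℕ} (g : Grid d) {c Δt : ℝ} (h0 : 0 ≤ c * Δt)
    (hCFL : ∀ i, c * Δt ≤ g.h i) {v : Fin d → NodalData d m} (hv : ∀ i, (v i).IsPeriodic g)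
    (l : Fin d → ℤ) (α : Fin d → Fin (m + 1)) :
    HasSum (fun n => nodeSymbol g (fun i => α i) (fun i => g.primary i + l i * g.h i) n *
      ∑ i, stepSymbol g c Δt i n * interpCoef g g.dual (v i) n) (incP g c Δt v l α) := by
  have h := hasSum_sum (s := Finset.univ) fun i (_ : i ∈ Finset.univ) =>
    hasSum_nodeSymbol_mul_stepSymbol g g.dual h0 hCFL (hv i) (fun k => l k - 1) α i
  have e : (fun i => g.primary i + l i * g.h i) =
      fun i => g.dual i + ((l i - 1 : ℤ) : ℝ) * g.h i + g.h i / 2 := by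
    funext i; simp only [Grid.dual, Grid.primary]; push_cast; ring
  simp_rw [e, Finset.mul_sum, incP, map_sum]
  exact h

/-! ### Fourier coefficients of the characteristic variables -/

theorem waveNum_ne_zero {d : ℕ} (g : Grid d) {n : Fin d → ℤ} (hn : n ≠ 0) : waveNum g n ≠ 0 := by
  rw [waveNum, Real.sqrt_ne_zero (Finset.sum_nonneg fun _ _ => sq_nonneg _)]
  intro h
  rw [Finset.sum_eq_zero_iff_of_nonneg fun _ _ => sq_nonneg _] at h
  refine hn (funext fun i => ?_)
  have h1 := h i (Finset.mem_univ i)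
  rw [sq_eq_zero_iff, waveVec, div_eq_zero_iff, or_iff_left (g.period_pos i).ne'] at h1
  simpa [Real.pi_ne_zero] using h1

theorem sum_unitVec_sq {d : ℕ} (g : Grid d) {e : Fin d → ℝ} (he : ∑ i, e i ^ 2 = 1)
    (n : Fin d → ℤ) : ∑ i, unitVec g e n i ^ 2 = 1 := by
  rw [unitVec]
  split_ifs with h
  · exact he
  · have h1 := waveNum_ne_zero g h
    have h2 : waveNum g n ^ 2 = ∑ i, waveVec g n i ^ 2 :=
      Real.sq_sqrt (Finset.sum_nonneg fun _ _ => sq_nonneg _)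
    simp_rw [div_pow]
    rw [← Finset.sum_div, ← h2, div_self (pow_ne_zero 2 h1)]

theorem norm_unitVec_le_one {d : ℕ} (g : Grid d) {e : Fin d → ℝ} (he : ∑ i, e i ^ 2 = 1)
    (i : Fin d) (n : Fin d → ℤ) : ‖(unitVec g e n i : ℂ)‖ ≤ 1 := by
  rw [Complex.norm_real, Real.norm_eq_abs, ← sq_le_one_iff_abs_le_one, ← sum_unitVec_sq g he n]
  exact Finset.single_le_sum (f := fun i => unitVec g e n i ^ 2) (fun _ _ => sq_nonneg _)
    (Finset.mem_univ i)

/-- The angle `c |k| Δt / 2` by which the symbols of `opS` rotate. -/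
def phase {d : ℕ} (g : Grid d) (c Δt : ℝ) (n : Fin d → ℤ) : ℝ := c * waveNum g n * Δt / 2

/-- At `k = 0` both sides vanish, whatever the value of `unitVec` there. -/
theorem stepSymbol_eq {d : ℕ} (g : Grid d) (c Δt : ℝ) (e : Fin d → ℝ) (i : Fin d)
    (n : Fin d → ℤ) : stepSymbol g c Δt i n =
      2 * Complex.I * (Real.sin (phase g c Δt n) : ℂ) * (unitVec g e n i : ℂ) := by
  have h1 := mul_sincDeriv_zero (c * Δt / 2) (waveNum g n)
  have h2 : waveNum g n ^ 2 = ∑ i, waveVec g n i ^ 2 :=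
    Real.sq_sqrt (Finset.sum_nonneg fun _ _ => sq_nonneg _)
  have h3 : c * Δt / 2 * waveNum g n = phase g c Δt n := by rw [phase]; ring
  rw [h2, h3] at h1
  have h4 : waveExp (g.K i * g.h i) (n i) = Complex.I * (waveVec g n i : ℂ) := rfl
  rw [stepSymbol, ← h1, h4]
  rcases eq_or_ne n 0 with hn | hn
  · subst hn
    simp [waveVec, waveNum]
  · have h5 : (waveNum g n : ℂ) ≠ 0 := by exact_mod_cast waveNum_ne_zero g hn
    rw [unitVec, if_neg hn]
    push_cast
    field_simp

/-- The longitudinal part `k · b / |k|` of vector-valued Fourier coefficients. -/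
def longCoef {d : ℕ} (g : Grid d) (e : Fin d → ℝ) (b : Fin d → (Fin d → ℤ) → ℂ)
    (n : Fin d → ℤ) : ℂ :=
  ∑ j, (unitVec g e n j : ℂ) * b j n

section Variables

variable {d : ℕ} {g : Grid d} {e : Fin d → ℝ} {p : (Fin d → ℝ) → ℂ}
  {v : Fin d → (Fin d → ℝ) → ℂ} {a : (Fin d → ℤ) → ℂ} {b : Fin d → (Fin d → ℤ) → ℂ}

theorem hasFourierSeries_opGadj (he : ∑ i, e i ^ 2 = 1)
    (hv : ∀ i, HasFourierSeries g (v i) (b i)) :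
    HasFourierSeries g (opGadj g e v) (longCoef g e b) :=
  HasFourierSeries.sum fun i _ => (hv i).multiplier (norm_unitVec_le_one g he i)

theorem hasFourierSeries_partD (he : ∑ i, e i ^ 2 = 1)
    (hv : ∀ i, HasFourierSeries g (v i) (b i)) (i : Fin d) :
    HasFourierSeries g (partD g e v i) fun n => (unitVec g e n i : ℂ) * longCoef g e b n :=
  (hasFourierSeries_opGadj he hv).multiplier (norm_unitVec_le_one g he i)

theorem hasFourierSeries_partC (he : ∑ i, e i ^ 2 = 1)
    (hv : ∀ i, HasFourierSeries g (v i) (b i)) (i : Fin d) :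
    HasFourierSeries g (partC g e v i)
      fun n => b i n - (unitVec g e n i : ℂ) * longCoef g e b n :=
  (hv i).sub (hasFourierSeries_partD he hv i)

theorem HasFourierSeries.opS (hp : HasFourierSeries g p a) (c Δt s : ℝ) :
    HasFourierSeries g (opS g c Δt s p)
      fun n => Complex.exp (Complex.I * ((s * phase g c Δt n : ℝ) : ℂ)) * a n := by
  have e1 : ∀ n, s * phase g c Δt n = s * c * waveNum g n * Δt / 2 := fun n => by
    rw [phase]; ring
  simp_rw [e1]
  refine hp.multiplier fun n => ?_
  rw [mul_comm, Complex.norm_exp_ofReal_mul_I]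

theorem longCoef_partD (he : ∑ i, e i ^ 2 = 1) (n : Fin d → ℤ) :
    longCoef g e (fun i n => (unitVec g e n i : ℂ) * longCoef g e b n) n = longCoef g e b n := by
  rw [longCoef]
  simp_rw [← mul_assoc]
  rw [← Finset.sum_mul]
  have h : (∑ i, (unitVec g e n i : ℂ) * unitVec g e n i) = 1 := by
    rw [← Complex.ofReal_one, ← sum_unitVec_sq g he n, Complex.ofReal_sum]
    refine Finset.sum_congr rfl fun i _ => ?_
    push_cast
    ring
  rw [h, one_mul]

theorem hasFourierSeries_varP (he : ∑ i, e i ^ 2 = 1) (hp : HasFourierSeries g p a)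
    (hv : ∀ i, HasFourierSeries g (v i) (b i)) (c Δt s : ℝ) :
    HasFourierSeries g (varP g c Δt e s p v) fun n => a n -
      s * (Complex.exp (Complex.I * ((s * phase g c Δt n : ℝ) : ℂ)) * longCoef g e b n) := by
  have h := hp.sub (((hasFourierSeries_opGadj he (hasFourierSeries_partD he hv)).opS c Δt s).smul
    (s : ℂ))
  simp_rw [longCoef_partD he] at h
  exact h

theorem hasFourierSeries_varV (he : ∑ i, e i ^ 2 = 1) (hp : HasFourierSeries g p a)
    (hv : ∀ i, HasFourierSeries g (v i) (b i)) (c Δt s : ℝ) (i : Fin d) :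
    HasFourierSeries g (varV g c Δt e s p v i) fun n =>
      (unitVec g e n i : ℂ) * longCoef g e b n - s * ((unitVec g e n i : ℂ) *
        (Complex.exp (Complex.I * ((s * phase g c Δt n : ℝ) : ℂ)) * a n)) :=
  (hasFourierSeries_partD he hv i).sub
    (((hp.opS c Δt s).multiplier (norm_unitVec_le_one g he i)).smul (s : ℂ))

end Variables

/-! ### The energies as sums over wave vectors -/

theorem norm_sq_eq_re_add_im (z : ℂ) : ‖z‖ ^ 2 = z.re ^ 2 + z.im ^ 2 := by
  rw [← Complex.normSq_eq_norm_sq, Complex.normSq_apply]; ring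

theorem sum_sub_mul_sq {d : ℕ} {u : Fin d → ℝ} (hu : ∑ i, u i ^ 2 = 1) (x : Fin d → ℝ) :
    ∑ i, (x i - u i * ∑ j, u j * x j) ^ 2 = ∑ i, x i ^ 2 - (∑ j, u j * x j) ^ 2 := by
  set t := ∑ j, u j * x j with ht
  have : ∀ i, (x i - u i * t) ^ 2 = x i ^ 2 - 2 * t * (u i * x i) + t ^ 2 * u i ^ 2 :=
    fun i => by ring
  simp_rw [this, Finset.sum_add_distrib, Finset.sum_sub_distrib, ← Finset.mul_sum, hu, ← ht]
  ring

/-- Pythagoras for the longitudinal and the transversal part. -/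
theorem sum_norm_sub_longitudinal_sq {d : ℕ} {u : Fin d → ℝ} (hu : ∑ i, u i ^ 2 = 1)
    (b : Fin d → ℂ) : ∑ i, ‖b i - u i * ∑ j, (u j : ℂ) * b j‖ ^ 2 =
      ∑ i, ‖b i‖ ^ 2 - ‖∑ j, (u j : ℂ) * b j‖ ^ 2 := by
  have h1 := sum_sub_mul_sq hu fun i => (b i).re
  have h2 := sum_sub_mul_sq hu fun i => (b i).im
  have h3 : (∑ j, (u j : ℂ) * b j).re = ∑ j, u j * (b j).re := by simp [Complex.re_sum]
  have h4 : (∑ j, (u j : ℂ) * b j).im = ∑ j, u j * (b j).im := by simp [Complex.im_sum]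
  have h5 : ∀ i, ‖b i - u i * ∑ j, (u j : ℂ) * b j‖ ^ 2 =
      ((b i).re - u i * ∑ j, u j * (b j).re) ^ 2 + ((b i).im - u i * ∑ j, u j * (b j).im) ^ 2 :=
    fun i => by
      rw [norm_sq_eq_re_add_im, Complex.sub_re, Complex.sub_im, Complex.re_ofReal_mul,
        Complex.im_ofReal_mul, h3, h4]
  simp_rw [h5, norm_sq_eq_re_add_im, Finset.sum_add_distrib, h3, h4]
  rw [h1, h2]
  ring

/-- The parallelogram law for the two characteristic variables; the rotations by `±θ` leave a cross
term with `sin θ`. -/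
theorem norm_sub_exp_mul_sq_add (a β : ℂ) (θ : ℝ) :
    ‖a - ((1 : ℝ) : ℂ) * (Complex.exp (Complex.I * ((1 * θ : ℝ) : ℂ)) * β)‖ ^ 2 +
      ‖a - ((-1 : ℝ) : ℂ) * (Complex.exp (Complex.I * ((-1 * θ : ℝ) : ℂ)) * β)‖ ^ 2 =
    2 * ‖a‖ ^ 2 + 2 * ‖β‖ ^ 2 -
      2 * ((starRingEnd ℂ) a * (2 * Complex.I * (Real.sin θ : ℂ) * β)).re := by
  have h1 : ∀ t : ℝ, Complex.exp (Complex.I * (t : ℂ)) =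
      (Real.cos t : ℂ) + (Real.sin t : ℂ) * Complex.I := fun t => by
    rw [mul_comm, Complex.exp_mul_I, Complex.ofReal_cos, Complex.ofReal_sin]
  rw [h1, h1, one_mul, neg_one_mul, Real.cos_neg, Real.sin_neg]
  have h2 := Real.sin_sq_add_cos_sq θ
  simp only [norm_sq_eq_re_add_im, Complex.sub_re, Complex.sub_im, Complex.mul_re, Complex.mul_im,
    Complex.add_re, Complex.add_im, Complex.ofReal_re, Complex.ofReal_im, Complex.I_re,
    Complex.I_im, Complex.conj_re, Complex.conj_im, Complex.re_ofNat, Complex.im_ofNat]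
  linear_combination (2 * (β.re ^ 2 + β.im ^ 2)) * h2

/-- The contribution of one wave vector to the energies: `Q` for `s = 1`, `R` for `s = -1`. -/
def density {d : ℕ} (g : Grid d) (c Δt : ℝ) (e : Fin d → ℝ) (s : ℝ) (a : (Fin d → ℤ) → ℂ)
    (b : Fin d → (Fin d → ℤ) → ℂ) (n : Fin d → ℤ) : ℝ :=
  2 * ‖a n‖ ^ 2 + 2 * ∑ i, ‖b i n‖ ^ 2 - s * (2 * ((starRingEnd ℂ) (a n) *
    (2 * Complex.I * (Real.sin (phase g c Δt n) : ℂ) * longCoef g e b n)).re)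

theorem norm_longCoef_sq_le {d : ℕ} (g : Grid d) {e : Fin d → ℝ} (he : ∑ i, e i ^ 2 = 1)
    (b : Fin d → (Fin d → ℤ) → ℂ) (n : Fin d → ℤ) :
    ‖longCoef g e b n‖ ^ 2 ≤ ∑ i, ‖b i n‖ ^ 2 := by
  have h := sum_norm_sub_longitudinal_sq (sum_unitVec_sq g he n) fun i => b i n
  have h0 : 0 ≤ ∑ i, ‖b i n - unitVec g e n i * ∑ j, (unitVec g e n j : ℂ) * b j n‖ ^ 2 :=
    Finset.sum_nonneg fun _ _ => sq_nonneg _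
  rw [h] at h0
  rw [longCoef]
  linarith

theorem summable_weight_mul_density {d : ℕ} {g : Grid d} (m : ℕ) (c Δt : ℝ) {e : Fin d → ℝ}
    (he : ∑ i, e i ^ 2 = 1) {s : ℝ} (hs : |s| ≤ 1) {a : (Fin d → ℤ) → ℂ}
    {b : Fin d → (Fin d → ℤ) → ℂ} (ha : Summable fun n => weight g m n * ‖a n‖ ^ 2)
    (hb : ∀ i, Summable fun n => weight g m n * ‖b i n‖ ^ 2) :
    Summable fun n => weight g m n * density g c Δt e s a b n := by
  have h1 : Summable fun n => 4 * (weight g m n * ‖a n‖ ^ 2) +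
      4 * ∑ i, weight g m n * ‖b i n‖ ^ 2 :=
    (ha.mul_left 4).add ((summable_sum fun i _ => hb i).mul_left 4)
  refine Summable.of_norm_bounded h1 fun n => ?_
  rw [Real.norm_eq_abs, abs_mul, abs_of_nonneg (weight_nonneg g m n), ← Finset.mul_sum]
  set B := ∑ i, ‖b i n‖ ^ 2 with hB
  have hB0 : 0 ≤ B := Finset.sum_nonneg fun _ _ => sq_nonneg _
  have h2 : |s * (2 * ((starRingEnd ℂ) (a n) *
      (2 * Complex.I * (Real.sin (phase g c Δt n) : ℂ) * longCoef g e b n)).re)| ≤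
      2 * ‖a n‖ ^ 2 + 2 * B := by
    rw [abs_mul]
    refine (mul_le_of_le_one_left (abs_nonneg _) hs).trans ?_
    rw [abs_mul, abs_two]
    have h3 := Complex.abs_re_le_norm ((starRingEnd ℂ) (a n) *
      (2 * Complex.I * (Real.sin (phase g c Δt n) : ℂ) * longCoef g e b n))
    rw [norm_mul, norm_mul, norm_mul, norm_mul, RCLike.norm_conj, Complex.norm_real,
      Complex.norm_I, Complex.norm_ofNat, Real.norm_eq_abs] at h3
    have h4 := Real.abs_sin_le_one (phase g c Δt n)
    have h5 : ‖a n‖ * (2 * 1 * |Real.sin (phase g c Δt n)| * ‖longCoef g e b n‖) ≤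
        ‖a n‖ * (2 * 1 * 1 * ‖longCoef g e b n‖) := by gcongr
    have h6 := norm_longCoef_sq_le g he b n
    nlinarith [sq_nonneg (‖a n‖ - ‖longCoef g e b n‖)]
  have h7 : |density g c Δt e s a b n| ≤ 4 * ‖a n‖ ^ 2 + 4 * B := by
    rw [density, ← hB]
    have h8 := abs_le.1 h2
    rw [abs_le]
    constructor <;> nlinarith [sq_nonneg ‖a n‖]
  calc weight g m n * |density g c Δt e s a b n| ≤ weight g m n * (4 * ‖a n‖ ^ 2 + 4 * B) :=
        mul_le_mul_of_nonneg_left h7 (weight_nonneg g m n)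
    _ = _ := by ring

theorem seminormSqVec_eq {d : ℕ} {g : Grid d} {f : Fin d → (Fin d → ℝ) → ℂ}
    {a : Fin d → (Fin d → ℤ) → ℂ} (h : ∀ i, HasFourierSeries g (f i) (a i)) (m : ℕ)
    (hs : Summable fun n => weight g m n * ∑ i, ‖a i n‖ ^ 2) :
    seminormSqVec g m f = ENNReal.ofReal (g.vol * ∑' n, weight g m n * ∑ i, ‖a i n‖ ^ 2) := by
  have hi : ∀ i, Summable fun n => weight g m n * ‖a i n‖ ^ 2 := fun i =>
    Summable.of_nonneg_of_le (fun n => mul_nonneg (weight_nonneg g m n) (sq_nonneg _))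
      (fun n => mul_le_mul_of_nonneg_left (Finset.single_le_sum (f := fun i => ‖a i n‖ ^ 2)
        (fun _ _ => sq_nonneg _) (Finset.mem_univ i)) (weight_nonneg g m n)) hs
  rw [seminormSqVec, Finset.sum_congr rfl fun i _ => (h i).seminormSq_eq m (hi i),
    ← ENNReal.ofReal_sum_of_nonneg fun i _ => mul_nonneg g.vol_pos.le
      (tsum_nonneg fun n => mul_nonneg (weight_nonneg g m n) (sq_nonneg _)),
    ← Finset.mul_sum, ← Summable.tsum_finsetSum fun i _ => hi i]
  simp_rw [Finset.mul_sum]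

/-- Three nonnegative weighted series add up, within `ℝ≥0∞`, to the series of their combination. -/
theorem ofReal_add_ofReal_add_two_mul {ι : Type*} {V : ℝ} (hV : 0 ≤ V) {W f₁ f₂ f₃ ρ : ι → ℝ}
    (hW : ∀ n, 0 ≤ W n) (h₁ : ∀ n, 0 ≤ f₁ n) (h₂ : ∀ n, 0 ≤ f₂ n) (h₃ : ∀ n, 0 ≤ f₃ n)
    (hρ : ∀ n, f₁ n + f₂ n + 2 * f₃ n = ρ n) (hs : Summable fun n => W n * ρ n) :
    (Summable (fun n => W n * f₁ n) ∧ Summable (fun n => W n * f₂ n) ∧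
      Summable fun n => W n * f₃ n) ∧
    ENNReal.ofReal (V * ∑' n, W n * f₁ n) + ENNReal.ofReal (V * ∑' n, W n * f₂ n) +
      2 * ENNReal.ofReal (V * ∑' n, W n * f₃ n) = ENNReal.ofReal (V * ∑' n, W n * ρ n) := by
  have hle : ∀ f : ι → ℝ, (∀ n, 0 ≤ f n) → (∀ n, f n ≤ ρ n) → Summable fun n => W n * f n :=
    fun f hf hfρ => Summable.of_nonneg_of_le (fun n => mul_nonneg (hW n) (hf n))
      (fun n => mul_le_mul_of_nonneg_left (hfρ n) (hW n)) hs
  have s₁ := hle f₁ h₁ fun n => by linarith [hρ n, h₂ n, h₃ n]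
  have s₂ := hle f₂ h₂ fun n => by linarith [hρ n, h₁ n, h₃ n]
  have s₃ := hle f₃ h₃ fun n => by linarith [hρ n, h₁ n, h₂ n, h₃ n]
  have hn : ∀ f : ι → ℝ, (∀ n, 0 ≤ f n) → 0 ≤ V * ∑' n, W n * f n := fun f hf =>
    mul_nonneg hV (tsum_nonneg fun n => mul_nonneg (hW n) (hf n))
  refine ⟨⟨s₁, s₂, s₃⟩, ?_⟩
  have h2 : (2 : ℝ≥0∞) = ENNReal.ofReal 2 := by simp
  rw [h2, ← ENNReal.ofReal_mul zero_le_two, ← ENNReal.ofReal_add (hn _ h₁) (hn _ h₂),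
    ← ENNReal.ofReal_add (add_nonneg (hn _ h₁) (hn _ h₂)) (mul_nonneg zero_le_two (hn _ h₃))]
  congr 1
  have h4 := ((s₁.hasSum.add s₂.hasSum).add (s₃.hasSum.mul_left 2)).tsum_eq
  have h5 : ∀ n, W n * f₁ n + W n * f₂ n + 2 * (W n * f₃ n) = W n * ρ n := fun n => by
    rw [← hρ n]; ring
  simp_rw [h5] at h4
  rw [h4]
  ring

section Energies

variable {d : ℕ} {g : Grid d} {e : Fin d → ℝ} {p : (Fin d → ℝ) → ℂ}
  {v : Fin d → (Fin d → ℝ) → ℂ} {a : (Fin d → ℤ) → ℂ} {b : Fin d → (Fin d → ℤ) → ℂ}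

theorem energy_varP_eq (m : ℕ) (c Δt : ℝ) (he : ∑ i, e i ^ 2 = 1) (hp : HasFourierSeries g p a)
    (hv : ∀ i, HasFourierSeries g (v i) (b i))
    (ha : Summable fun n => weight g m n * ‖a n‖ ^ 2)
    (hb : ∀ i, Summable fun n => weight g m n * ‖b i n‖ ^ 2) :
    seminormSq g m (varP g c Δt e 1 p v) + seminormSq g m (varP g c Δt e (-1) p v) +
      2 * seminormSqVec g m (partC g e v) =
    ENNReal.ofReal (g.vol * ∑' n, weight g m n * density g c Δt e 1 a b n) := by
  have hs := summable_weight_mul_density m c Δt he (s := 1) (by simp) ha hb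
  have hρ : ∀ n, ‖a n - ((1 : ℝ) : ℂ) * (Complex.exp (Complex.I *
        ((1 * phase g c Δt n : ℝ) : ℂ)) * longCoef g e b n)‖ ^ 2 +
      ‖a n - ((-1 : ℝ) : ℂ) * (Complex.exp (Complex.I *
        ((-1 * phase g c Δt n : ℝ) : ℂ)) * longCoef g e b n)‖ ^ 2 +
      2 * ∑ i, ‖b i n - (unitVec g e n i : ℂ) * longCoef g e b n‖ ^ 2 =
      density g c Δt e 1 a b n := fun n => by
    have h2 := sum_norm_sub_longitudinal_sq (sum_unitVec_sq g he n) fun i => b i n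
    rw [← longCoef] at h2
    rw [norm_sub_exp_mul_sq_add, h2, density]
    ring
  obtain ⟨⟨s₁, s₂, s₃⟩, h⟩ := ofReal_add_ofReal_add_two_mul g.vol_pos.le (weight_nonneg g m)
    (fun n => sq_nonneg _) (fun n => sq_nonneg _)
    (fun n => Finset.sum_nonneg fun _ _ => sq_nonneg _) hρ hs
  rw [(hasFourierSeries_varP he hp hv c Δt 1).seminormSq_eq m s₁,
    (hasFourierSeries_varP he hp hv c Δt (-1)).seminormSq_eq m s₂,
    seminormSqVec_eq (hasFourierSeries_partC he hv) m s₃, h]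

theorem energy_varV_eq (m : ℕ) (c Δt : ℝ) (he : ∑ i, e i ^ 2 = 1) (hp : HasFourierSeries g p a)
    (hv : ∀ i, HasFourierSeries g (v i) (b i))
    (ha : Summable fun n => weight g m n * ‖a n‖ ^ 2)
    (hb : ∀ i, Summable fun n => weight g m n * ‖b i n‖ ^ 2) :
    seminormSqVec g m (varV g c Δt e 1 p v) + seminormSqVec g m (varV g c Δt e (-1) p v) +
      2 * seminormSqVec g m (partC g e v) =
    ENNReal.ofReal (g.vol * ∑' n, weight g m n * density g c Δt e (-1) a b n) := by
  have hs := summable_weight_mul_density m c Δt he (s := -1) (by simp) ha hb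
  have h3 : ∀ (s : ℝ) (z : ℂ) (n : Fin d → ℤ), ∑ i, ‖(unitVec g e n i : ℂ) * longCoef g e b n -
      s * ((unitVec g e n i : ℂ) * z)‖ ^ 2 = ‖longCoef g e b n - s * z‖ ^ 2 := fun s z n => by
    have h4 : ∀ i, (unitVec g e n i : ℂ) * longCoef g e b n - s * ((unitVec g e n i : ℂ) * z) =
        (unitVec g e n i : ℂ) * (longCoef g e b n - s * z) := fun i => by ring
    simp_rw [h4, norm_mul, mul_pow, Complex.norm_real, Real.norm_eq_abs, sq_abs]
    rw [← Finset.sum_mul, sum_unitVec_sq g he, one_mul]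
  have hρ : ∀ n, ∑ i, ‖(unitVec g e n i : ℂ) * longCoef g e b n - ((1 : ℝ) : ℂ) *
        ((unitVec g e n i : ℂ) * (Complex.exp (Complex.I *
          ((1 * phase g c Δt n : ℝ) : ℂ)) * a n))‖ ^ 2 +
      ∑ i, ‖(unitVec g e n i : ℂ) * longCoef g e b n - ((-1 : ℝ) : ℂ) *
        ((unitVec g e n i : ℂ) * (Complex.exp (Complex.I *
          ((-1 * phase g c Δt n : ℝ) : ℂ)) * a n))‖ ^ 2 +
      2 * ∑ i, ‖b i n - (unitVec g e n i : ℂ) * longCoef g e b n‖ ^ 2 =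
      density g c Δt e (-1) a b n := fun n => by
    have h2 := sum_norm_sub_longitudinal_sq (sum_unitVec_sq g he n) fun i => b i n
    rw [← longCoef] at h2
    rw [h3, h3, norm_sub_exp_mul_sq_add, h2, density]
    simp only [Complex.mul_re, Complex.mul_im, Complex.ofReal_re, Complex.ofReal_im, Complex.I_re,
      Complex.I_im, Complex.conj_re, Complex.conj_im, Complex.re_ofNat, Complex.im_ofNat]
    ring
  obtain ⟨⟨s₁, s₂, s₃⟩, h⟩ := ofReal_add_ofReal_add_two_mul g.vol_pos.le (weight_nonneg g m)
    (fun n => Finset.sum_nonneg fun _ _ => sq_nonneg _)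
    (fun n => Finset.sum_nonneg fun _ _ => sq_nonneg _)
    (fun n => Finset.sum_nonneg fun _ _ => sq_nonneg _) hρ hs
  rw [seminormSqVec_eq (hasFourierSeries_varV he hp hv c Δt 1) m s₁,
    seminormSqVec_eq (hasFourierSeries_varV he hp hv c Δt (-1)) m s₂,
    seminormSqVec_eq (hasFourierSeries_partC he hv) m s₃, h]

end Energies

/-! ### Conservation -/

/-- The change of the energy density in a velocity step: the defect between the exact increment
`stepSymbol * a` and the actual one, tested with the sum of the old and the new velocity. -/
theorem density_neg_sub_density {d : ℕ} (g : Grid d) (c Δt : ℝ) (e : Fin d → ℝ)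
    (a : (Fin d → ℤ) → ℂ) (b b' : Fin d → (Fin d → ℤ) → ℂ) (n : Fin d → ℤ) :
    density g c Δt e (-1) a b' n - density g c Δt e 1 a b n =
      -2 * ∑ i, ((stepSymbol g c Δt i n * a n - (b' i n - b i n)) *
        (starRingEnd ℂ) (b' i n + b i n)).re := by
  have h : ∀ (x : ℂ) (b : Fin d → (Fin d → ℤ) → ℂ),
      ((starRingEnd ℂ) (a n) * (x * longCoef g e b n)).re =
        ∑ i, ((starRingEnd ℂ) (a n) * (x * ((unitVec g e n i : ℂ) * b i n))).re := fun x b => by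
    rw [longCoef, Finset.mul_sum, Finset.mul_sum, Complex.re_sum]
  rw [density, density, h, h]
  simp_rw [stepSymbol_eq g c Δt e]
  have h2 : ∀ A X Y Z W : ℝ, A + X - -1 * (2 * Y) - (A + Z - 1 * (2 * W)) =
    X + 2 * Y - Z + 2 * W := fun A X Y Z W => by ring
  rw [h2, Finset.mul_sum, Finset.mul_sum, Finset.mul_sum, Finset.mul_sum, Finset.mul_sum,
    ← Finset.sum_add_distrib, ← Finset.sum_sub_distrib, ← Finset.sum_add_distrib]
  refine Finset.sum_congr rfl fun i _ => ?_
  simp only [norm_sq_eq_re_add_im, map_add, Complex.sub_re, Complex.sub_im, Complex.mul_re,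
    Complex.mul_im, Complex.add_re, Complex.add_im, Complex.ofReal_re, Complex.ofReal_im,
    Complex.I_re, Complex.I_im, Complex.conj_re, Complex.conj_im, Complex.re_ofNat,
    Complex.im_ofNat]
  ring

/-- The change of the energy density in a pressure step, similarly. -/
theorem density_sub_density_neg {d : ℕ} (g : Grid d) (c Δt : ℝ) (e : Fin d → ℝ)
    (a a' : (Fin d → ℤ) → ℂ) (b : Fin d → (Fin d → ℤ) → ℂ) (n : Fin d → ℤ) :
    density g c Δt e 1 a' b n - density g c Δt e (-1) a b n =
      -2 * ((∑ i, stepSymbol g c Δt i n * b i n - (a' n - a n)) *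
        (starRingEnd ℂ) (a' n + a n)).re := by
  have h : ∑ i, stepSymbol g c Δt i n * b i n =
      2 * Complex.I * (Real.sin (phase g c Δt n) : ℂ) * longCoef g e b n := by
    rw [longCoef, Finset.mul_sum]
    refine Finset.sum_congr rfl fun i _ => ?_
    rw [stepSymbol_eq g c Δt e, mul_assoc]
  rw [h, density, density]
  simp only [norm_sq_eq_re_add_im, map_add, Complex.sub_re, Complex.sub_im, Complex.mul_re,
    Complex.mul_im, Complex.add_re, Complex.add_im, Complex.ofReal_re, Complex.ofReal_im,
    Complex.I_re, Complex.I_im, Complex.conj_re, Complex.conj_im, Complex.re_ofNat,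
    Complex.im_ofNat]
  ring

section Steps

variable {d m : ℕ} {g : Grid d} {c Δt : ℝ} {e : Fin d → ℝ} {p : NodalData d m}
  {v : Fin d → NodalData d m}

theorem isPeriodic_stepV (hp : p.IsPeriodic g) (hv : ∀ i, (v i).IsPeriodic g) (i : Fin d) :
    (stepV g c Δt v p i).IsPeriodic g :=
  (hv i).add (isPeriodic_incV g c Δt hp i)

theorem isPeriodic_stepP (hp : p.IsPeriodic g) (hv : ∀ i, (v i).IsPeriodic g) :
    (stepP g c Δt p v).IsPeriodic g :=
  hp.add (isPeriodic_incP g c Δt hv)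

/-- The energies agree before and after a velocity step, by orthogonality tested with the sum of
the old and the new velocity. -/
theorem tsum_density_stepV (h0 : 0 ≤ c * Δt) (hCFL : ∀ i, c * Δt ≤ g.h i)
    (he : ∑ i, e i ^ 2 = 1) (hp : p.IsPeriodic g) (hv : ∀ i, (v i).IsPeriodic g) :
    ∑' n, weight g m n * density g c Δt e 1 (interpCoef g g.primary p)
      (fun i => interpCoef g g.dual (v i)) n =
    ∑' n, weight g m n * density g c Δt e (-1) (interpCoef g g.primary p)
      (fun i => interpCoef g g.dual (stepV g c Δt v p i)) n := by
  have ha := summable_weight_mul_norm_interpCoef_sq g g.primary hp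
  have s1 := summable_weight_mul_density m c Δt he (s := 1) (by simp) ha fun i =>
    summable_weight_mul_norm_interpCoef_sq g g.dual (hv i)
  have s2 := summable_weight_mul_density m c Δt he (s := -1) (by simp) ha fun i =>
    summable_weight_mul_norm_interpCoef_sq g g.dual (isPeriodic_stepV (c := c) (Δt := Δt) hp hv i)
  have h1 := (hasSum_sum (s := Finset.univ) fun i (_ : i ∈ Finset.univ) => Complex.hasSum_re
    (hasSum_weight_mul_sub_mul_conj g g.dual (isPeriodic_incV g c Δt hp i)
      (hasSum_incV g h0 hCFL hp i) (stepV g c Δt v p i + v i))).mul_left (-2)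
  simp only [Complex.zero_re, Finset.sum_const_zero, mul_zero] at h1
  have h2 := (s2.hasSum.sub s1.hasSum).unique (h1.congr_fun fun n => ?_)
  · exact (sub_eq_zero.1 h2).symm
  · rw [← mul_sub, density_neg_sub_density, mul_left_comm, Finset.mul_sum]
    congr 1
    refine Finset.sum_congr rfl fun i _ => ?_
    rw [← Complex.re_ofReal_mul, interpCoef_add, stepV_eq_add_incV, interpCoef_add,
      add_sub_cancel_left]

/-- The energies agree before and after a pressure step, by orthogonality tested with the sum of
the old and the new pressure. -/
theorem tsum_density_stepP (h0 : 0 ≤ c * Δt) (hCFL : ∀ i, c * Δt ≤ g.h i)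
    (he : ∑ i, e i ^ 2 = 1) (hp : p.IsPeriodic g) (hv : ∀ i, (v i).IsPeriodic g) :
    ∑' n, weight g m n * density g c Δt e (-1) (interpCoef g g.primary p)
      (fun i => interpCoef g g.dual (v i)) n =
    ∑' n, weight g m n * density g c Δt e 1 (interpCoef g g.primary (stepP g c Δt p v))
      (fun i => interpCoef g g.dual (v i)) n := by
  have hb := fun i => summable_weight_mul_norm_interpCoef_sq g g.dual (hv i)
  have s1 := summable_weight_mul_density m c Δt he (s := -1) (by simp)
    (summable_weight_mul_norm_interpCoef_sq g g.primary hp) hb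
  have s2 := summable_weight_mul_density m c Δt he (s := 1) (by simp)
    (summable_weight_mul_norm_interpCoef_sq g g.primary
      (isPeriodic_stepP (c := c) (Δt := Δt) hp hv)) hb
  have h1 := (Complex.hasSum_re (hasSum_weight_mul_sub_mul_conj g g.primary
    (isPeriodic_incP g c Δt hv) (hasSum_incP g h0 hCFL hv) (stepP g c Δt p v + p))).mul_left (-2)
  simp only [Complex.zero_re, mul_zero] at h1
  have h2 := (s2.hasSum.sub s1.hasSum).unique (h1.congr_fun fun n => ?_)
  · exact (sub_eq_zero.1 h2).symm
  · rw [← mul_sub, density_sub_density_neg, mul_left_comm, ← Complex.re_ofReal_mul,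
      interpCoef_add, stepP_eq_add_incP, interpCoef_add, add_sub_cancel_left]

end Steps

theorem isPeriodic_scheme {d m : ℕ} (g : Grid d) (c Δt : ℝ) {p0 : NodalData d m}
    {v0 : Fin d → NodalData d m} (hp0 : p0.IsPeriodic g) (hv0 : ∀ i, (v0 i).IsPeriodic g) (n : ℕ) :
    (scheme g c Δt p0 v0 n).1.IsPeriodic g ∧ ∀ i, ((scheme g c Δt p0 v0 n).2 i).IsPeriodic g := by
  induction n with
  | zero => exact ⟨hp0, hv0⟩
  | succ n ih =>
    have hv := fun i => isPeriodic_stepV (c := c) (Δt := Δt) ih.1 ih.2 i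
    exact ⟨isPeriodic_stepP ih.1 hv, hv⟩

section Energies

variable {d m : ℕ} {g : Grid d} {c Δt : ℝ} {e : Fin d → ℝ} {p0 : NodalData d m}
  {v0 : Fin d → NodalData d m}

theorem energyQ_eq_tsum (he : ∑ i, e i ^ 2 = 1) (hp0 : p0.IsPeriodic g)
    (hv0 : ∀ i, (v0 i).IsPeriodic g) (n : ℕ) :
    energyQ g c Δt e p0 v0 n = ENNReal.ofReal (g.vol * ∑' k, weight g m k *
      density g c Δt e 1 (interpCoef g g.primary (scheme g c Δt p0 v0 n).1)
        (fun i => interpCoef g g.dual ((scheme g c Δt p0 v0 n).2 i)) k) :=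
  have h := isPeriodic_scheme g c Δt hp0 hv0 n
  energy_varP_eq m c Δt he (hasFourierSeries_interpolant g g.primary h.1)
    (fun i => hasFourierSeries_interpolant g g.dual (h.2 i))
    (summable_weight_mul_norm_interpCoef_sq g g.primary h.1)
    fun i => summable_weight_mul_norm_interpCoef_sq g g.dual (h.2 i)

theorem energyR_eq_tsum (he : ∑ i, e i ^ 2 = 1) (hp0 : p0.IsPeriodic g)
    (hv0 : ∀ i, (v0 i).IsPeriodic g) (n : ℕ) :
    energyR g c Δt e p0 v0 n = ENNReal.ofReal (g.vol * ∑' k, weight g m k *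
      density g c Δt e (-1) (interpCoef g g.primary (scheme g c Δt p0 v0 n).1)
        (fun i => interpCoef g g.dual ((scheme g c Δt p0 v0 (n + 1)).2 i)) k) :=
  have h := isPeriodic_scheme g c Δt hp0 hv0
  energy_varV_eq m c Δt he (hasFourierSeries_interpolant g g.primary (h n).1)
    (fun i => hasFourierSeries_interpolant g g.dual ((h (n + 1)).2 i))
    (summable_weight_mul_norm_interpCoef_sq g g.primary (h n).1)
    fun i => summable_weight_mul_norm_interpCoef_sq g g.dual ((h (n + 1)).2 i)

theorem energyQ_eq_energyR (h0 : 0 ≤ c * Δt) (hCFL : ∀ i, c * Δt ≤ g.h i)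
    (he : ∑ i, e i ^ 2 = 1) (hp0 : p0.IsPeriodic g) (hv0 : ∀ i, (v0 i).IsPeriodic g) (n : ℕ) :
    energyQ g c Δt e p0 v0 n = energyR g c Δt e p0 v0 n := by
  have h := isPeriodic_scheme g c Δt hp0 hv0 n
  rw [energyQ_eq_tsum he hp0 hv0, energyR_eq_tsum he hp0 hv0,
    tsum_density_stepV h0 hCFL he h.1 h.2]
  rfl

theorem energyR_eq_energyQ_succ (h0 : 0 ≤ c * Δt) (hCFL : ∀ i, c * Δt ≤ g.h i)
    (he : ∑ i, e i ^ 2 = 1) (hp0 : p0.IsPeriodic g) (hv0 : ∀ i, (v0 i).IsPeriodic g) (n : ℕ) :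
    energyR g c Δt e p0 v0 n = energyQ g c Δt e p0 v0 (n + 1) := by
  have h := isPeriodic_scheme g c Δt hp0 hv0
  rw [energyQ_eq_tsum he hp0 hv0, energyR_eq_tsum he hp0 hv0,
    tsum_density_stepP h0 hCFL he (h n).1 (h (n + 1)).2]
  rfl

end Energies

end
end HermiteLeapfrog

theorem mainTheorem2 {d : ℕ} (m : ℕ) (g : HermiteLeapfrog.Grid d) (c Δt : ℝ)
    (hc : 0 < c) (hΔt : 0 < Δt) (hCFL : ∀ i, c * Δt < g.h i)
    (e : Fin d → ℝ) (he : ∑ i, e i ^ 2 = 1)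
    (p0 : HermiteLeapfrog.NodalData d m) (v0 : Fin d → HermiteLeapfrog.NodalData d m)
    (hp0 : p0.IsPeriodic g) (hv0 : ∀ i, (v0 i).IsPeriodic g) (n : ℕ) :
    HermiteLeapfrog.energyQ g c Δt e p0 v0 n = HermiteLeapfrog.energyR g c Δt e p0 v0 n ∧
    HermiteLeapfrog.energyR g c Δt e p0 v0 n = HermiteLeapfrog.energyQ g c Δt e p0 v0 0 ∧
    HermiteLeapfrog.energyQ g c Δt e p0 v0 0 ≠ ⊤ := by
  have h0 : 0 ≤ c * Δt := (mul_pos hc hΔt).le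
  have hCFL' : ∀ i, c * Δt ≤ g.h i := fun i => (hCFL i).le
  have hQR := HermiteLeapfrog.energyQ_eq_energyR h0 hCFL' he hp0 hv0
  have hQ0 : ∀ n, HermiteLeapfrog.energyQ g c Δt e p0 v0 n =
      HermiteLeapfrog.energyQ g c Δt e p0 v0 0 := fun n => by
    induction n with
    | zero => rfl
    | succ n ih =>
      rw [← HermiteLeapfrog.energyR_eq_energyQ_succ h0 hCFL' he hp0 hv0, ← hQR, ih]
  refine ⟨hQR n, (hQR n).symm.trans (hQ0 n), ?_⟩
  rw [HermiteLeapfrog.energyQ_eq_tsum he hp0 hv0]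
  exact ENNReal.ofReal_ne_top
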